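/- Let $n$ be a natural number, let $\Bbbk$ be a field (of any characteristic), and let $(V,c)$ be an $n$-dimensional braided vector space of diagonal type over $\Bbbk$: $V$ has a basis $x_1,\dots,x_n$ and there is a matrix $\mathbf q=(q_{ij})\in(\Bbbk^\times)^{n\times n}$ such that $c(x_i\otimes x_j)=q_{ij}\,x_j\otimes x_i$ for all $i,j$. View the tensor algebra $T(V)$ as a braided bialgebra, with the coproduct $\Delta:T(V)\to T(V)\otimes T(V)$ which is the algebra map given by $v\mapsto v\otimes 1+1\otimes v$ for $v\in V$, where $T(V)\otimes T(V)$ carries the braided product $(a\otimes b)(a'\otimes b')=a\,c(b\otimes a')\,b'$. Let $\mathcal I(V)$ be the sum of all homogeneous two-sided ideals $I\subseteq\bigoplus_{k\ge 2}V^{\otimes k}$ of $T(V)$ with $\Delta(I)\subseteq I\otimes T(V)+T(V)\otimes I$, and let $\mathcal B(V)=T(V)/\mathcal I(V)$ be the Nichols algebra of $V$. For a ring element $q$ and $m\in\mathbb N_0$ put $(m)_q=1+q+\cdots+q^{m-1}$. Let $e_1,\dots,e_n$ be the standard basis vectors of $\mathbb N_0^n$ and $|m|=m_1+\cdots+m_n$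 for $m=(m_1,\dots,m_n)\in\mathbb N_0^n$. For $m\in\mathbb N_0^n$ with $|m|\ge 2$ define $P_m\in\mathbb Z[p_{ij}\mid 1\le i,j\le n]$ as follows, where $i\neq j$ in (2)–(7): 1. if $m=m_ie_i$, then $P_m=(m_i)_{p_{ii}}$; 2. if $m=e_i+m_je_j$ with $m_j\ge1$, then $P_m=1-p_{jj}^{m_j-1}p_{ij}p_{ji}$; 3. if $m=2e_i+m_je_j$ with $m_j\ge 1$, then $P_m=1+p_{jj}^{m_j(m_j-1)/2}(-p_{ij}p_{ji})^{m_j}p_{ii}$; 4. if $m=3e_i+3e_j$, then $P_m=(3)_{p_{ii}^2(p_{ij}p_{ji})^3p_{jj}^2}$; 5. if $m=3e_i+4e_j$, then $P_m=\bigl(1-p_{ii}^2(p_{ij}p_{ji})^4p_{jj}^4\bigr)\,(3)_{p_{ii}(p_{ij}p_{ji})^2p_{jj}^2}$; 6. if $m=3e_i+6e_j$, then $P_m=\bigl(1-p_{ii}(p_{ij}p_{ji})^3p_{jj}^5\bigr)\,(3)_{p_{ii}^2(p_{ij}p_{ji})^6p_{jj}^{10}}$; 7. if $m=4e_i+4e_j$,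 then $P_m=\bigl(1+p_{ii}^3(p_{ij}p_{ji})^4p_{jj}^3\bigr)\bigl(1+p_{ii}^6(p_{ij}p_{ji})^8p_{jj}^6\bigr)$; 8. otherwise, $P_m=1-\prod_{1\le i\le n}p_{ii}^{m_i(m_i-1)}\prod_{1\le i<j\le n}(p_{ij}p_{ji})^{m_im_j}$. (Where several cases or choices of $i,j$ apply, they give the same polynomial.) Then $\mathcal B(V)=T(V)$, that is, the canonical projection $T(V)\to\mathcal B(V)$ is bijective, if and only if $P_m(\mathbf q)\neq 0$ for every $m\in\mathbb N_0^n$ with $|m|\ge 2$. -/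

import Mathlib

open scoped TensorProduct

noncomputable section

/-! ### The Nichols algebra of a braided vector space -/

section Nichols

variable {K V : Type*} [Field K] [AddCommGroup V] [Module K V]

/-- Left multiplication `T(V) ⊗ (T(V) ⊗ V) → T(V) ⊗ V`, `s ⊗ (t ⊗ v) ↦ st ⊗ v`. -/
def tensorLeftMul (K V : Type*) [Field K] [AddCommGroup V] [Module K V] :
    TensorAlgebra K V ⊗[K] (TensorAlgebra K V ⊗[K] V) →ₗ[K] TensorAlgebra K V ⊗[K] V :=
  (LinearMap.mul' K (TensorAlgebra K V)).rTensor V ∘ₗ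
    (TensorProduct.assoc K (TensorAlgebra K V) (TensorAlgebra K V) V).symm.toLinearMap

/-- For `w ∈ V` and `f : V → T(V) ⊗ V`, the map `v ↦ ∑ w' · f(v')`, where
`c (v ⊗ w) = ∑ w' ⊗ v'`. -/
def braidingStep (c : V ⊗[K] V →ₗ[K] V ⊗[K] V) :
    V →ₗ[K] Module.End K (V →ₗ[K] TensorAlgebra K V ⊗[K] V) :=
  LinearMap.mk₂ K
    (fun w f => tensorLeftMul K V ∘ₗ TensorProduct.map (TensorAlgebra.ι K) f ∘ₗ c ∘ₗ
      (TensorProduct.mk K V V).flip w)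
    (fun w w' f => by ext v; simp)
    (fun a w f => by ext v; simp)
    (fun w f f' => by ext v; simp [TensorProduct.map_add_right])
    (fun a w f => by ext v; simp [TensorProduct.map_smul_right])

/-- The extension `c_{V,T(V)} : V ⊗ T(V) → T(V) ⊗ V` of the braiding `c` (in curried form). It is
determined by `v ⊗ 1 ↦ 1 ⊗ v` and `v ⊗ w t ↦ ∑ w' · c_{V,T(V)}(v' ⊗ t)` for `v, w ∈ V`, where
`c (v ⊗ w) = ∑ w' ⊗ v'`. -/
def braidingExt (c : V ⊗[K] V →ₗ[K] V ⊗[K] V) :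
    V →ₗ[K] TensorAlgebra K V →ₗ[K] TensorAlgebra K V ⊗[K] V :=
  LinearMap.flip <|
    (LinearMap.applyₗ (R := K) (TensorProduct.mk K (TensorAlgebra K V) V 1)) ∘ₗ
      (TensorAlgebra.lift K (braidingStep c)).toLinearMap

/-- Left multiplication by `v ⊗ 1 + 1 ⊗ v` in the braided tensor product algebra
`T(V) ⊗ T(V)`, whose product is `(a ⊗ b)(a' ⊗ b') = a c(b ⊗ a') b'`; that is,
`a ⊗ b ↦ v a ⊗ b + ∑ a' ⊗ v' b`, where `c_{V,T(V)}(v ⊗ a) = ∑ a' ⊗ v'`. -/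
def primitiveMul (c : V ⊗[K] V →ₗ[K] V ⊗[K] V) (v : V) :
    Module.End K (TensorAlgebra K V ⊗[K] TensorAlgebra K V) :=
  (LinearMap.mulLeft K (TensorAlgebra.ι K v)).rTensor (TensorAlgebra K V) +
    (LinearMap.mul' K (TensorAlgebra K V) ∘ₗ
        (TensorAlgebra.ι K).rTensor (TensorAlgebra K V)).lTensor (TensorAlgebra K V) ∘ₗ
      (TensorProduct.assoc K (TensorAlgebra K V) V (TensorAlgebra K V)).toLinearMap ∘ₗ
        (braidingExt c v).rTensor (TensorAlgebra K V)

/-- `primitiveMul` as a linear map in `v`. -/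
def primitiveMulₗ (c : V ⊗[K] V →ₗ[K] V ⊗[K] V) :
    V →ₗ[K] Module.End K (TensorAlgebra K V ⊗[K] TensorAlgebra K V) where
  toFun := primitiveMul c
  map_add' v w := by
    ext a b
    simp [primitiveMul, add_mul, TensorProduct.add_tmul]
    abel
  map_smul' r v := by
    ext a b
    simp [primitiveMul, ← TensorProduct.smul_tmul']

/-- The braided coproduct of the tensor algebra: the algebra map from `T(V)` to the braided tensor
product algebra `T(V) ⊗ T(V)` with `v ↦ v ⊗ 1 + 1 ⊗ v` for `v ∈ V`. -/
def braidedComul (c : V ⊗[K] V →ₗ[K] V ⊗[K] V) :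
    TensorAlgebra K V →ₗ[K] TensorAlgebra K V ⊗[K] TensorAlgebra K V :=
  (LinearMap.applyₗ (R := K) (1 ⊗ₜ[K] 1)) ∘ₗ
    (TensorAlgebra.lift K (primitiveMulₗ c)).toLinearMap

/-- A two-sided ideal of `T(V)` as a `K`-subspace. -/
def TwoSidedIdeal.toSubspace (I : TwoSidedIdeal (TensorAlgebra K V)) :
    Submodule K (TensorAlgebra K V) :=
  (TwoSidedIdeal.asIdeal I).restrictScalars K

/-- The homogeneous component of degree `d` of an element of `T(V)`. -/
def tensorComponent (d : ℕ) (t : TensorAlgebra K V) : TensorAlgebra K V :=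
  DirectSum.decompose (fun k : ℕ => LinearMap.range (TensorAlgebra.ι K : V →ₗ[K] _) ^ k) t d

/-- Homogeneous two-sided ideals of `T(V)` which are generated in degrees at least two and are
coideals for the braided coproduct. -/
structure IsNicholsCoideal (c : V ⊗[K] V →ₗ[K] V ⊗[K] V)
    (I : TwoSidedIdeal (TensorAlgebra K V)) : Prop where
  homogeneous : ∀ t ∈ I, ∀ d : ℕ, tensorComponent d t ∈ I
  two_le_degree : ∀ t ∈ I, ∀ d < 2, tensorComponent d t = 0
  coideal : ∀ t ∈ I, braidedComul c t ∈
    LinearMap.range (I.toSubspace.subtype.rTensor (TensorAlgebra K V)) ⊔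
      LinearMap.range (I.toSubspace.subtype.lTensor (TensorAlgebra K V))

/-- The defining ideal of the Nichols algebra: the sum of all homogeneous ideals of `T(V)` which
are generated in degrees at least two and are coideals. -/
def nicholsIdeal (c : V ⊗[K] V →ₗ[K] V ⊗[K] V) : TwoSidedIdeal (TensorAlgebra K V) :=
  sSup {I | IsNicholsCoideal c I}

/-- The Nichols algebra `B(V)` of the braided vector space `(V, c)`. -/
abbrev NicholsAlgebra (c : V ⊗[K] V →ₗ[K] V ⊗[K] V) : Type _ :=
  (nicholsIdeal c).ringCon.Quotient

/-- The canonical projection `T(V) → B(V)`. -/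
def NicholsAlgebra.proj (c : V ⊗[K] V →ₗ[K] V ⊗[K] V) :
    TensorAlgebra K V →ₐ[K] NicholsAlgebra c :=
  (nicholsIdeal c).ringCon.mkₐ K

/-- `(V, c)` is of diagonal type with respect to the basis `x`, with braiding matrix `q`. -/
structure IsDiagonalBraiding {n : ℕ} (c : V ⊗[K] V →ₗ[K] V ⊗[K] V)
    (x : Module.Basis (Fin n) K V) (q : Matrix (Fin n) (Fin n) K) : Prop where
  ne_zero : ∀ i j, q i j ≠ 0
  braiding : ∀ i j, c (x i ⊗ₜ[K] x j) = q i j • (x j ⊗ₜ[K] x i)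

end Nichols

/-! ### The polynomials `P_m` -/

section Polynomials

open MvPolynomial

/-- `(m)_q = 1 + q + ⋯ + q ^ (m - 1)`. -/
def qNumber {R : Type*} [Semiring R] (m : ℕ) (q : R) : R :=
  ∑ k ∈ Finset.range m, q ^ k

/-- The variable `p_ij` of `ℤ[p_ij | 1 ≤ i, j ≤ n]`. -/
abbrev pVar {n : ℕ} (i j : Fin n) : MvPolynomial (Fin n × Fin n) ℤ := X (i, j)

/-- `m = a e_i + b e_j` with `i ≠ j`, where `s = (i, j)`. -/
def IsTwoTerm {n : ℕ} (m : Fin n → ℕ) (a b : ℕ) (s : Fin n × Fin n) : Prop :=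
  s.1 ≠ s.2 ∧ m = Pi.single s.1 a + Pi.single s.2 b

open Classical in
/-- The polynomial `P_m`, for `m ∈ ℕ₀ⁿ` with `|m| ≥ 2`. Where the pair `(i, j)` in one of the cases
is not unique, the polynomial does not depend on its choice. -/
def nicholsP {n : ℕ} (m : Fin n → ℕ) : MvPolynomial (Fin n × Fin n) ℤ :=
  if h : ∃ i : Fin n, m = Pi.single i (m i) then
    qNumber (m h.choose) (pVar h.choose h.choose)
  else if h : ∃ s : Fin n × Fin n, 0 < m s.2 ∧ IsTwoTerm m 1 (m s.2) s then
    let i := h.choose.1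
    let j := h.choose.2
    1 - pVar j j ^ (m j - 1) * (pVar i j * pVar j i)
  else if h : ∃ s : Fin n × Fin n, 0 < m s.2 ∧ IsTwoTerm m 2 (m s.2) s then
    let i := h.choose.1
    let j := h.choose.2
    1 + pVar j j ^ (m j * (m j - 1) / 2) * (-(pVar i j * pVar j i)) ^ m j * pVar i i
  else if h : ∃ s : Fin n × Fin n, IsTwoTerm m 3 3 s then
    let i := h.choose.1
    let j := h.choose.2
    qNumber 3 (pVar i i ^ 2 * (pVar i j * pVar j i) ^ 3 * pVar j j ^ 2)
  else if h : ∃ s : Fin n × Fin n, IsTwoTerm m 3 4 s then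
    let i := h.choose.1
    let j := h.choose.2
    (1 - pVar i i ^ 2 * (pVar i j * pVar j i) ^ 4 * pVar j j ^ 4) *
      qNumber 3 (pVar i i * (pVar i j * pVar j i) ^ 2 * pVar j j ^ 2)
  else if h : ∃ s : Fin n × Fin n, IsTwoTerm m 3 6 s then
    let i := h.choose.1
    let j := h.choose.2
    (1 - pVar i i * (pVar i j * pVar j i) ^ 3 * pVar j j ^ 5) *
      qNumber 3 (pVar i i ^ 2 * (pVar i j * pVar j i) ^ 6 * pVar j j ^ 10)
  else if h : ∃ s : Fin n × Fin n, IsTwoTerm m 4 4 s then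
    let i := h.choose.1
    let j := h.choose.2
    (1 + pVar i i ^ 3 * (pVar i j * pVar j i) ^ 4 * pVar j j ^ 3) *
      (1 + pVar i i ^ 6 * (pVar i j * pVar j i) ^ 8 * pVar j j ^ 6)
  else
    1 - (∏ i, pVar i i ^ (m i * (m i - 1))) *
      ∏ i, ∏ j ∈ Finset.Ioi i, (pVar i j * pVar j i) ^ (m i * m j)

/-- The value `P(q)` of a polynomial `P ∈ ℤ[p_ij]` at a matrix `q`. -/
def evalAtMatrix {K : Type*} [Field K] {n : ℕ} (q : Matrix (Fin n) (Fin n) K)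
    (P : MvPolynomial (Fin n × Fin n) ℤ) : K :=
  aeval (fun s : Fin n × Fin n => q s.1 s.2) P

end Polynomials

end

/-!
The ideal defining `B(V)` is the radical of the skew derivations `∂ j`: an element of `T(V)` lies
in it iff all its iterated skew derivatives have zero constant term. Hence `B(V) = T(V)` iff, in
every positive degree `d`, the map `t ↦ ∑ j, ∂ j t * x j` is invertible; in the basis of words it
is the matrix `shuffleMatrix q d`.

Over `ℤ[p_ij]` there is a factorization
`(1 - rotation) * shuffle (d + 2) = cons (shuffle (d + 1)) * (1 - twisted rotation)`, in which the
two outer matrices are of the form `1 - weighted permutation` and respect the multidegree. The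
determinant of such a matrix is a product over the orbits of words under rotation; an orbit of
words with `r`-fold symmetry and multidegree `l` contributes a factor `1 - σ ^ (1 / r)` for a
monomial `σ` depending only on `l`. So the part in multidegree `l` of the quotient of determinants
is a product of such factors, and the exponent of the factor with `r = 1` is positive except for
the multidegrees supported at one letter and `(1, m)`, `(2, m)`, `(3, 3)`, `(3, 4)`, `(3, 6)`,
`(4, 4)`: the periodic words are outnumbered. In the exceptional multidegrees the exponents are
computed explicitly. In each case the quotient vanishes at the same points as `P_l`.
-/

/-! ### Determinants of weighted permutations -/

section WeightedPermMatrix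

open Equiv.Perm Finset Function

variable {ι R : Type*} [CommRing R]

/-- The matrix of the operator `F ↦ (w ↦ s w * F (f w))` on functions `ι → R`. -/
def weightedPermMatrix [DecidableEq ι] (f : Equiv.Perm ι) (s : ι → R) : Matrix ι ι R :=
  Matrix.of fun w v => if v = f w then s w else 0

theorem weightedPermMatrix_mulVec [Fintype ι] [DecidableEq ι] (f : Equiv.Perm ι) (s F : ι → R)
    (w : ι) : (weightedPermMatrix f s).mulVec F w = s w * F (f w) := by
  simp [weightedPermMatrix, Matrix.mulVec, dotProduct]

theorem eq_one_or_eq_of_forall_sameCycle [Finite ι] {f σ : Equiv.Perm ι}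
    (hf : ∀ x y, f.SameCycle x y) (hσ : ∀ x, σ x = x ∨ σ x = f x) : σ = 1 ∨ σ = f := by
  by_cases! h : ∃ x, σ x = x
  · obtain ⟨x, hx⟩ := h
    have fixed_inv (y : ι) (hy : σ y = y) : σ (f⁻¹ y) = f⁻¹ y :=
      (hσ (f⁻¹ y)).elim id fun h => by
        rw [σ.injective (h.trans ((f.apply_symm_apply y).trans hy.symm)), hy]
    have fixed_inv_pow (k : ℕ) : σ ((f⁻¹ ^ k) x) = (f⁻¹ ^ k) x := by
      induction k with
      | zero => exact hx
      | succ k ih => rw [pow_succ']; exact fixed_inv _ ih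
    refine Or.inl (Equiv.ext fun y => ?_)
    obtain ⟨k, -, rfl⟩ := (sameCycle_inv.2 (hf x y)).exists_pow_eq'
    exact fixed_inv_pow k
  · exact Or.inr (Equiv.ext fun x => (hσ x).resolve_left (h x))

theorem bijOn_iterate_minimalPeriod [Finite ι] (f : Equiv.Perm ι) (w : ι) :
    Set.BijOn (fun i => f^[i] w) (Set.Iio (minimalPeriod f w)) {v | f.SameCycle w v} := by
  refine ⟨fun i _ => ⟨i, by rw [zpow_natCast, coe_pow]⟩, iterate_injOn_Iio_minimalPeriod,
    fun v hv => ?_⟩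
  have mem_periodicPts : w ∈ periodicPts f := by
    refine mk_mem_periodicPts (orderOf_pos f) ?_
    rw [IsPeriodicPt, IsFixedPt, ← coe_pow, pow_orderOf_eq_one, one_apply]
  obtain ⟨k, -, hk⟩ := SameCycle.exists_pow_eq' hv
  refine ⟨k % minimalPeriod f w,
    Nat.mod_lt _ (minimalPeriod_pos_of_mem_periodicPts mem_periodicPts), ?_⟩
  simp only [iterate_mod_minimalPeriod_eq, ← coe_pow, hk]

variable [Fintype ι]

theorem prod_range_minimalPeriod (f : Equiv.Perm ι) (s : ι → R) (w : ι)
    [DecidablePred (f.SameCycle w)] :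
    ∏ i ∈ range (minimalPeriod f w), s (f^[i] w) = ∏ v with f.SameCycle w v, s v := by
  obtain ⟨mapsTo, injOn, surjOn⟩ := bijOn_iterate_minimalPeriod f w
  exact prod_nbij (fun i => f^[i] w) (fun i hi => by simpa using mapsTo (by simpa using hi))
    (by simpa using injOn) (by simpa using surjOn) (fun _ _ => rfl)

theorem card_sameCycle (f : Equiv.Perm ι) (w : ι) [DecidablePred (f.SameCycle w)] :
    #{v | f.SameCycle w v} = minimalPeriod f w := by
  obtain ⟨mapsTo, injOn, surjOn⟩ := bijOn_iterate_minimalPeriod f w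
  rw [← card_range (minimalPeriod f w)]
  exact (card_nbij (fun i => f^[i] w) (fun i hi => by simpa using mapsTo (by simpa using hi))
    (by simpa using injOn) (by simpa using surjOn)).symm

variable [DecidableEq ι]

theorem det_one_sub_weightedPermMatrix_of_isCycle {f : Equiv.Perm ι} (hf : f.IsCycle)
    (hsupp : f.support = univ) (s : ι → R) :
    (1 - weightedPermMatrix f s).det = 1 - ∏ w, s w := by
  have hne (w : ι) : f w ≠ w := by simpa using hsupp.ge (mem_univ w)
  have sameCycle (x y : ι) : f.SameCycle x y := hf.sameCycle (hne x) (hne y)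
  have entry_self (w : ι) : (1 - weightedPermMatrix f s) w w = 1 := by
    simp [weightedPermMatrix, (hne w).symm]
  have entry_apply (w : ι) : (1 - weightedPermMatrix f s) w (f w) = -s w := by
    simp [weightedPermMatrix, Matrix.one_apply_ne (hne w).symm]
  have sign_sq : ((-1 : R) ^ Fintype.card ι) * (-1) ^ Fintype.card ι = 1 := by simp [← mul_pow]
  rw [← Matrix.det_transpose, Matrix.det_apply', ← sum_subset (subset_univ {1, f}),
    sum_pair hf.ne_one.symm]
  · simp only [Matrix.transpose_apply, Equiv.Perm.one_apply, entry_self, entry_apply,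
      Equiv.Perm.sign_one, hf.sign, hsupp, card_univ, prod_const_one, prod_neg]
    push_cast
    linear_combination (-(∏ x, s x)) * sign_sq
  · intro σ _ hσ
    contrapose! hσ
    rw [mem_insert, mem_singleton]
    refine eq_one_or_eq_of_forall_sameCycle sameCycle fun x => ?_
    by_contra! hx
    refine hσ (mul_eq_zero_of_right _ (prod_eq_zero (mem_univ x) ?_))
    simp [weightedPermMatrix, Matrix.one_apply_ne hx.1.symm, hx.2]

theorem det_one_sub_weightedPermMatrix_of_sameCycle [Nonempty ι] (f : Equiv.Perm ι) (s : ι → R)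
    (hf : ∀ x y, f.SameCycle x y) : (1 - weightedPermMatrix f s).det = 1 - ∏ w, s w := by
  by_cases! h : ∃ x, f x = x
  · obtain ⟨x, hx⟩ := h
    have eq_x (y : ι) : y = x := by
      obtain ⟨k, rfl⟩ := hf x y
      exact zpow_apply_eq_self_of_apply_eq_self hx k
    let _ : Unique ι := ⟨⟨x⟩, eq_x⟩
    rw [Matrix.det_unique, Fintype.prod_unique]
    simp [weightedPermMatrix, Subsingleton.elim _ (default : ι)]
  · obtain ⟨x⟩ := ‹Nonempty ι›
    exact det_one_sub_weightedPermMatrix_of_isCycle ⟨x, h x, fun y _ => hf x y⟩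
      (by ext y; simpa using h y) s

open Classical in
theorem det_one_sub_weightedPermMatrix (f : Equiv.Perm ι) (s : ι → R) :
    (1 - weightedPermMatrix f s).det =
      ∏ k : Quotient (SameCycle.setoid f), (1 - ∏ w with Quotient.mk _ w = k, s w) := by
  let Q := Quotient (SameCycle.setoid f)
  let cycle : ι → Q := Quotient.mk _
  have cycle_eq (w v : ι) : cycle w = cycle v ↔ f.SameCycle w v :=
    Quotient.eq (r := SameCycle.setoid f)
  have cycle_apply (w : ι) : cycle (f w) = cycle w :=
    (cycle_eq _ _).2 (sameCycle_apply_left.2 (SameCycle.refl f w))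
  let : LinearOrder Q := IsWellOrder.linearOrder WellOrderingRel
  have blockTriangular : (1 - weightedPermMatrix f s).BlockTriangular cycle := by
    intro w v h
    have hne : w ≠ v := by rintro rfl; exact lt_irrefl _ h
    have hne' : v ≠ f w := by rintro rfl; rw [cycle_apply] at h; exact lt_irrefl _ h
    simp [weightedPermMatrix, Matrix.one_apply_ne hne, hne']
  rw [blockTriangular.det_fintype]
  refine prod_congr rfl fun k _ => ?_
  have mem_block (w : ι) : cycle (f w) = k ↔ cycle w = k := by rw [cycle_apply]
  have block_eq : (1 - weightedPermMatrix f s).toSquareBlock cycle k =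
      1 - weightedPermMatrix (f.subtypePerm mem_block) (fun w => s w) := by
    ext w v
    simp [Matrix.toSquareBlock_def, weightedPermMatrix, Matrix.one_apply, Subtype.ext_iff]
  obtain ⟨x, hx⟩ := Quotient.exists_rep k
  have : Nonempty {w // cycle w = k} := ⟨⟨x, hx⟩⟩
  rw [block_eq, det_one_sub_weightedPermMatrix_of_sameCycle]
  · exact congrArg (1 - ·) (prod_subtype _ (by simp [cycle]) _).symm
  · rintro ⟨y, hy⟩ ⟨z, hz⟩
    rw [sameCycle_subtypePerm, ← cycle_eq, hy, hz]

/- Each cycle of length `m` contributes the same factor for each of its `m` points; the exponent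
`d / m` makes up for this. -/
theorem det_one_sub_weightedPermMatrix_pow (f : Equiv.Perm ι) (s : ι → R) {d : ℕ}
    (hd : ∀ w, f^[d] w = w) :
    (1 - weightedPermMatrix f s).det ^ d =
      ∏ w, (1 - ∏ i ∈ range (minimalPeriod f w), s (f^[i] w)) ^ (d / minimalPeriod f w) := by
  classical
  rw [det_one_sub_weightedPermMatrix, ← prod_pow,
    ← prod_fiberwise _ (Quotient.mk (SameCycle.setoid f))]
  refine prod_congr rfl fun k _ => ?_
  obtain ⟨x, rfl⟩ := Quotient.exists_rep k
  have mem_cycle (w v : ι) : Quotient.mk (SameCycle.setoid f) v = Quotient.mk _ w ↔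
      f.SameCycle w v := eq_comm.trans Quotient.eq
  have factor_eq (w : ι) (hw : f.SameCycle x w) :
      (1 - ∏ i ∈ range (minimalPeriod f w), s (f^[i] w)) ^ (d / minimalPeriod f w) =
        (1 - ∏ v with f.SameCycle x v, s v) ^ (d / minimalPeriod f x) := by
    have sameCycle_iff (v : ι) : f.SameCycle w v ↔ f.SameCycle x v :=
      ⟨hw.trans, hw.symm.trans⟩
    rw [prod_range_minimalPeriod, ← card_sameCycle f w, ← card_sameCycle f x]
    simp only [sameCycle_iff]
  simp only [mem_cycle]
  rw [prod_congr rfl fun w hw => factor_eq w (mem_filter.1 hw).2, prod_const, ← pow_mul,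
    card_sameCycle, Nat.div_mul_cancel (IsPeriodicPt.minimalPeriod_dvd (hd x))]

end WeightedPermMatrix

/-! ### The shuffle operators on words -/

section Words

variable {α R : Type*} [CommRing R] {d : ℕ}

/-- The factor by which the letter `i` is braided past the word `w`. -/
def wordChar (p : α → α → R) (i : α) (w : Fin d → α) : R :=
  ∏ k, p i (w k)

theorem wordChar_cons (p : α → α → R) (i a : α) (w : Fin d → α) :
    wordChar p i (Fin.cons a w : Fin (d + 1) → α) = p i a * wordChar p i w := by
  simp [wordChar, Fin.prod_univ_succ]

theorem wordChar_snoc (p : α → α → R) (i a : α) (w : Fin d → α) :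
    wordChar p i (Fin.snoc w a : Fin (d + 1) → α) = wordChar p i w * p i a := by
  simp [wordChar, Fin.prod_univ_castSucc]

/-- Cyclic rotation of words: the first letter is moved to the end. -/
def rotateWord (α : Type*) (d : ℕ) : Equiv.Perm (Fin d → α) :=
  Equiv.arrowCongr (finRotate d).symm (Equiv.refl _)

theorem rotateWord_apply (w : Fin d → α) (k : Fin d) :
    rotateWord α d w k = w (finRotate d k) := rfl

theorem rotateWord_cons (i : α) (s : Fin d → α) :
    rotateWord α (d + 1) (Fin.cons i s) = Fin.snoc s i := by
  ext k
  rw [rotateWord_apply]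
  cases k using Fin.lastCases <;> simp

/-- The weight of the rotation of a word `w` which is followed by the letter `j`, where the first
letter of `w` is braided past the other letters of `w` once and past `j` in both directions. -/
def twistedWeight (p : α → α → R) (j : α) (w : Fin (d + 1) → α) : R :=
  wordChar p (w 0) (Fin.tail w) * (p (w 0) j * p j (w 0))

/-- The function `v j ↦ p j i * F (v i j)` on words. -/
def insertBeforeLast (p : α → α → R) (F : (Fin (d + 2) → α) → R) (i : α)
    (u : Fin (d + 1) → α) : R :=
  p (u (Fin.last d)) i * F (Fin.snoc (Fin.snoc (Fin.init u) i) (u (Fin.last d)))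

theorem insertBeforeLast_snoc (p : α → α → R) (F : (Fin (d + 2) → α) → R) (i j : α)
    (v : Fin d → α) : insertBeforeLast p F i (Fin.snoc v j) =
      p j i * F (Fin.snoc (Fin.snoc v i : Fin (d + 1) → α) j) := by
  simp [insertBeforeLast]

theorem insertBeforeLast_cons (p : α → α → R) (F : (Fin (d + 3) → α) → R) (i a : α) :
    insertBeforeLast p (fun v => F (Fin.cons a v)) i =
      fun v => insertBeforeLast p F i (Fin.cons a v) := by
  ext v
  cases v using Fin.snocCases with
  | snoc v j => simp only [Fin.cons_snoc_eq_snoc_cons, insertBeforeLast_snoc]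

theorem sum_word_cons [Fintype α] {M : Type*} [AddCommMonoid M] (F : (Fin (d + 1) → α) → M) :
    ∑ w, F w = ∑ i, ∑ s, F (Fin.cons i s) := by
  rw [← Fintype.sum_prod_type', ← (Fin.consEquiv fun _ => α).sum_comp]
  rfl

theorem sum_word_snoc [Fintype α] {M : Type*} [AddCommMonoid M] (F : (Fin (d + 1) → α) → M) :
    ∑ w, F w = ∑ i, ∑ s, F (Fin.snoc s i) := by
  rw [← Fintype.sum_prod_type', ← (Fin.snocEquiv fun _ => α).sum_comp]
  rfl

variable [DecidableEq α]

/-- The block diagonal matrix on words with a block `M` for each first letter. -/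
def consMatrix (M : Matrix (Fin d → α) (Fin d → α) R) :
    Matrix (Fin (d + 1) → α) (Fin (d + 1) → α) R :=
  Matrix.of fun w v => if w 0 = v 0 then M (Fin.tail w) (Fin.tail v) else 0

/-- The block diagonal matrix on words with the block `M j` for the last letter `j`. -/
def snocMatrix (M : α → Matrix (Fin d → α) (Fin d → α) R) :
    Matrix (Fin (d + 1) → α) (Fin (d + 1) → α) R :=
  Matrix.of fun w v =>
    if w (Fin.last d) = v (Fin.last d) then M (w (Fin.last d)) (Fin.init w) (Fin.init v) else 0

/-- The matrix of the rotation of words, braiding the first letter past all the others. -/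
def rotationMatrix (p : α → α → R) (d : ℕ) : Matrix (Fin (d + 1) → α) (Fin (d + 1) → α) R :=
  weightedPermMatrix (rotateWord α (d + 1)) fun w => wordChar p (w 0) (Fin.tail w)

/-- The matrix of the rotation of words `w` which are followed by the letter `j`, weighted by
`twistedWeight p j`. -/
def twistedRotationMatrix (p : α → α → R) (d : ℕ) (j : α) :
    Matrix (Fin (d + 1) → α) (Fin (d + 1) → α) R :=
  weightedPermMatrix (rotateWord α (d + 1)) (twistedWeight p j)

/-- The matrix, in the row convention, of the operator on words of length `d` which sends a word to
the sum, over all its letters, of the words in which this letter is braided to the end. It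
describes the total skew derivation `t ↦ ∑ j, ∂ j t * x j` in degree `d`. -/
def shuffleMatrix (p : α → α → R) : (d : ℕ) → Matrix (Fin d → α) (Fin d → α) R
  | 0 => 0
  | d + 1 => consMatrix (shuffleMatrix p d) + rotationMatrix p d

theorem shuffleMatrix_one (p : α → α → R) : shuffleMatrix p 1 = 1 := by
  ext w v
  simp [shuffleMatrix, consMatrix, rotationMatrix, weightedPermMatrix, wordChar, rotateWord,
    Matrix.one_apply, eq_comm]

theorem map_shuffleMatrix {S : Type*} [CommRing S] (φ : R →+* S) (p : α → α → R) (d : ℕ) :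
    (shuffleMatrix p d).map φ = shuffleMatrix (fun i j => φ (p i j)) d := by
  induction d with
  | zero => ext; simp [shuffleMatrix]
  | succ d ih =>
    ext w v
    have ih_apply := congrFun₂ ih (Fin.tail w) (Fin.tail v)
    rw [Matrix.map_apply] at ih_apply
    simp [shuffleMatrix, consMatrix, rotationMatrix, weightedPermMatrix, wordChar, apply_ite φ,
      ih_apply]

variable [Fintype α]

theorem consMatrix_mulVec (M : Matrix (Fin d → α) (Fin d → α) R) (F : (Fin (d + 1) → α) → R)
    (i : α) (s : Fin d → α) :
    (consMatrix M).mulVec F (Fin.cons i s) = M.mulVec (fun v => F (Fin.cons i v)) s := by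
  simp only [Matrix.mulVec, dotProduct, consMatrix, sum_word_cons]
  rw [Finset.sum_eq_single i] <;> simp +contextual [eq_comm]

theorem snocMatrix_mulVec (M : α → Matrix (Fin d → α) (Fin d → α) R) (F : (Fin (d + 1) → α) → R)
    (s : Fin d → α) (j : α) :
    (snocMatrix M).mulVec F (Fin.snoc s j) = (M j).mulVec (fun v => F (Fin.snoc v j)) s := by
  simp only [Matrix.mulVec, dotProduct, snocMatrix, sum_word_snoc]
  rw [Finset.sum_eq_single j] <;> simp +contextual [eq_comm]

theorem det_consMatrix (M : Matrix (Fin d → α) (Fin d → α) R) :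
    (consMatrix M).det = M.det ^ Fintype.card α := by
  let e := (Equiv.prodComm _ _).trans (Fin.consEquiv (n := d) fun _ => α)
  have blockDiagonal : (consMatrix M).submatrix e e = Matrix.blockDiagonal fun _ : α => M := by
    ext ⟨s, i⟩ ⟨t, j⟩
    simp [consMatrix, Matrix.blockDiagonal_apply, e, Fin.consEquiv]
  rw [← Matrix.det_submatrix_equiv_self e, blockDiagonal, Matrix.det_blockDiagonal,
    Finset.prod_const, Finset.card_univ]

theorem det_one_sub_snocMatrix (M : α → Matrix (Fin d → α) (Fin d → α) R) :
    (1 - snocMatrix M).det = ∏ j, (1 - M j).det := by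
  let e := (Equiv.prodComm _ _).trans (Fin.snocEquiv (n := d) fun _ => α)
  have blockDiagonal : (1 - snocMatrix M).submatrix e e =
      Matrix.blockDiagonal fun j => 1 - M j := by
    ext ⟨s, i⟩ ⟨t, j⟩
    by_cases h : i = j <;>
      simp [snocMatrix, Matrix.blockDiagonal_apply, e, Fin.snocEquiv, Matrix.one_apply,
        Fin.snoc_inj, h]
  rw [← Matrix.det_submatrix_equiv_self e, blockDiagonal, Matrix.det_blockDiagonal]

variable (p : α → α → R)

theorem rotationMatrix_mulVec (F : (Fin (d + 1) → α) → R) (i : α) (s : Fin d → α) :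
    (rotationMatrix p d).mulVec F (Fin.cons i s) = wordChar p i s * F (Fin.snoc s i) := by
  rw [rotationMatrix, weightedPermMatrix_mulVec, rotateWord_cons, Fin.cons_zero, Fin.tail_cons]

theorem shuffleMatrix_mulVec_cons (F : (Fin (d + 1) → α) → R) (i : α) (s : Fin d → α) :
    (shuffleMatrix p (d + 1)).mulVec F (Fin.cons i s) =
      (shuffleMatrix p d).mulVec (fun v => F (Fin.cons i v)) s +
        wordChar p i s * F (Fin.snoc s i) := by
  rw [shuffleMatrix, Matrix.add_mulVec, Pi.add_apply, consMatrix_mulVec, rotationMatrix_mulVec]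

theorem shuffleMatrix_mulVec_wordChar_mul (i : α) (F : (Fin d → α) → R) (s : Fin d → α) :
    (shuffleMatrix p d).mulVec (fun v => wordChar p i v * F v) s =
      wordChar p i s * (shuffleMatrix p d).mulVec F s := by
  induction d with
  | zero => simp [shuffleMatrix]
  | succ d ih =>
    cases s using Fin.consCases with
    | cons a s =>
      have ih_cons : (shuffleMatrix p d).mulVec
          (fun v => p i a * wordChar p i v * F (Fin.cons a v)) s =
          p i a * (wordChar p i s * (shuffleMatrix p d).mulVec (fun v => F (Fin.cons a v)) s) := by
        rw [← ih]
        simpa only [Pi.smul_def, smul_eq_mul, mul_assoc] using congrFun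
          (Matrix.mulVec_smul (shuffleMatrix p d) (p i a)
            fun v => wordChar p i v * F (Fin.cons a v)) s
      simp only [shuffleMatrix_mulVec_cons, wordChar_cons, wordChar_snoc, ih_cons]
      ring

theorem shuffleMatrix_mulVec_snoc (F : (Fin (d + 2) → α) → R) (s : Fin (d + 1) → α) (i : α) :
    (shuffleMatrix p (d + 2)).mulVec F (Fin.snoc s i) =
      F (Fin.snoc s i) + (shuffleMatrix p (d + 1)).mulVec (insertBeforeLast p F i) s := by
  induction d with
  | zero =>
    cases s using Fin.consCases with
    | cons a s =>
      have cons_eq_snoc : (Fin.cons a s : Fin 1 → α) = Fin.snoc s a := by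
        ext k
        fin_cases k
        rfl
      rw [← Fin.cons_snoc_eq_snoc_cons, shuffleMatrix_mulVec_cons, shuffleMatrix_one,
        Matrix.one_mulVec, Matrix.one_mulVec, Fin.cons_snoc_eq_snoc_cons, cons_eq_snoc,
        insertBeforeLast_snoc, wordChar_snoc]
      simp [wordChar]
  | succ d ih =>
    cases s using Fin.consCases with
    | cons a s =>
      rw [← Fin.cons_snoc_eq_snoc_cons, shuffleMatrix_mulVec_cons, ih, shuffleMatrix_mulVec_cons,
        wordChar_snoc, insertBeforeLast_cons, insertBeforeLast_snoc]
      ring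

theorem one_sub_rotationMatrix_mul_shuffleMatrix (d : ℕ) :
    (1 - rotationMatrix p (d + 1)) * shuffleMatrix p (d + 2) =
      consMatrix (shuffleMatrix p (d + 1)) * (1 - snocMatrix (twistedRotationMatrix p d)) := by
  apply Matrix.mulVec_injective
  ext F w
  cases w using Fin.consCases with
  | cons i s =>
  have one_sub_snocMatrix_mulVec :
      (fun v => (1 - snocMatrix (twistedRotationMatrix p d)).mulVec F (Fin.cons i v)) =
        (fun v => F (Fin.cons i v)) - fun v => wordChar p i v * insertBeforeLast p F i v := by
    ext v
    rw [Matrix.sub_mulVec, Matrix.one_mulVec, Pi.sub_apply, Pi.sub_apply]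
    congr 1
    cases v using Fin.snocCases with
    | snoc v j =>
    rw [Fin.cons_snoc_eq_snoc_cons, snocMatrix_mulVec, twistedRotationMatrix,
      weightedPermMatrix_mulVec, rotateWord_cons, insertBeforeLast_snoc, twistedWeight,
      wordChar_snoc, Fin.cons_zero, Fin.tail_cons]
    ring
  rw [← Matrix.mulVec_mulVec, ← Matrix.mulVec_mulVec, Matrix.sub_mulVec, Matrix.one_mulVec,
    Pi.sub_apply, rotationMatrix_mulVec, shuffleMatrix_mulVec_cons, shuffleMatrix_mulVec_snoc,
    consMatrix_mulVec, one_sub_snocMatrix_mulVec, Matrix.mulVec_sub, Pi.sub_apply,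
    shuffleMatrix_mulVec_wordChar_mul]
  ring

theorem det_shuffleMatrix_succ (d : ℕ) :
    (1 - rotationMatrix p (d + 1)).det * (shuffleMatrix p (d + 2)).det =
      (shuffleMatrix p (d + 1)).det ^ Fintype.card α *
        ∏ j, (1 - twistedRotationMatrix p d j).det := by
  rw [← Matrix.det_mul, one_sub_rotationMatrix_mul_shuffleMatrix, Matrix.det_mul, det_consMatrix,
    det_one_sub_snocMatrix]

end Words

/-! ### Degrees and roots of words -/

section Degrees

open Finset Function

variable {α R : Type*} [CommRing R] {d : ℕ}

theorem rotateWord_iterate_apply (w : Fin (d + 1) → α) (i : ℕ) (k : Fin (d + 1)) :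
    (rotateWord α (d + 1))^[i] w k = w (k + Fin.ofNat (d + 1) i) := by
  induction i generalizing k with
  | zero => simp
  | succ i ih =>
    have shift : finRotate (d + 1) k + Fin.ofNat (d + 1) i = k + Fin.ofNat (d + 1) (i + 1) := by
      ext
      simp [Fin.val_add, add_comm, add_left_comm]
    rw [iterate_succ_apply', rotateWord_apply, ih, shift]

theorem rotateWord_iterate_length (w : Fin (d + 1) → α) :
    (rotateWord α (d + 1))^[d + 1] w = w := by
  ext k
  simp [rotateWord_iterate_apply]

theorem sum_range_rotateWord_zero (w : Fin (d + 1) → α) {M : Type*} [AddCommMonoid M]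
    (F : α → M) :
    ∑ i ∈ range (d + 1), F ((rotateWord α (d + 1))^[i] w 0) = ∑ k, F (w k) := by
  simp [sum_range, rotateWord_iterate_apply]

/-- The largest `r` such that `w` is an `r`-th power. -/
noncomputable def rootOrder (w : Fin d → α) : ℕ :=
  d / minimalPeriod (rotateWord α d) w

theorem minimalPeriod_mul_rootOrder (w : Fin (d + 1) → α) :
    minimalPeriod (rotateWord α (d + 1)) w * rootOrder w = d + 1 :=
  Nat.mul_div_cancel' (IsPeriodicPt.minimalPeriod_dvd (rotateWord_iterate_length w))

theorem rootOrder_pos (w : Fin (d + 1) → α) : 0 < rootOrder w :=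
  Nat.pos_of_ne_zero fun h => by simpa [h] using minimalPeriod_mul_rootOrder w

theorem rootOrder_dvd (w : Fin (d + 1) → α) : rootOrder w ∣ d + 1 :=
  Dvd.intro_left _ (minimalPeriod_mul_rootOrder w)

theorem sum_range_minimalPeriod_mul {ι M : Type*} [AddCommMonoid M] (f : ι → ι) (E : ι → M) (w : ι)
    (r : ℕ) : ∑ i ∈ range (minimalPeriod f w * r), E (f^[i] w) =
      r • ∑ i ∈ range (minimalPeriod f w), E (f^[i] w) := by
  induction r with
  | zero => simp
  | succ r ih =>
    have periodic : ∀ i, f^[minimalPeriod f w * r + i] w = f^[i] w := fun i => by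
      rw [add_comm, iterate_add_apply, (isPeriodicPt_minimalPeriod f w).mul_const r]
    simp only [mul_add, mul_one, sum_range_add, ih, add_smul, one_smul, periodic]

theorem rootOrder_nsmul_sum_range_minimalPeriod {M : Type*} [AddCommMonoid M]
    (E : (Fin (d + 1) → α) → M) (w : Fin (d + 1) → α) :
    rootOrder w • ∑ i ∈ range (minimalPeriod (rotateWord α (d + 1)) w),
      E ((rotateWord α (d + 1))^[i] w) =
    ∑ i ∈ range (d + 1), E ((rotateWord α (d + 1))^[i] w) := by
  rw [← sum_range_minimalPeriod_mul, minimalPeriod_mul_rootOrder]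

section Monomials

variable [Fintype α]

/-- The monomial with exponents `e` in the `p i j`. -/
def pMonomial (p : α → α → R) (e : α × α → ℕ) : R :=
  ∏ x, p x.1 x.2 ^ e x

theorem pMonomial_add (p : α → α → R) (e e' : α × α → ℕ) :
    pMonomial p (e + e') = pMonomial p e * pMonomial p e' := by
  simp [pMonomial, pow_add, prod_mul_distrib]

theorem pMonomial_sum (p : α → α → R) {ι : Type*} (s : Finset ι) (e : ι → α × α → ℕ) :
    pMonomial p (∑ i ∈ s, e i) = ∏ i ∈ s, pMonomial p (e i) := by
  simp only [pMonomial, Finset.sum_apply, ← prod_pow_eq_pow_sum]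
  exact prod_comm

theorem pMonomial_nsmul (p : α → α → R) (r : ℕ) (e : α × α → ℕ) :
    pMonomial p (r • e) = pMonomial p e ^ r := by
  simp only [pMonomial, Pi.smul_apply, smul_eq_mul, ← prod_pow, ← pow_mul, mul_comm]

theorem prod_range_minimalPeriod_pMonomial (p : α → α → R) (E : (Fin (d + 1) → α) → α × α → ℕ)
    (w : Fin (d + 1) → α) :
    ∏ i ∈ range (minimalPeriod (rotateWord α (d + 1)) w),
      pMonomial p (E ((rotateWord α (d + 1))^[i] w)) =
    pMonomial p fun x =>
      (∑ i ∈ range (d + 1), E ((rotateWord α (d + 1))^[i] w)) x / rootOrder w := by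
  rw [← pMonomial_sum, ← rootOrder_nsmul_sum_range_minimalPeriod]
  congr 1
  ext x
  rw [Pi.smul_apply, smul_eq_mul, Nat.mul_div_cancel_left _ (rootOrder_pos w)]

end Monomials

variable [DecidableEq α]

/-- The degree of a word: the multiplicity of each letter. -/
def wordDeg (w : Fin d → α) : α → ℕ :=
  fun a => ({k | w k = a} : Finset (Fin d)).card

theorem wordDeg_eq_sum (w : Fin d → α) (a : α) :
    wordDeg w a = ∑ k, if w k = a then 1 else 0 := by
  simp [wordDeg]

theorem wordDeg_cons (i : α) (s : Fin d → α) :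
    wordDeg (Fin.cons i s : Fin (d + 1) → α) = wordDeg s + Pi.single i 1 := by
  ext a
  rw [wordDeg_eq_sum, Fin.sum_univ_succ, Pi.add_apply, wordDeg_eq_sum, add_comm]
  simp [Pi.single_apply, eq_comm]

theorem wordDeg_comp_equiv (w : Fin d → α) (e : Equiv.Perm (Fin d)) :
    wordDeg (w ∘ e) = wordDeg w := by
  ext a
  simp only [wordDeg_eq_sum, comp_apply]
  exact Equiv.sum_comp e fun k => if w k = a then 1 else 0

theorem wordDeg_rotateWord_iterate (w : Fin d → α) (i : ℕ) :
    wordDeg ((rotateWord α d)^[i] w) = wordDeg w := by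
  induction i with
  | zero => rfl
  | succ i ih =>
    rw [iterate_succ_apply', ← ih]
    exact wordDeg_comp_equiv _ _

/-- The exponents of the double braiding of all pairs of letters in a word of degree `l`. The
truncated subtraction is harmless, as the factor `l x.1` vanishes where it truncates. -/
def twistExp (l : α → ℕ) : α × α → ℕ :=
  fun x => l x.1 * (l x.2 - if x.1 = x.2 then 1 else 0)

/-- The exponents of the braiding of the first letter of `w` past the other letters. -/
def headExp (w : Fin (d + 1) → α) : α × α → ℕ :=
  fun x => if w 0 = x.1 then wordDeg w x.2 - if x.1 = x.2 then 1 else 0 else 0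

/-- The exponents of `twistedWeight`. -/
def twistedHeadExp (j : α) (w : Fin (d + 1) → α) : α × α → ℕ :=
  headExp w + (Pi.single (w 0, j) 1 + Pi.single (j, w 0) 1)

theorem sum_headExp (w : Fin (d + 1) → α) :
    ∑ i ∈ range (d + 1), headExp ((rotateWord α (d + 1))^[i] w) = twistExp (wordDeg w) := by
  ext x
  simp only [Finset.sum_apply, headExp, wordDeg_rotateWord_iterate]
  rw [sum_range_rotateWord_zero w fun a =>
    if a = x.1 then wordDeg w x.2 - if x.1 = x.2 then 1 else 0 else 0]
  rw [← sum_filter, sum_const, smul_eq_mul]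
  rfl

theorem twistExp_add_single (l : α → ℕ) (j a b : α) :
    twistExp (l + Pi.single j 1) (a, b) =
      twistExp l (a, b) + ((if b = j then l a else 0) + if a = j then l b else 0) := by
  rcases eq_or_ne a b with rfl | hab
  · rcases eq_or_ne a j with rfl | haj
    · simp only [twistExp, Pi.add_apply, Pi.single_eq_same, if_true]
      cases l a <;> simp; ring
    · simp [twistExp, haj]
  · rcases eq_or_ne a j with rfl | haj
    · simp [twistExp, hab, hab.symm, add_mul]
    · rcases eq_or_ne b j with rfl | hbj
      · simp [twistExp, hab, mul_add]
      · simp [twistExp, haj, hbj]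

theorem sum_twistedHeadExp (j : α) (w : Fin (d + 1) → α) :
    ∑ i ∈ range (d + 1), twistedHeadExp j ((rotateWord α (d + 1))^[i] w) =
      twistExp (wordDeg w + Pi.single j 1) := by
  have sum_single_left (a b : α) :
      (∑ k, (Pi.single (w k, j) 1 : α × α → ℕ)) (a, b) = if b = j then wordDeg w a else 0 := by
    simp only [Finset.sum_apply, Pi.single_apply, Prod.mk.injEq, wordDeg_eq_sum]
    split_ifs with h <;> simp [h, eq_comm]
  have sum_single_right (a b : α) :
      (∑ k, (Pi.single (j, w k) 1 : α × α → ℕ)) (a, b) = if a = j then wordDeg w b else 0 := by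
    simp only [Finset.sum_apply, Pi.single_apply, Prod.mk.injEq, wordDeg_eq_sum]
    split_ifs with h <;> simp [h, eq_comm]
  simp only [twistedHeadExp, sum_add_distrib]
  rw [sum_headExp, sum_range_rotateWord_zero w fun a => (Pi.single (a, j) 1 : α × α → ℕ),
    sum_range_rotateWord_zero w fun a => (Pi.single (j, a) 1 : α × α → ℕ)]
  ext ⟨a, b⟩
  rw [Pi.add_apply, Pi.add_apply, sum_single_left, sum_single_right, twistExp_add_single]

variable [Fintype α]

theorem sum_wordDeg (w : Fin d → α) : ∑ a, wordDeg w a = d := by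
  simp_rw [wordDeg_eq_sum]
  rw [sum_comm]
  simp

theorem pMonomial_single (p : α → α → R) (x : α × α) :
    pMonomial p (Pi.single x 1) = p x.1 x.2 := by
  rw [pMonomial, prod_eq_single x] <;> simp +contextual

theorem prod_eq_prod_pow_wordDeg {M : Type*} [CommMonoid M] (F : α → M) (w : Fin d → α) :
    ∏ k, F (w k) = ∏ a, F a ^ wordDeg w a := by
  simp only [wordDeg, ← prod_const]
  rw [← prod_fiberwise _ w]
  exact prod_congr rfl fun a _ => prod_congr rfl fun k hk => by rw [(mem_filter.1 hk).2]

theorem pMonomial_headExp (p : α → α → R) (w : Fin (d + 1) → α) :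
    pMonomial p (headExp w) = wordChar p (w 0) (Fin.tail w) := by
  cases w using Fin.consCases with
  | cons i s =>
    have exponent (a : α) : headExp (Fin.cons i s : Fin (d + 1) → α) (i, a) = wordDeg s a := by
      simp [headExp, wordDeg_cons, Pi.single_apply, eq_comm]
    have exponent_of_ne {b : α} (hb : b ≠ i) (a : α) :
        headExp (Fin.cons i s : Fin (d + 1) → α) (b, a) = 0 := by
      simp [headExp, hb.symm]
    rw [pMonomial, Fintype.prod_prod_type, prod_eq_single i] <;>
      simp +contextual [exponent, exponent_of_ne, wordChar, prod_eq_prod_pow_wordDeg]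

theorem pMonomial_twistedHeadExp (p : α → α → R) (j : α) (w : Fin (d + 1) → α) :
    pMonomial p (twistedHeadExp j w) = twistedWeight p j w := by
  rw [twistedHeadExp, pMonomial_add, pMonomial_add, pMonomial_single, pMonomial_single,
    pMonomial_headExp, twistedWeight]

theorem det_one_sub_rotationMatrix_pow (p : α → α → R) (d : ℕ) :
    (1 - rotationMatrix p d).det ^ (d + 1) = ∏ w : Fin (d + 1) → α,
      (1 - pMonomial p (fun x => twistExp (wordDeg w) x / rootOrder w)) ^ rootOrder w := by
  rw [rotationMatrix, det_one_sub_weightedPermMatrix_pow _ _ rotateWord_iterate_length]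
  refine prod_congr rfl fun w _ => ?_
  rw [← sum_headExp, ← prod_range_minimalPeriod_pMonomial]
  simp only [pMonomial_headExp, rootOrder]

theorem det_one_sub_twistedRotationMatrix_pow (p : α → α → R) (d : ℕ) (j : α) :
    (1 - twistedRotationMatrix p d j).det ^ (d + 1) = ∏ w : Fin (d + 1) → α,
      (1 - pMonomial p (fun x => twistExp (wordDeg w + Pi.single j 1) x / rootOrder w)) ^
        rootOrder w := by
  rw [twistedRotationMatrix, det_one_sub_weightedPermMatrix_pow _ _ rotateWord_iterate_length]
  refine prod_congr rfl fun w _ => ?_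
  rw [← sum_twistedHeadExp, ← prod_range_minimalPeriod_pMonomial]
  simp only [pMonomial_twistedHeadExp, rootOrder]

end Degrees

/-! ### Counting words -/

section Counting

open Finset Function

variable {α : Type*} {d r L : ℕ}

theorem dvd_rootOrder_iff (hrL : r * L = d + 1) (w : Fin (d + 1) → α) :
    r ∣ rootOrder w ↔ IsPeriodicPt (rotateWord α (d + 1)) L w := by
  have hr : r ≠ 0 := left_ne_zero_of_mul (hrL.trans_ne d.succ_ne_zero)
  rw [isPeriodicPt_iff_minimalPeriod_dvd, rootOrder,
    Nat.dvd_div_iff_mul_dvd (IsPeriodicPt.minimalPeriod_dvd (rotateWord_iterate_length w)),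
    mul_comm]
  simpa only [hrL] using Nat.mul_dvd_mul_iff_left (b := minimalPeriod (rotateWord α (d + 1)) w)
    (c := L) (Nat.pos_of_ne_zero hr)

/-- The `r`-th power of a word of length `L`, where `r * L = d`. -/
def powWord (h : r * L = d) (u : Fin L → α) : Fin d → α :=
  fun k => u ((finProdFinEquiv (m := r) (n := L)).symm (Fin.cast h.symm k)).2

theorem powWord_apply (h : r * L = d) (u : Fin L → α) (k : Fin d) (hk : k.val % L < L) :
    powWord h u k = u ⟨k.val % L, hk⟩ := rfl

theorem powWord_injective (h : r * L = d + 1) : Injective (powWord h : (Fin L → α) → _) := by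
  intro u u' heq
  ext k
  have hk : k.val < d + 1 := k.2.trans_le (Nat.le_of_dvd d.succ_pos (Dvd.intro_left r h))
  have := congrFun heq ⟨k, hk⟩
  simpa only [powWord_apply _ _ _ (Nat.mod_lt _ k.pos), Nat.mod_eq_of_lt k.2] using this

theorem dvd_rootOrder_powWord (h : r * L = d + 1) (u : Fin L → α) :
    r ∣ rootOrder (powWord h u) := by
  have hL : 0 < L := Nat.pos_of_ne_zero (right_ne_zero_of_mul (h.trans_ne d.succ_ne_zero))
  rw [dvd_rootOrder_iff h]
  funext k
  rw [rotateWord_iterate_apply, powWord_apply _ _ _ (Nat.mod_lt _ hL),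
    powWord_apply _ _ _ (Nat.mod_lt _ hL)]
  congr 2
  simp [Fin.val_add, Nat.mod_mod_of_dvd _ (Dvd.intro_left r h)]

theorem exists_powWord_eq (h : r * L = d + 1) {w : Fin (d + 1) → α} (hw : r ∣ rootOrder w) :
    ∃ u : Fin L → α, powWord h u = w := by
  have hL : 0 < L := Nat.pos_of_ne_zero (right_ne_zero_of_mul (h.trans_ne d.succ_ne_zero))
  refine ⟨fun k => w (Fin.castLE (Nat.le_of_dvd d.succ_pos (Dvd.intro_left r h)) k), ?_⟩
  ext k
  have rotate_eq : (rotateWord α (d + 1))^[L * (k.val / L)] w = w :=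
    ((dvd_rootOrder_iff h w).1 hw).mul_const _
  rw [powWord_apply _ _ _ (Nat.mod_lt _ hL)]
  conv_lhs => rw [← rotate_eq]
  rw [rotateWord_iterate_apply]
  congr 2
  ext
  simp only [Fin.val_add, Fin.val_castLE, Fin.val_ofNat, Nat.add_mod_mod, Nat.mod_add_div]
  exact Nat.mod_eq_of_lt k.2

theorem rootOrder_const (d : ℕ) (i : α) : rootOrder (fun _ : Fin (d + 1) => i) = d + 1 :=
  Nat.dvd_antisymm (rootOrder_dvd _) ((dvd_rootOrder_iff (mul_one _) _).2 rfl)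

variable [DecidableEq α]

theorem wordDeg_eq_single_iff (w : Fin d → α) (i : α) :
    wordDeg w = Pi.single i d ↔ w = fun _ => i := by
  constructor
  · intro hw
    ext k
    by_contra hk
    have not_mem : #{k' | w k' = w k} = 0 := by
      simpa [wordDeg, hk] using congrFun hw (w k)
    simp only [card_eq_zero, filter_eq_empty_iff] at not_mem
    exact not_mem (mem_univ k) rfl
  · rintro rfl
    ext a
    rcases eq_or_ne a i with rfl | hai <;> simp [wordDeg, *, Ne.symm]

theorem wordDeg_powWord (h : r * L = d) (u : Fin L → α) :
    wordDeg (powWord h u) = r • wordDeg u := by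
  subst h
  ext a
  have sum_pairs : wordDeg (powWord (r := r) rfl u) a =
      ∑ _ : Fin r, ∑ k, if u k = a then 1 else 0 := by
    rw [wordDeg_eq_sum, ← finProdFinEquiv.sum_comp, Fintype.sum_prod_type]
    simp [powWord]
  simp [sum_pairs, wordDeg_eq_sum]

theorem dvd_wordDeg (w : Fin (d + 1) → α) (h : r ∣ rootOrder w) (a : α) : r ∣ wordDeg w a := by
  obtain ⟨L, hL⟩ := h.trans (rootOrder_dvd w)
  obtain ⟨u, rfl⟩ := exists_powWord_eq hL.symm h
  simp [wordDeg_powWord]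

theorem sub_single_add_single {l : α → ℕ} {j : α} (hj : 0 < l j) :
    l - Pi.single j 1 + Pi.single j 1 = l :=
  tsub_add_cancel_of_le (by simpa [Pi.single, update_le_iff] using Nat.succ_le_of_lt hj)

variable [Fintype α]

open MvPolynomial in
theorem card_wordDeg_eq (l : α → ℕ) (hl : ∑ a, l a = d) :
    #{w : Fin d → α | wordDeg w = l} = Nat.multinomial univ l := by
  -- Both sides are the coefficient of `X ^ l` in `(∑ a, X a) ^ d`.
  have coeff_word (w : Fin d → α) : coeff (Finsupp.equivFunOnFinite.symm l)
      (∏ k, (X (w k) : MvPolynomial α ℕ)) = if wordDeg w = l then 1 else 0 := by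
    rw [prod_eq_prod_pow_wordDeg X w, prod_X_pow, coeff_monomial]
    congr 1
    simp [DFunLike.ext_iff, funext_iff, Finsupp.indicator_apply, eq_comm]
  have coeff_pow := coeff_sum_X_pow_of_fintype (R := ℕ) (Finsupp.equivFunOnFinite.symm l) d
  rw [Fintype.sum_pow, coeff_sum, sum_congr rfl fun w _ => coeff_word w, ← card_filter,
    if_pos, Nat.cast_id] at coeff_pow
  · exact coeff_pow.trans (Finsupp.multinomial_of_support_subset (subset_univ _)).symm
  · rw [Finsupp.sum_fintype _ _ fun _ => rfl]
    exact hl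

theorem sum_sub_single {l : α → ℕ} (hl : ∑ a, l a = d + 1) {j : α} (hj : 0 < l j) :
    ∑ a, (l - Pi.single j 1 : α → ℕ) a = d := by
  rw [← sub_single_add_single hj] at hl
  simpa [sum_add_distrib] using hl

theorem multinomial_eq_sum_sub_single (l : α → ℕ) (hl : ∑ a, l a ≠ 0) :
    Nat.multinomial univ l = ∑ i with 0 < l i, Nat.multinomial univ (l - Pi.single i 1) := by
  obtain ⟨d, hd⟩ := Nat.exists_eq_succ_of_ne_zero hl
  have cons_eq_iff (i : α) (s : Fin d → α) :
      wordDeg (Fin.cons i s : Fin (d + 1) → α) = l ↔ 0 < l i ∧ wordDeg s = l - Pi.single i 1 := by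
    rw [wordDeg_cons]
    constructor
    · rintro rfl
      simp
    · rintro ⟨hi, hs⟩
      rw [hs, sub_single_add_single hi]
  rw [← card_wordDeg_eq l hd, card_filter, sum_word_cons, sum_filter]
  refine sum_congr rfl fun i _ => ?_
  split_ifs with hi
  · simp only [cons_eq_iff, hi, true_and, ← card_filter, card_wordDeg_eq _ (sum_sub_single hd hi)]
  · simp [cons_eq_iff, hi]

theorem card_dvd_rootOrder (l : α → ℕ) (hl : ∑ a, l a = d + 1) (hr : ∀ a, r ∣ l a) :
    #{w : Fin (d + 1) → α | wordDeg w = l ∧ r ∣ rootOrder w} =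
      Nat.multinomial univ (fun a => l a / r) := by
  obtain ⟨L, hL⟩ : r ∣ d + 1 := hl ▸ dvd_sum fun a _ => hr a
  have hr0 : 0 < r := Nat.pos_of_ne_zero (left_ne_zero_of_mul (hL.symm.trans_ne d.succ_ne_zero))
  rw [← card_wordDeg_eq (d := L)]
  · symm
    refine card_bij (fun u _ => powWord hL.symm u) ?_ (fun u _ u' _ h => powWord_injective _ h) ?_
    · simp +contextual [wordDeg_powWord, dvd_rootOrder_powWord, funext_iff, Nat.mul_div_cancel', hr]
    · simp only [mem_filter, mem_univ, true_and, and_imp]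
      rintro w rfl hw
      obtain ⟨u, rfl⟩ := exists_powWord_eq hL.symm hw
      exact ⟨u, by simp [wordDeg_powWord, hr0], rfl⟩
  · rw [← Nat.sum_div fun a _ => hr a, hl, hL, Nat.mul_div_cancel_left _ hr0]

end Counting

/-! ### Products over all words of a given degree -/

section RootProducts

open Finset

variable {α R : Type*} [Fintype α] [DecidableEq α] [CommRing R]

/-- The product of `g r ^ r` over all words `w` of length `d` and degree `l`, with `r` the root
order of `w`. -/
noncomputable def rootProd (g : ℕ → R) (d : ℕ) (l : α → ℕ) : R :=
  ∏ w : Fin d → α with wordDeg w = l, g (rootOrder w) ^ rootOrder w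

/-- The product of the `rootProd`s of all degrees obtained by removing a letter from `l`. -/
noncomputable def deletionProd (g : ℕ → R) (d : ℕ) (l : α → ℕ) : R :=
  ∏ j with 0 < l j, rootProd g d (l - Pi.single j 1)

theorem rootProd_eq_prod_pow (g : ℕ → R) {d : ℕ} {l : α → ℕ} (T : Finset ℕ)
    (hT : ∀ t, (∀ a, t ∣ l a) → t ∈ T) :
    rootProd g (d + 1) l =
      ∏ t ∈ T, g t ^ (t * #{w : Fin (d + 1) → α | wordDeg w = l ∧ rootOrder w = t}) := by
  have rootOrder_mem : ∀ w ∈ ({w | wordDeg w = l} : Finset (Fin (d + 1) → α)),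
      rootOrder w ∈ T := fun w hw => hT _ fun a => (mem_filter.1 hw).2 ▸ dvd_wordDeg w dvd_rfl a
  rw [rootProd, ← prod_fiberwise_of_maps_to rootOrder_mem]
  refine prod_congr rfl fun t _ => ?_
  rw [filter_filter, pow_mul, ← prod_const]
  exact prod_congr rfl fun w hw => by rw [(mem_filter.1 hw).2.2]

section Counts

variable {d r s : ℕ} {l : α → ℕ} (hl : ∑ a, l a = d + 1)
include hl

theorem card_rootOrder_eq_sub (hs : ∀ a, s ∣ l a) (hr : ∀ a, r ∣ l a) (hsr : s ∣ r)
    (not_dvd : ¬ r ∣ s) (h : ∀ t, (∀ a, t ∣ l a) → s ∣ t → t = s ∨ r ∣ t) :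
    #{w : Fin (d + 1) → α | wordDeg w = l ∧ rootOrder w = s} =
      Nat.multinomial univ (fun a => l a / s) - Nat.multinomial univ (fun a => l a / r) := by
  have eq_sdiff : ({w | wordDeg w = l ∧ rootOrder w = s} : Finset (Fin (d + 1) → α)) =
      ({w | wordDeg w = l ∧ s ∣ rootOrder w} : Finset _) \
        ({w | wordDeg w = l ∧ r ∣ rootOrder w} : Finset _) := by
    ext w
    simp only [mem_sdiff, mem_filter, mem_univ, true_and, not_and]
    constructor
    · rintro ⟨hw, rfl⟩
      exact ⟨⟨hw, dvd_rfl⟩, fun _ => not_dvd⟩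
    · rintro ⟨⟨rfl, hsw⟩, hrw⟩
      exact ⟨rfl, (h _ (dvd_wordDeg w dvd_rfl) hsw).resolve_right (hrw rfl)⟩
  rw [eq_sdiff, card_sdiff_of_subset (monotone_filter_right _ fun w _ hw => ⟨hw.1, hsr.trans hw.2⟩),
    card_dvd_rootOrder l hl hr, card_dvd_rootOrder l hl hs]

theorem card_rootOrder_eq_of_maximal (hr : ∀ a, r ∣ l a)
    (h : ∀ t, (∀ a, t ∣ l a) → r ∣ t → t = r) :
    #{w : Fin (d + 1) → α | wordDeg w = l ∧ rootOrder w = r} =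
      Nat.multinomial univ (fun a => l a / r) := by
  rw [← card_dvd_rootOrder l hl hr]
  congr 1
  refine filter_congr fun w _ => and_congr_right fun hw => ⟨fun hwr => hwr.symm.dvd, ?_⟩
  exact h _ fun a => hw ▸ dvd_wordDeg w dvd_rfl a

theorem rootProd_of_coprime (g : ℕ → R) (h : ∀ r, (∀ a, r ∣ l a) → r = 1) :
    rootProd g (d + 1) l = g 1 ^ Nat.multinomial univ l := by
  rw [rootProd_eq_prod_pow g {1} (by simpa using h), prod_singleton, one_mul,
    card_rootOrder_eq_of_maximal hl (fun _ => one_dvd _) fun t ht _ => h t ht]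
  simp only [Nat.div_one]

theorem rootProd_of_two_divisors (g : ℕ → R) (hr : ∀ a, r ∣ l a) (hr1 : r ≠ 1)
    (h : ∀ t, (∀ a, t ∣ l a) → t = 1 ∨ t = r) :
    rootProd g (d + 1) l =
      g 1 ^ (Nat.multinomial univ l - Nat.multinomial univ (fun a => l a / r)) *
        g r ^ (r * Nat.multinomial univ (fun a => l a / r)) := by
  rw [rootProd_eq_prod_pow g {1, r} (by simpa using h), prod_pair hr1.symm, one_mul,
    card_rootOrder_eq_sub hl (fun _ => one_dvd _) hr (one_dvd r) (by simpa using hr1)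
      fun t ht _ => (h t ht).imp_right fun htr => htr.symm.dvd,
    card_rootOrder_eq_of_maximal hl hr fun t ht hrt =>
      (h t ht).resolve_left fun ht1 => hr1 (Nat.dvd_one.1 (ht1 ▸ hrt))]
  simp only [Nat.div_one]

theorem rootProd_of_dvd_four (g : ℕ → R) (h4 : ∀ a, 4 ∣ l a) (h : ∀ t, (∀ a, t ∣ l a) → t ∣ 4) :
    rootProd g (d + 1) l =
      g 1 ^ (Nat.multinomial univ l - Nat.multinomial univ (fun a => l a / 2)) *
        (g 2 ^ (2 * (Nat.multinomial univ (fun a => l a / 2) -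
          Nat.multinomial univ (fun a => l a / 4))) *
        g 4 ^ (4 * Nat.multinomial univ (fun a => l a / 4))) := by
  have h2 (a : α) : 2 ∣ l a := (by norm_num : 2 ∣ 4).trans (h4 a)
  have eq_one_or (t : ℕ) (ht : ∀ a, t ∣ l a) : t = 1 ∨ t = 2 ∨ t = 4 := by
    have : t ∈ Nat.divisors 4 := Nat.mem_divisors.2 ⟨h t ht, four_ne_zero⟩
    simpa [show Nat.divisors 4 = {1, 2, 4} by decide] using this
  rw [rootProd_eq_prod_pow g {1, 2, 4} (by simpa using eq_one_or), prod_insert (by simp),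
    prod_pair (by simp), one_mul,
    card_rootOrder_eq_sub hl (r := 2) (fun _ => one_dvd _) h2 (by simp) (by simp),
    card_rootOrder_eq_sub hl h2 h4 (by norm_num) (by norm_num),
    card_rootOrder_eq_of_maximal hl h4 fun t ht => Nat.dvd_antisymm (h t ht)]
  · simp only [Nat.div_one]
  · intro t ht h2t
    rcases eq_one_or t ht with rfl | rfl | rfl
    · simp at h2t
    · exact Or.inl rfl
    · exact Or.inr dvd_rfl
  · rintro t ht -
    rcases eq_one_or t ht with rfl | rfl | rfl <;> simp

end Counts

theorem rootProd_single (g : ℕ → R) (d : ℕ) (i : α) :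
    rootProd g (d + 1) (Pi.single i (d + 1)) = g (d + 1) ^ (d + 1) := by
  simp [rootProd, wordDeg_eq_single_iff, filter_eq', rootOrder_const]

end RootProducts

section TwoLetters

open Finset

variable {α R : Type*} [DecidableEq α]

/-- The degree `a e_i + b e_j`. -/
def twoDeg (i j : α) (a b : ℕ) : α → ℕ := Pi.single i a + Pi.single j b

variable {i j : α}

theorem twoDeg_comm (a b : ℕ) : twoDeg i j a b = twoDeg j i b a := add_comm _ _

theorem twoDeg_left (hij : i ≠ j) (a b : ℕ) : twoDeg i j a b i = a := by
  simp [twoDeg, hij]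

theorem twoDeg_right (hij : i ≠ j) (a b : ℕ) : twoDeg i j a b j = b := by
  simp [twoDeg, hij.symm]

theorem twoDeg_of_ne {c : α} (hi : c ≠ i) (hj : c ≠ j) (a b : ℕ) : twoDeg i j a b c = 0 := by
  simp [twoDeg, hi, hj]

theorem forall_dvd_twoDeg (hij : i ≠ j) {a b r : ℕ} :
    (∀ c, r ∣ twoDeg i j a b c) ↔ r ∣ a ∧ r ∣ b := by
  refine ⟨fun h => ⟨twoDeg_left hij a b ▸ h i, twoDeg_right hij a b ▸ h j⟩, fun h c => ?_⟩
  rcases eq_or_ne c i with rfl | hi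
  · simpa only [twoDeg_left hij] using h.1
  rcases eq_or_ne c j with rfl | hj
  · simpa only [twoDeg_right hij] using h.2
  · simp [twoDeg_of_ne hi hj]

theorem twoDeg_div (hij : i ≠ j) (a b r : ℕ) :
    (fun c => twoDeg i j a b c / r) = twoDeg i j (a / r) (b / r) := by
  ext c
  rcases eq_or_ne c i with rfl | hi
  · simp only [twoDeg_left hij]
  rcases eq_or_ne c j with rfl | hj
  · simp only [twoDeg_right hij]
  · simp [twoDeg_of_ne hi hj]

theorem twoDeg_sub_single_left (a b : ℕ) :
    twoDeg i j (a + 1) b - Pi.single i 1 = twoDeg i j a b := by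
  rw [twoDeg, Pi.single_add, add_right_comm, add_tsub_cancel_right, twoDeg]

theorem twoDeg_sub_single_right (a b : ℕ) :
    twoDeg i j a (b + 1) - Pi.single j 1 = twoDeg i j a b := by
  rw [twoDeg_comm, twoDeg_sub_single_left, twoDeg_comm]

variable [Fintype α]

theorem sum_twoDeg (a b : ℕ) : ∑ c, twoDeg i j a b c = a + b := by
  simp [twoDeg, sum_add_distrib]

theorem multinomial_twoDeg (hij : i ≠ j) (a b : ℕ) :
    Nat.multinomial univ (twoDeg i j a b) = (a + b).choose a := by
  have pos : 0 < a.factorial * b.factorial := by positivity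
  have spec := Nat.multinomial_spec univ (twoDeg i j a b)
  rw [sum_twoDeg, prod_eq_mul i j hij (fun c _ hc => by simp [twoDeg_of_ne hc.1 hc.2])
    (by simp) (by simp), twoDeg_left hij, twoDeg_right hij] at spec
  refine Nat.eq_of_mul_eq_mul_left pos (spec.trans ?_)
  rw [← Nat.add_choose_mul_factorial_mul_factorial, Nat.choose_symm_add, mul_assoc, mul_comm]

theorem filter_pos_twoDeg (hij : i ≠ j) (a b : ℕ) :
    ({c | 0 < twoDeg i j (a + 1) (b + 1) c} : Finset α) = {i, j} := by
  ext c
  rcases eq_or_ne c i with rfl | hi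
  · simp [twoDeg_left hij]
  rcases eq_or_ne c j with rfl | hj
  · simp [twoDeg_right hij]
  · simp [twoDeg_of_ne hi hj, hi, hj]

variable [CommRing R]

theorem deletionProd_twoDeg (g : ℕ → R) (hij : i ≠ j) (d a b : ℕ) :
    deletionProd g d (twoDeg i j (a + 1) (b + 1)) =
      rootProd g d (twoDeg i j a (b + 1)) * rootProd g d (twoDeg i j (a + 1) b) := by
  rw [deletionProd, filter_pos_twoDeg hij, prod_pair hij, twoDeg_sub_single_left,
    twoDeg_sub_single_right]

theorem pMonomial_twoDeg (p : α → α → R) (hij : i ≠ j) (a b r : ℕ) :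
    pMonomial p (fun x => twistExp (twoDeg i j a b) x / r) =
      p i i ^ (a * (a - 1) / r) * (p i j * p j i) ^ (a * b / r) * p j j ^ (b * (b - 1) / r) := by
  have eq_one : ∀ x ∈ univ, x ∉ ({i, j} : Finset α) ×ˢ {i, j} →
      p x.1 x.2 ^ (twistExp (twoDeg i j a b) x / r) = 1 := by
    rintro ⟨c, c'⟩ - hc
    have : twoDeg i j a b c = 0 ∨ twoDeg i j a b c' = 0 := by
      by_contra! hne
      have mem (e : α) (he : twoDeg i j a b e ≠ 0) : e ∈ ({i, j} : Finset α) := by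
        contrapose! he
        rw [mem_insert, mem_singleton, not_or] at he
        exact twoDeg_of_ne he.1 he.2 a b
      exact hc (mk_mem_product (mem c hne.1) (mem c' hne.2))
    rcases this with h | h <;> simp [twistExp, h]
  rw [pMonomial, ← prod_subset (subset_univ _) eq_one, prod_product, prod_pair hij,
    prod_pair hij, prod_pair hij]
  simp only [twistExp, twoDeg_left hij, twoDeg_right hij, hij, hij.symm, if_true, if_false,
    Nat.sub_zero, mul_pow, mul_comm b a]
  ring

end TwoLetters

/-! ### The exceptional degrees -/

section DegreeRatio

variable {R : Type*} [CommRing R]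

/-- Two ring elements each of which divides a power of the other. -/
def RadEquiv (D P : R) : Prop := (∃ N, D ∣ P ^ N) ∧ ∃ N, P ∣ D ^ N

theorem RadEquiv.map_eq_zero_iff {K : Type*} [CommRing K] [IsReduced K] {D P : R}
    (h : RadEquiv D P) (φ : R →+* K) : φ D = 0 ↔ φ P = 0 := by
  have eq_zero_of_dvd_pow {A B : R} {N : ℕ} (hAB : A ∣ B ^ N) (hA : φ A = 0) : φ B = 0 := by
    have := map_dvd φ hAB
    rw [hA, map_pow, zero_dvd_iff] at this
    exact eq_zero_of_pow_eq_zero this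
  obtain ⟨⟨_, hD⟩, _, hP⟩ := h
  exact ⟨eq_zero_of_dvd_pow hD, eq_zero_of_dvd_pow hP⟩

variable {α : Type*} [Fintype α] [DecidableEq α]

/-- The factor `1 - σ ^ (1 / r)`, where `σ` is the double braiding of all pairs of letters in a
word of degree `l`; the division of exponents is exact when `r` is the root order of such a
word. -/
def twistFactor (p : α → α → R) (l : α → ℕ) (r : ℕ) : R :=
  1 - pMonomial p fun x => twistExp l x / r

/-- The contribution of the degree `l`, where `∑ a, l a = d + 2`, to the quotient of consecutive
determinants has the same zeros as `P`. -/
def HasDegreeRatio (p : α → α → R) (d : ℕ) (l : α → ℕ) (P : R) : Prop :=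
  ∃ D, deletionProd (twistFactor p l) (d + 1) l ^ (d + 2) =
    D * rootProd (twistFactor p l) (d + 2) l ^ (d + 1) ∧ RadEquiv D P

theorem HasDegreeRatio.of_pow {p : α → α → R} {d k N : ℕ} {l : α → ℕ} {D P : R} (hk : k ≠ 0)
    (h : deletionProd (twistFactor p l) (d + 1) l ^ (d + 2) =
      D ^ k * rootProd (twistFactor p l) (d + 2) l ^ (d + 1))
    (hDP : D ∣ P ^ N) (hPD : P ∣ D) : HasDegreeRatio p d l P :=
  ⟨D ^ k, h, ⟨N * k, by simpa only [pow_mul] using pow_dvd_pow_of_dvd hDP k⟩,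
    1, by simpa only [pow_one] using hPD.trans (dvd_pow_self D hk)⟩

theorem hasDegreeRatio_of_pow_eq {p : α → α → R} {d k : ℕ} {l : α → ℕ} {P : R} (hk : k ≠ 0)
    (h : deletionProd (twistFactor p l) (d + 1) l ^ (d + 2) =
      P ^ k * rootProd (twistFactor p l) (d + 2) l ^ (d + 1)) : HasDegreeRatio p d l P :=
  .of_pow (N := 1) hk h (pow_one P).symm.dvd dvd_rfl

end DegreeRatio

theorem qNumber_three {R : Type*} [CommRing R] (y : R) : qNumber 3 y = 1 + y + y ^ 2 := by
  simp [qNumber, Finset.sum_range_succ]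

theorem choose_two_of_even (m : ℕ) : (2 * m).choose 2 = m * (2 * m - 1) := by
  rw [Nat.choose_two_right, mul_assoc, Nat.mul_div_cancel_left _ two_pos]

theorem choose_two_of_odd (m : ℕ) : (2 * m + 1).choose 2 = m * (2 * m + 1) := by
  rw [Nat.choose_two_right, Nat.add_sub_cancel, mul_comm, mul_assoc,
    Nat.mul_div_cancel_left _ two_pos]

section Exceptional

variable {α R : Type*} [Fintype α] [DecidableEq α] [CommRing R] {i j : α} (hij : i ≠ j)
include hij

theorem twistFactor_twoDeg (p : α → α → R) (a b r : ℕ) :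
    twistFactor p (twoDeg i j a b) r =
      1 - p i i ^ (a * (a - 1) / r) * (p i j * p j i) ^ (a * b / r) *
        p j j ^ (b * (b - 1) / r) := by
  rw [twistFactor, pMonomial_twoDeg p hij]

theorem rootProd_twoDeg_of_coprime (g : ℕ → R) {a b d : ℕ} (h : a + b = d + 1)
    (hab : a.Coprime b) : rootProd g (d + 1) (twoDeg i j a b) = g 1 ^ (a + b).choose a := by
  rw [rootProd_of_coprime (by rw [sum_twoDeg, h]), multinomial_twoDeg hij]
  intro r hr
  rw [forall_dvd_twoDeg hij] at hr
  exact Nat.eq_one_of_dvd_coprimes hab hr.1 hr.2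

theorem rootProd_twoDeg_of_prime_gcd (g : ℕ → R) {a b d r : ℕ} (h : a + b = d + 1)
    (hr : r.Prime) (hab : a.gcd b = r) :
    rootProd g (d + 1) (twoDeg i j a b) =
      g 1 ^ ((a + b).choose a - (a / r + b / r).choose (a / r)) *
        g r ^ (r * (a / r + b / r).choose (a / r)) := by
  rw [rootProd_of_two_divisors (r := r) (by rw [sum_twoDeg, h]) g _ hr.ne_one,
    multinomial_twoDeg hij, twoDeg_div hij, multinomial_twoDeg hij]
  · intro t ht
    rw [forall_dvd_twoDeg hij] at ht
    exact (Nat.dvd_prime hr).1 (hab ▸ Nat.dvd_gcd ht.1 ht.2)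
  · rw [forall_dvd_twoDeg hij, ← hab]
    exact ⟨Nat.gcd_dvd_left a b, Nat.gcd_dvd_right a b⟩

theorem rootProd_twoDeg_four_four (g : ℕ → R) :
    rootProd g 8 (twoDeg i j 4 4) = g 1 ^ 64 * (g 2 ^ 8 * g 4 ^ 8) := by
  rw [rootProd_of_dvd_four (by rw [sum_twoDeg])]
  · simp [twoDeg_div hij, multinomial_twoDeg hij, Nat.choose]
  · simp [forall_dvd_twoDeg hij]
  · exact fun t ht => ((forall_dvd_twoDeg hij).1 ht).1

theorem deletionProd_pow_one (g : ℕ → R) (m : ℕ) :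
    deletionProd g (m + 1) (twoDeg i j 1 (m + 1)) ^ (m + 2) =
      g (m + 1) ^ ((m + 1) * (m + 2)) * rootProd g (m + 2) (twoDeg i j 1 (m + 1)) ^ (m + 1) := by
  have deg_zero : twoDeg i j 0 (m + 1) = Pi.single j (m + 1) := by simp [twoDeg]
  rw [deletionProd_twoDeg g hij (m + 1) 0 m, deg_zero, rootProd_single, zero_add,
    rootProd_twoDeg_of_coprime hij g (by lia) (by simp),
    rootProd_twoDeg_of_coprime hij g (by lia) (by simp)]
  simp only [Nat.choose_one_right]
  ring

theorem deletionProd_pow_two_even (g : ℕ → R) (k : ℕ) {b : R} (hb : g 1 = g 2 * b) :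
    deletionProd g (2 * k + 3) (twoDeg i j 2 (2 * k + 2)) ^ (2 * k + 4) =
      b ^ (2 * (k + 2) * (2 * k + 3)) *
        rootProd g (2 * k + 4) (twoDeg i j 2 (2 * k + 2)) ^ (2 * k + 3) := by
  have sub_eq : (k + 2) * (2 * k + 3) - (1 + (k + 1)) = (k + 2) * (2 * k + 2) := by
    rw [Nat.sub_eq_iff_eq_add (by nlinarith)]
    ring
  rw [deletionProd_twoDeg g hij _ 1 (2 * k + 1),
    rootProd_twoDeg_of_coprime hij g (a := 1) (by lia) (by simp),
    rootProd_twoDeg_of_coprime hij g (a := 2) (by lia) (by simp),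
    rootProd_twoDeg_of_prime_gcd hij g (a := 2) (b := 2 * k + 2) (by lia) Nat.prime_two (by simp),
    show (2 * k + 2) / 2 = k + 1 by lia, Nat.div_self two_pos,
    show 2 + (2 * k + 2) = 2 * (k + 2) by ring, choose_two_of_even,
    show 2 * (k + 2) - 1 = 2 * k + 3 by lia, show 2 + (2 * k + 1) = 2 * (k + 1) + 1 by ring,
    choose_two_of_odd]
  simp only [Nat.choose_one_right, sub_eq, hb]
  ring

theorem deletionProd_pow_two_odd (g : ℕ → R) (k : ℕ) :
    deletionProd g (2 * k + 4) (twoDeg i j 2 (2 * k + 3)) ^ (2 * k + 5) =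
      g 2 ^ (2 * (k + 2) * (2 * k + 5)) *
        rootProd g (2 * k + 5) (twoDeg i j 2 (2 * k + 3)) ^ (2 * k + 4) := by
  have sub_eq : (k + 2) * (2 * k + 3) - (1 + (k + 1)) = (k + 2) * (2 * k + 2) := by
    rw [Nat.sub_eq_iff_eq_add (by nlinarith)]
    ring
  rw [deletionProd_twoDeg g hij _ 1 (2 * k + 2),
    rootProd_twoDeg_of_coprime hij g (a := 1) (by lia) (by simp),
    rootProd_twoDeg_of_coprime hij g (a := 2) (b := 2 * k + 3) (by lia) (by simp),
    rootProd_twoDeg_of_prime_gcd hij g (a := 2) (b := 2 * k + 2) (by lia) Nat.prime_two (by simp),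
    show (2 * k + 2) / 2 = k + 1 by lia, Nat.div_self two_pos,
    show 2 + (2 * k + 2) = 2 * (k + 2) by ring, choose_two_of_even,
    show 2 * (k + 2) - 1 = 2 * k + 3 by lia, show 2 + (2 * k + 3) = 2 * (k + 2) + 1 by ring,
    choose_two_of_odd]
  simp only [Nat.choose_one_right, sub_eq]
  ring

theorem deletionProd_pow_three_three (g : ℕ → R) {b : R} (hb : g 1 = g 3 * b) :
    deletionProd g 5 (twoDeg i j 3 3) ^ 6 = b ^ 30 * rootProd g 6 (twoDeg i j 3 3) ^ 5 := by
  rw [deletionProd_twoDeg g hij, rootProd_twoDeg_of_coprime hij g (by norm_num) (by norm_num),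
    rootProd_twoDeg_of_coprime hij g (by norm_num) (by norm_num),
    rootProd_twoDeg_of_prime_gcd hij g (by norm_num) Nat.prime_three (by norm_num), hb]
  norm_num only [Nat.choose]
  ring

theorem deletionProd_pow_three_four (g : ℕ → R) :
    deletionProd g 6 (twoDeg i j 3 4) ^ 7 =
      (g 2 * g 3) ^ 42 * rootProd g 7 (twoDeg i j 3 4) ^ 6 := by
  rw [deletionProd_twoDeg g hij,
    rootProd_twoDeg_of_coprime hij g (a := 3) (b := 4) (by norm_num) (by norm_num),
    rootProd_twoDeg_of_prime_gcd hij g (a := 3) (by norm_num) Nat.prime_three (by norm_num),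
    rootProd_twoDeg_of_prime_gcd hij g (a := 2) (by norm_num) Nat.prime_two (by norm_num)]
  norm_num only [Nat.choose]
  ring

theorem deletionProd_pow_three_six (g : ℕ → R) {b : R} (hb : g 1 = g 3 * b) :
    deletionProd g 8 (twoDeg i j 3 6) ^ 9 =
      (b * g 2) ^ 72 * rootProd g 9 (twoDeg i j 3 6) ^ 8 := by
  rw [deletionProd_twoDeg g hij,
    rootProd_twoDeg_of_coprime hij g (a := 3) (b := 5) (by norm_num) (by norm_num),
    rootProd_twoDeg_of_prime_gcd hij g (a := 3) (by norm_num) Nat.prime_three (by norm_num),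
    rootProd_twoDeg_of_prime_gcd hij g (a := 2) (by norm_num) Nat.prime_two (by norm_num), hb]
  norm_num only [Nat.choose]
  ring

theorem deletionProd_pow_four_four (g : ℕ → R) {b c : R} (hb : g 2 = g 4 * b)
    (hc : g 1 = g 2 * c) :
    deletionProd g 7 (twoDeg i j 4 4) ^ 8 =
      (b * c ^ 2) ^ 56 * rootProd g 8 (twoDeg i j 4 4) ^ 7 := by
  rw [deletionProd_twoDeg g hij, rootProd_twoDeg_of_coprime hij g (by norm_num) (by norm_num),
    rootProd_twoDeg_of_coprime hij g (by norm_num) (by norm_num), rootProd_twoDeg_four_four hij,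
    hc, hb]
  norm_num only [Nat.choose]
  ring

variable (p : α → α → R)

theorem hasDegreeRatio_one (m : ℕ) :
    HasDegreeRatio p m (twoDeg i j 1 (m + 1)) (1 - p j j ^ m * (p i j * p j i)) := by
  have factor_eq : twistFactor p (twoDeg i j 1 (m + 1)) (m + 1) =
      1 - p j j ^ m * (p i j * p j i) := by
    simp [twistFactor_twoDeg hij, mul_comm]
  refine hasDegreeRatio_of_pow_eq (k := (m + 1) * (m + 2)) (by positivity) ?_
  rw [← factor_eq]
  exact deletionProd_pow_one hij _ m

theorem hasDegreeRatio_two_even (k : ℕ) :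
    HasDegreeRatio p (2 * k + 2) (twoDeg i j 2 (2 * k + 2))
      (1 + p j j ^ ((2 * k + 2) * (2 * k + 1) / 2) * (-(p i j * p j i)) ^ (2 * k + 2) * p i i) := by
  have div_eq : (2 * k + 2) * (2 * k + 1) / 2 = (k + 1) * (2 * k + 1) := by
    rw [show (2 * k + 2) * (2 * k + 1) = 2 * ((k + 1) * (2 * k + 1)) by ring,
      Nat.mul_div_cancel_left _ two_pos]
  refine hasDegreeRatio_of_pow_eq (k := 2 * (k + 2) * (2 * k + 3)) (by positivity)
    (deletionProd_pow_two_even hij _ k ?_)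
  rw [twistFactor_twoDeg hij, twistFactor_twoDeg hij, show 2 * k + 2 - 1 = 2 * k + 1 by lia, div_eq,
    Even.neg_pow ⟨k + 1, by ring⟩]
  simp only [Nat.div_one, Nat.mul_div_cancel_left _ two_pos]
  ring

theorem hasDegreeRatio_two_odd (k : ℕ) :
    HasDegreeRatio p (2 * k + 3) (twoDeg i j 2 (2 * k + 3))
      (1 + p j j ^ ((2 * k + 3) * (2 * k + 2) / 2) * (-(p i j * p j i)) ^ (2 * k + 3) * p i i) := by
  have factor_eq : twistFactor p (twoDeg i j 2 (2 * k + 3)) 2 =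
      1 + p j j ^ ((2 * k + 3) * (2 * k + 2) / 2) * (-(p i j * p j i)) ^ (2 * k + 3) * p i i := by
    rw [twistFactor_twoDeg hij, show 2 * k + 3 - 1 = 2 * k + 2 by lia,
      Odd.neg_pow ⟨k + 1, by ring⟩]
    simp only [Nat.mul_div_cancel_left _ two_pos]
    ring
  refine hasDegreeRatio_of_pow_eq (k := 2 * (k + 2) * (2 * k + 5)) (by positivity) ?_
  rw [← factor_eq]
  exact deletionProd_pow_two_odd hij _ k

theorem hasDegreeRatio_three_three :
    HasDegreeRatio p 4 (twoDeg i j 3 3)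
      (qNumber 3 (p i i ^ 2 * (p i j * p j i) ^ 3 * p j j ^ 2)) := by
  refine hasDegreeRatio_of_pow_eq (by simp) (deletionProd_pow_three_three hij _ ?_)
  rw [qNumber_three, twistFactor_twoDeg hij, twistFactor_twoDeg hij]
  ring

theorem hasDegreeRatio_three_four :
    HasDegreeRatio p 5 (twoDeg i j 3 4)
      ((1 - p i i ^ 2 * (p i j * p j i) ^ 4 * p j j ^ 4) *
        qNumber 3 (p i i * (p i j * p j i) ^ 2 * p j j ^ 2)) := by
  refine .of_pow (N := 2) (by simp) (deletionProd_pow_three_four hij _) ?_ ?_ <;>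
    rw [qNumber_three, twistFactor_twoDeg hij, twistFactor_twoDeg hij] <;>
    set y := p i i * (p i j * p j i) ^ 2 * p j j ^ 2 with hy
  · refine ⟨(1 + y) * (1 + y + y ^ 2), ?_⟩
    rw [hy]
    ring
  · refine ⟨1 - y, ?_⟩
    rw [hy]
    ring

theorem hasDegreeRatio_three_six :
    HasDegreeRatio p 7 (twoDeg i j 3 6)
      ((1 - p i i * (p i j * p j i) ^ 3 * p j j ^ 5) *
        qNumber 3 (p i i ^ 2 * (p i j * p j i) ^ 6 * p j j ^ 10)) := by
  have factor_one : twistFactor p (twoDeg i j 3 6) 1 = twistFactor p (twoDeg i j 3 6) 3 *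
      qNumber 3 (p i i ^ 2 * (p i j * p j i) ^ 6 * p j j ^ 10) := by
    rw [qNumber_three, twistFactor_twoDeg hij, twistFactor_twoDeg hij]
    ring
  refine .of_pow (N := 2) (by simp) (deletionProd_pow_three_six hij _ factor_one) ?_ ?_ <;>
    rw [qNumber_three, twistFactor_twoDeg hij] <;>
    set y := p i i * (p i j * p j i) ^ 3 * p j j ^ 5 with hy
  · refine ⟨(1 - y) * (1 - y + y ^ 2), ?_⟩
    rw [hy]
    ring
  · refine ⟨1 + y + y ^ 2, ?_⟩
    rw [hy]
    ring

theorem hasDegreeRatio_four_four :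
    HasDegreeRatio p 6 (twoDeg i j 4 4)
      ((1 + p i i ^ 3 * (p i j * p j i) ^ 4 * p j j ^ 3) *
        (1 + p i i ^ 6 * (p i j * p j i) ^ 8 * p j j ^ 6)) := by
  have factor_two : twistFactor p (twoDeg i j 4 4) 2 = twistFactor p (twoDeg i j 4 4) 4 *
      (1 + p i i ^ 3 * (p i j * p j i) ^ 4 * p j j ^ 3) := by
    rw [twistFactor_twoDeg hij, twistFactor_twoDeg hij]
    ring
  have factor_one : twistFactor p (twoDeg i j 4 4) 1 = twistFactor p (twoDeg i j 4 4) 2 *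
      (1 + p i i ^ 6 * (p i j * p j i) ^ 8 * p j j ^ 6) := by
    rw [twistFactor_twoDeg hij, twistFactor_twoDeg hij]
    ring
  exact .of_pow (N := 2) (by simp) (deletionProd_pow_four_four hij _ factor_two factor_one)
    ⟨1 + p i i ^ 3 * (p i j * p j i) ^ 4 * p j j ^ 3, by ring⟩
    ⟨1 + p i i ^ 6 * (p i j * p j i) ^ 8 * p j j ^ 6, by ring⟩

end Exceptional

/-! ### The generic degrees -/

section Generic

open Finset

theorem rootOrder_eq_sum_totient {α : Type*} {d : ℕ} (w : Fin (d + 1) → α) :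
    rootOrder w = ∑ r ∈ Icc 1 (d + 1), if r ∣ rootOrder w then r.totient else 0 := by
  have rootOrder_le : rootOrder w ≤ d + 1 := Nat.le_of_dvd d.succ_pos (rootOrder_dvd w)
  conv_lhs => rw [← Nat.sum_totient (rootOrder w)]
  rw [← sum_filter]
  refine sum_congr ?_ fun _ _ => rfl
  ext r
  simp only [Nat.mem_divisors, mem_filter, mem_Icc]
  exact ⟨fun h => ⟨⟨Nat.pos_of_dvd_of_pos h.1 (rootOrder_pos w),
    (Nat.le_of_dvd (rootOrder_pos w) h.1).trans rootOrder_le⟩, h.1⟩,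
    fun h => ⟨h.2, (rootOrder_pos w).ne'⟩⟩

variable {α : Type*} [DecidableEq α] {r : ℕ} {l : α → ℕ}

/-- All multiplicities are multiples of `r` after removing at most one letter, as is the case when
some word of degree `l`, or of degree `l` with one letter removed, is an `r`-th power. -/
def IsNearMultiple (r : ℕ) (l : α → ℕ) : Prop :=
  (∀ a, r ∣ l a) ∨ ∃ j, 0 < l j ∧ ∀ a, r ∣ (l - Pi.single j 1 : α → ℕ) a

theorem IsNearMultiple.dvd_twistExp (h : IsNearMultiple r l) (x : α × α) : r ∣ twistExp l x := by
  obtain h | ⟨j, -, h⟩ := h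
  · exact (h x.1).mul_right _
  · obtain ⟨a, b⟩ := x
    have dvd_of_ne {c : α} (hc : c ≠ j) : r ∣ l c := by simpa [hc] using h c
    obtain ha | rfl := ne_or_eq a j
    · exact (dvd_of_ne ha).mul_right _
    obtain rfl | hb := eq_or_ne b a
    · simpa [twistExp] using (show r ∣ l b - 1 by simpa using h b).mul_left (l b)
    · simpa [twistExp, hb.symm] using (dvd_of_ne hb).mul_left (l a)

theorem isNearMultiple_rootOrder {d : ℕ} (w : Fin (d + 1) → α) :
    IsNearMultiple (rootOrder w) (wordDeg w) :=
  .inl (dvd_wordDeg w dvd_rfl)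

theorem isNearMultiple_rootOrder_of_wordDeg_eq_sub {d : ℕ} {w : Fin (d + 1) → α} {j : α}
    (hj : 0 < l j) (hw : wordDeg w = l - Pi.single j 1) : IsNearMultiple (rootOrder w) l :=
  .inr ⟨j, hj, hw ▸ dvd_wordDeg w dvd_rfl⟩

theorem not_dvd_sub_single (hr : 2 ≤ r) {j : α} (hj : 0 < l j) (h : r ∣ l j) :
    ¬ ∀ a, r ∣ (l - Pi.single j 1 : α → ℕ) a := by
  intro hsub
  have dvd_pred : r ∣ l j - 1 := by simpa using hsub j
  have dvd_one : r ∣ 1 := by simpa only [Nat.sub_sub_self hj] using Nat.dvd_sub h dvd_pred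
  exact absurd (Nat.dvd_one.1 dvd_one) (by lia)

theorem sub_single_div_eq (hr : 2 ≤ r) {j : α} (hj : 0 < l j) (h : r ∣ l j - 1) :
    (fun a => (l - Pi.single j 1 : α → ℕ) a / r) = fun a => l a / r := by
  ext a
  obtain rfl | ha := eq_or_ne a j
  · obtain ⟨t, ht⟩ := h
    have eq_add : l a = 1 + r * t := by lia
    simp [eq_add, Nat.add_mul_div_left, show 0 < r by lia, show 1 < r by lia]
  · simp [ha]

variable [Fintype α]

section TwistFactor

variable {R : Type*} [CommRing R] (p : α → α → R)

theorem IsNearMultiple.twistFactor_dvd (h : IsNearMultiple r l) :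
    twistFactor p l r ∣ twistFactor p l 1 := by
  have eq_pow : pMonomial p (fun x => twistExp l x / 1) =
      (pMonomial p fun x => twistExp l x / r) ^ r := by
    rw [← pMonomial_nsmul]
    congr 1
    ext x
    simp [Nat.mul_div_cancel' (h.dvd_twistExp x)]
  rw [twistFactor, twistFactor, eq_pow]
  simpa only [one_pow] using sub_dvd_pow_sub_pow (1 : R) (pMonomial p fun x => twistExp l x / r) r

theorem rootProd_twistFactor_dvd (d : ℕ) (l : α → ℕ) :
    rootProd (twistFactor p l) (d + 1) l ∣
      twistFactor p l 1 ^ ∑ w : Fin (d + 1) → α with wordDeg w = l, rootOrder w := by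
  rw [rootProd, ← prod_pow_eq_pow_sum]
  refine prod_dvd_prod_of_dvd _ _ fun w hw => pow_dvd_pow_of_dvd ?_ _
  obtain rfl : wordDeg w = l := by simpa using hw
  exact (isNearMultiple_rootOrder w).twistFactor_dvd p

theorem rootProd_eq_pow_mul (g : ℕ → R) (d : ℕ) (l : α → ℕ) :
    rootProd g d l = g 1 ^ #{w : Fin d → α | wordDeg w = l ∧ rootOrder w = 1} *
      ∏ w : Fin d → α with wordDeg w = l ∧ rootOrder w ≠ 1, g (rootOrder w) ^ rootOrder w := by
  rw [rootProd, ← prod_filter_mul_prod_filter_not _ (fun w => rootOrder w = 1), filter_filter,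
    filter_filter, ← prod_const]
  congr 1
  exact prod_congr rfl fun w hw => by rw [(mem_filter.1 hw).2.2, pow_one]

theorem exists_deletionProd_eq_pow_mul (d : ℕ) (l : α → ℕ) :
    ∃ G M, deletionProd (twistFactor p l) (d + 1) l = twistFactor p l 1 ^ (∑ j with 0 < l j,
      #{w : Fin (d + 1) → α | wordDeg w = l - Pi.single j 1 ∧ rootOrder w = 1}) * G ∧
      G ∣ twistFactor p l 1 ^ M := by
  refine ⟨∏ j with 0 < l j, ∏ w : Fin (d + 1) → α with
      wordDeg w = l - Pi.single j 1 ∧ rootOrder w ≠ 1, twistFactor p l (rootOrder w) ^ rootOrder w,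
    ∑ j with 0 < l j, ∑ w : Fin (d + 1) → α with
      wordDeg w = l - Pi.single j 1 ∧ rootOrder w ≠ 1, rootOrder w, ?_, ?_⟩
  · simp only [deletionProd, rootProd_eq_pow_mul, prod_mul_distrib, prod_pow_eq_pow_sum]
  · simp only [← prod_pow_eq_pow_sum]
    refine prod_dvd_prod_of_dvd _ _ fun j hj => prod_dvd_prod_of_dvd _ _ fun w hw =>
      pow_dvd_pow_of_dvd (IsNearMultiple.twistFactor_dvd p ?_) _
    exact isNearMultiple_rootOrder_of_wordDeg_eq_sub (mem_filter.1 hj).2 (mem_filter.1 hw).2.1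

variable {p} in
theorem hasDegreeRatio_of_dvd_pow {d S Q M : ℕ} {a G : R}
    (hroot : rootProd (twistFactor p l) (d + 2) l ∣ a ^ S)
    (hdel : deletionProd (twistFactor p l) (d + 1) l = a ^ Q * G) (hG : G ∣ a ^ M)
    (h : (d + 1) * S < (d + 2) * Q) : HasDegreeRatio p d l a := by
  obtain ⟨H, hH⟩ := pow_dvd_pow_of_dvd hroot (d + 1)
  obtain ⟨X, hX⟩ := Nat.exists_eq_add_of_lt h
  refine ⟨a ^ (X + 1) * H * G ^ (d + 2), ?_, ⟨X + 1 + S * (d + 1) + M * (d + 2), ?_⟩, 1, ?_⟩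
  · calc
      _ = a ^ (S * (d + 1)) * a ^ (X + 1) * G ^ (d + 2) := by
        rw [hdel, mul_pow, ← pow_mul, ← pow_add, mul_comm Q, hX]
        ring
      _ = _ := by rw [pow_mul, hH]; ring
  · rw [pow_add _ _ (M * _), pow_add _ _ (S * _), pow_mul _ S, pow_mul _ M]
    exact mul_dvd_mul (mul_dvd_mul_left _ (Dvd.intro_left _ hH.symm)) (pow_dvd_pow_of_dvd hG _)
  · rw [pow_one, mul_assoc]
    exact (dvd_pow_self a X.succ_ne_zero).mul_right _

theorem hasDegreeRatio_of_sum_rootOrder_lt {d : ℕ} (l : α → ℕ)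
    (h : (d + 1) * ∑ w : Fin (d + 2) → α with wordDeg w = l, rootOrder w <
      (d + 2) * ∑ j with 0 < l j,
        #{w : Fin (d + 1) → α | wordDeg w = l - Pi.single j 1 ∧ rootOrder w = 1}) :
    HasDegreeRatio p d l (twistFactor p l 1) := by
  obtain ⟨G, M, hdel, hG⟩ := exists_deletionProd_eq_pow_mul p d l
  exact hasDegreeRatio_of_dvd_pow (rootProd_twistFactor_dvd p (d + 1) l) hdel hG h

end TwistFactor

instance : Decidable (IsNearMultiple r l) :=
  inferInstanceAs (Decidable (_ ∨ _))

/-- An upper bound for the number of periodic words of degree `l` or of degree `l` with one letter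
removed, counted with multiplicity. -/
def periodicBound (l : α → ℕ) : ℕ :=
  ∑ r ∈ Icc 2 (∑ a, l a),
    if IsNearMultiple r l then r.totient * Nat.multinomial univ (fun a => l a / r) else 0

/-- Even counted as often as a degree has letters, its periodic words are outnumbered by its
words. -/
def HasFewPeriodicWords (l : α → ℕ) : Prop :=
  (∑ a, l a) * periodicBound l < Nat.multinomial univ l

section Counting

variable {d : ℕ}

theorem card_dvd_rootOrder_eq_zero (d : ℕ) (h : ¬ ∀ a, r ∣ l a) :
    #{w : Fin (d + 1) → α | wordDeg w = l ∧ r ∣ rootOrder w} = 0 := by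
  rw [card_eq_zero, filter_eq_empty_iff]
  rintro w - ⟨rfl, hw⟩
  exact h (dvd_wordDeg w hw)

theorem sum_rootOrder (hl : ∑ a, l a = d + 1) :
    ∑ w : Fin (d + 1) → α with wordDeg w = l, rootOrder w = Nat.multinomial univ l +
      ∑ r ∈ Icc 2 (∑ a, l a),
        r.totient * #{w : Fin (d + 1) → α | wordDeg w = l ∧ r ∣ rootOrder w} := by
  calc
    _ = ∑ r ∈ Icc 1 (d + 1),
        r.totient * #{w : Fin (d + 1) → α | wordDeg w = l ∧ r ∣ rootOrder w} := by
      rw [sum_congr rfl fun w _ => rootOrder_eq_sum_totient w, sum_comm]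
      refine sum_congr rfl fun r _ => ?_
      rw [← sum_filter, filter_filter, sum_const, smul_eq_mul, mul_comm]
    _ = _ := by
      rw [hl, ← insert_Icc_add_one_left_eq_Icc (by lia : 1 ≤ d + 1), sum_insert (by simp)]
      simp only [one_dvd, and_true, Nat.totient_one, one_mul, card_wordDeg_eq l hl, Nat.reduceAdd]

theorem multinomial_le_card_rootOrder_one (hl : ∑ a, l a = d + 1) :
    Nat.multinomial univ l ≤ #{w : Fin (d + 1) → α | wordDeg w = l ∧ rootOrder w = 1} +
      ∑ r ∈ Icc 2 (d + 2), #{w : Fin (d + 1) → α | wordDeg w = l ∧ r ∣ rootOrder w} := by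
  rw [← card_wordDeg_eq l hl]
  have subset_union : ({w | wordDeg w = l} : Finset (Fin (d + 1) → α)) ⊆
      ({w | wordDeg w = l ∧ rootOrder w = 1} : Finset _) ∪
        (Icc 2 (d + 2)).biUnion fun r => {w | wordDeg w = l ∧ r ∣ rootOrder w} := by
    intro w hw
    have rootOrder_le : rootOrder w ≤ d + 1 := Nat.le_of_dvd d.succ_pos (rootOrder_dvd w)
    have := rootOrder_pos w
    simp only [mem_union, mem_biUnion, mem_filter, mem_univ, true_and, mem_Icc] at hw ⊢
    by_cases! one : rootOrder w = 1
    · exact .inl ⟨hw, one⟩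
    · exact .inr ⟨rootOrder w, by lia, hw, dvd_rfl⟩
  exact (card_le_card subset_union).trans <|
    (card_union_le _ _).trans (Nat.add_le_add_left card_biUnion_le _)

variable (hl : ∑ a, l a = d + 2)
include hl

theorem multinomial_le_sum_card_rootOrder_one :
    Nat.multinomial univ l ≤ ∑ j with 0 < l j,
        #{w : Fin (d + 1) → α | wordDeg w = l - Pi.single j 1 ∧ rootOrder w = 1} +
      ∑ r ∈ Icc 2 (d + 2), ∑ j with 0 < l j,
        #{w : Fin (d + 1) → α | wordDeg w = l - Pi.single j 1 ∧ r ∣ rootOrder w} := by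
  rw [multinomial_eq_sum_sub_single l (by lia), sum_comm, ← sum_add_distrib]
  exact sum_le_sum fun j hj =>
    multinomial_le_card_rootOrder_one (sum_sub_single hl (mem_filter.1 hj).2)

theorem sum_card_dvd_rootOrder_of_dvd_sub (hr : 2 ≤ r) {j : α} (hj : 0 < l j)
    (h : ∀ a, r ∣ (l - Pi.single j 1 : α → ℕ) a) :
    ∑ j with 0 < l j, #{w : Fin (d + 1) → α | wordDeg w = l - Pi.single j 1 ∧ r ∣ rootOrder w} =
      Nat.multinomial univ fun a => l a / r := by
  rw [sum_eq_single_of_mem j (by simpa using hj),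
    card_dvd_rootOrder _ (sum_sub_single hl hj) h,
    sub_single_div_eq hr hj (by simpa using h j)]
  intro k hk hkj
  exact card_dvd_rootOrder_eq_zero d
    (not_dvd_sub_single hr (mem_filter.1 hk).2 (by simpa [hkj] using h k))

theorem totient_mul_card_add_sum_le (hr : 2 ≤ r) :
    r.totient * #{w : Fin (d + 2) → α | wordDeg w = l ∧ r ∣ rootOrder w} + ∑ j with 0 < l j,
      #{w : Fin (d + 1) → α | wordDeg w = l - Pi.single j 1 ∧ r ∣ rootOrder w} ≤
    if IsNearMultiple r l then r.totient * Nat.multinomial univ (fun a => l a / r) else 0 := by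
  by_cases dvd : ∀ a, r ∣ l a
  · rw [if_pos (.inl dvd), card_dvd_rootOrder l hl dvd, sum_eq_zero, add_zero]
    exact fun j hj => card_dvd_rootOrder_eq_zero d
      (not_dvd_sub_single hr (mem_filter.1 hj).2 (dvd j))
  rw [card_dvd_rootOrder_eq_zero _ dvd, mul_zero, zero_add]
  by_cases dvd_sub : ∃ j, 0 < l j ∧ ∀ a, r ∣ (l - Pi.single j 1 : α → ℕ) a
  · obtain ⟨j, hj, h⟩ := dvd_sub
    rw [if_pos (.inr ⟨j, hj, h⟩), sum_card_dvd_rootOrder_of_dvd_sub hl hr hj h]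
    exact Nat.le_mul_of_pos_left _ (Nat.totient_pos.2 (by lia))
  · rw [sum_eq_zero]
    · exact Nat.zero_le _
    · exact fun j hj => card_dvd_rootOrder_eq_zero d fun h =>
        dvd_sub ⟨j, (mem_filter.1 hj).2, h⟩

theorem HasFewPeriodicWords.hasDegreeRatio (h : HasFewPeriodicWords l) {R : Type*} [CommRing R]
    (p : α → α → R) : HasDegreeRatio p d l (twistFactor p l 1) := by
  rw [HasFewPeriodicWords, hl] at h
  refine hasDegreeRatio_of_sum_rootOrder_lt p l ?_
  have periodic_le : (∑ r ∈ Icc 2 (d + 2), r.totient *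
        #{w : Fin (d + 2) → α | wordDeg w = l ∧ r ∣ rootOrder w}) +
      ∑ r ∈ Icc 2 (d + 2), ∑ j with 0 < l j,
        #{w : Fin (d + 1) → α | wordDeg w = l - Pi.single j 1 ∧ r ∣ rootOrder w} ≤
      periodicBound l := by
    rw [← sum_add_distrib, periodicBound, hl]
    exact sum_le_sum fun r hr => totient_mul_card_add_sum_le hl (mem_Icc.1 hr).1
  rw [sum_rootOrder hl, hl]
  grind [Nat.mul_le_mul_left (d + 2) (multinomial_le_sum_card_rootOrder_one hl),
    Nat.mul_le_mul_left (d + 2) periodic_le]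

end Counting

end Generic

/-! ### Estimates for multinomial coefficients -/

section Estimates

open Finset

theorem sum_totient_dvd_le {m : ℕ} (hm : 0 < m) (N : ℕ) :
    (∑ r ∈ Icc 2 N, if r ∣ m then r.totient else 0) ≤ m - 1 := by
  have sum_totient := Nat.sum_totient m
  rw [← add_sum_erase _ _ (Nat.one_mem_divisors.2 hm.ne'), Nat.totient_one] at sum_totient
  rw [← sum_filter]
  refine (sum_le_sum_of_subset (t := m.divisors.erase 1) ?_).trans (by lia)
  intro r hr
  simp only [mem_filter, mem_Icc] at hr
  simp only [mem_erase, Nat.mem_divisors]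
  exact ⟨by lia, hr.2, hm.ne'⟩

theorem choose_le_choose_add {x x' y y' : ℕ} (hx : x ≤ x') (hy : y ≤ y') :
    (x + y).choose x ≤ (x' + y').choose x' := by
  calc (x + y).choose x ≤ (x + y').choose x := Nat.choose_le_choose _ (by lia)
    _ = (x + y').choose y' := Nat.choose_symm_add
    _ ≤ (x' + y').choose y' := Nat.choose_le_choose _ (by lia)
    _ = (x' + y').choose x' := Nat.choose_symm_add.symm

theorem two_mul_le_choose_two_mul (y : ℕ) : 2 * (2 * y + 1) ≤ (2 * (y + 1)).choose (y + 1) := by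
  have recursion := Nat.succ_mul_centralBinom_succ y
  have lt_centralBinom : y + 1 ≤ y.centralBinom := by
    calc y + 1 = (1 + y).choose 1 := by rw [Nat.choose_one_right, add_comm]
      _ ≤ (1 + y).choose y := (Nat.choose_symm_add (a := 1) (b := y)).le
      _ ≤ y.centralBinom := by
        obtain rfl | hy := Nat.eq_zero_or_pos y
        · simp
        · exact Nat.choose_le_choose _ (by lia)
  rw [← Nat.centralBinom_eq_two_mul_choose]
  nlinarith

theorem add_le_choose {y z : ℕ} (hy : 1 ≤ y) (hz : 1 ≤ z) : y + z ≤ (y + z).choose y := by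
  induction y, hy using Nat.le_induction with
  | base => simp
  | succ y _ ih =>
    have : 0 < (y + z).choose (y + 1) := Nat.choose_pos (by lia)
    rw [add_right_comm, Nat.choose_succ_succ']
    lia

theorem two_mul_choose_two (z : ℕ) : 2 * (2 + z).choose 2 = (z + 2) * (z + 1) := by
  rw [add_comm 2 z, mul_comm, ← Nat.add_one_mul_choose_eq, Nat.choose_one_right]

section Multinomial

variable {α : Type*} [Fintype α]

theorem multinomial_mul_le (k m : α → ℕ) :
    Nat.multinomial univ k * Nat.multinomial univ m ≤ Nat.multinomial univ (k + m) := by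
  classical
  -- Concatenation of words is injective.
  rw [← card_wordDeg_eq k rfl, ← card_wordDeg_eq m rfl,
    ← card_wordDeg_eq (d := ∑ a, k a + ∑ a, m a) (k + m) (by simp [sum_add_distrib]),
    ← card_product]
  refine card_le_card_of_injOn (fun x => Fin.append x.1 x.2) ?_ ?_
  · rintro ⟨u, v⟩ huv
    simp only [coe_product, Set.mem_prod, mem_coe, mem_filter, mem_univ, true_and] at huv
    simp only [coe_filter, mem_univ, true_and, Set.mem_ofPred_eq, ← huv.1, ← huv.2]
    ext a
    rw [Pi.add_apply, wordDeg_eq_sum, wordDeg_eq_sum, wordDeg_eq_sum, Fin.sum_univ_add]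
    simp only [Fin.append_left, Fin.append_right]
  · exact fun _ _ _ _ heq => (Fin.appendEquiv _ _).injective heq

theorem multinomial_mono {k m : α → ℕ} (h : k ≤ m) :
    Nat.multinomial univ k ≤ Nat.multinomial univ m := by
  obtain ⟨t, rfl⟩ := exists_add_of_le h
  exact (Nat.le_mul_of_pos_right _ (Nat.multinomial_pos _ _)).trans (multinomial_mul_le k t)

theorem multinomial_le_factorial (k : α → ℕ) : Nat.multinomial univ k ≤ (∑ a, k a).factorial :=
  Nat.le_of_dvd (Nat.factorial_pos _) (Dvd.intro_left _ (Nat.multinomial_spec univ k))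

theorem choose_mul_choose_le_multinomial (k : α → ℕ) {c c' : α} (hc : c ≠ c') :
    (∑ a, k a).choose (k c) * (∑ a, k a - k c).choose (k c') ≤ Nat.multinomial univ k := by
  classical
  have not_mem' : c' ∉ (univ.erase c).erase c' := notMem_erase _ _
  have not_mem : c ∉ insert c' ((univ.erase c).erase c') := by simp [hc]
  have univ_eq : univ = insert c (insert c' ((univ.erase c).erase c')) := by
    rw [insert_erase (by simp [hc.symm]), insert_erase (mem_univ c)]
  rw [univ_eq, Nat.multinomial_insert not_mem, Nat.multinomial_insert not_mem', sum_insert not_mem,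
    sum_insert not_mem', ← mul_assoc, Nat.add_sub_cancel_left]
  exact Nat.le_mul_of_pos_right _ (Nat.multinomial_pos _ _)

theorem add_add_le_sum (k : α → ℕ) {c₁ c₂ c₃ : α} (h12 : c₁ ≠ c₂) (h13 : c₁ ≠ c₃) (h23 : c₂ ≠ c₃) :
    k c₁ + k c₂ + k c₃ ≤ ∑ a, k a := by
  classical
  calc k c₁ + k c₂ + k c₃ = ∑ a ∈ {c₁, c₂, c₃}, k a := by
        rw [sum_insert (by simp [h12, h13]), sum_pair h23, add_assoc]
    _ ≤ ∑ a, k a := sum_le_sum_of_subset (subset_univ _)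

theorem sum_le_two_mul_sum_half (l : α → ℕ) : ∑ a, l a ≤ 2 * ∑ a, (l a + 1) / 2 := by
  rw [mul_sum]
  exact sum_le_sum fun a _ => by lia

end Multinomial

variable {α : Type*} [DecidableEq α] {r : ℕ} {l : α → ℕ}

theorem IsNearMultiple.dvd_or_dvd_sub_one (h : IsNearMultiple r l) (c : α) :
    r ∣ l c ∨ r ∣ l c - 1 := by
  obtain h | ⟨j, -, h⟩ := h
  · exact .inl (h c)
  obtain rfl | hc := eq_or_ne c j
  · exact .inr (by simpa using h c)
  · exact .inl (by simpa [hc] using h c)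

theorem IsNearMultiple.dvd_of_eq_one (h : IsNearMultiple r l) (hr : 2 ≤ r) {c b : α} (hc : l c = 1)
    (hb : b ≠ c) : r ∣ l b := by
  have not_dvd : ¬ r ∣ l c := fun hdvd => by
    have := Nat.dvd_one.1 (hc ▸ hdvd)
    lia
  obtain h | ⟨j, -, h⟩ := h
  · exact h b
  obtain rfl | hj := eq_or_ne c j
  · simpa [hb] using h b
  · exact absurd (by simpa [hj] using h c) not_dvd

variable [Fintype α]

theorem periodicBound_le_sum_mul (f : ℕ → ℕ)
    (hf : ∀ r, 2 ≤ r → IsNearMultiple r l → r.totient ≤ f r) :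
    periodicBound l ≤
      (∑ r ∈ Icc 2 (∑ a, l a), f r) * Nat.multinomial univ (fun a => l a / 2) := by
  rw [periodicBound, sum_mul]
  refine sum_le_sum fun r hr => ?_
  have two_le : 2 ≤ r := (mem_Icc.1 hr).1
  split_ifs with near
  · exact Nat.mul_le_mul (hf r two_le near)
      (multinomial_mono fun _ => Nat.div_le_div_left two_le two_pos)
  · exact Nat.zero_le _

theorem periodicBound_le {c : α} (hc : 2 ≤ l c) :
    periodicBound l ≤ (2 * l c - 3) * Nat.multinomial univ (fun a => l a / 2) := by
  refine (periodicBound_le_sum_mul (fun r => (if r ∣ l c then r.totient else 0) +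
    if r ∣ l c - 1 then r.totient else 0) fun r _ near => ?_).trans (Nat.mul_le_mul_right _ ?_)
  · obtain dvd | dvd := near.dvd_or_dvd_sub_one c <;> simp [dvd]
  · have sum_le := sum_totient_dvd_le (m := l c) (by lia) (∑ a, l a)
    have sum_sub_le := sum_totient_dvd_le (m := l c - 1) (by lia) (∑ a, l a)
    rw [sum_add_distrib]
    lia

theorem periodicBound_le_of_eq_one {c b : α} (hc : l c = 1) (hb : b ≠ c) (hlb : 1 ≤ l b) :
    periodicBound l ≤ (l b - 1) * Nat.multinomial univ (fun a => l a / 2) := by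
  refine (periodicBound_le_sum_mul (fun r => if r ∣ l b then r.totient else 0)
    fun r hr near => ?_).trans (Nat.mul_le_mul_right _ (sum_totient_dvd_le hlb _))
  simp [near.dvd_of_eq_one hr hc hb]

theorem HasFewPeriodicWords.of_half {A : ℕ}
    (hbound : periodicBound l ≤ A * Nat.multinomial univ (fun a => l a / 2))
    (hA : (∑ a, l a) * A < Nat.multinomial univ (fun a => (l a + 1) / 2)) :
    HasFewPeriodicWords l := by
  have eq_add : l = (fun a => l a / 2) + fun a => (l a + 1) / 2 := by
    ext a
    simp only [Pi.add_apply]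
    lia
  calc (∑ a, l a) * periodicBound l
      ≤ (∑ a, l a) * (A * Nat.multinomial univ (fun a => l a / 2)) := Nat.mul_le_mul_left _ hbound
    _ = Nat.multinomial univ (fun a => l a / 2) * ((∑ a, l a) * A) := by ring
    _ < Nat.multinomial univ (fun a => l a / 2) * Nat.multinomial univ (fun a => (l a + 1) / 2) :=
        Nat.mul_lt_mul_of_pos_left hA (Nat.multinomial_pos _ _)
    _ ≤ Nat.multinomial univ l := by
        conv_rhs => rw [eq_add]
        exact multinomial_mul_le _ _

section ThreeLetters

variable {c₁ c₂ c₃ : α} (h12 : c₁ ≠ c₂) (h13 : c₁ ≠ c₃) (h23 : c₂ ≠ c₃)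
include h12 h13 h23

theorem hasFewPeriodicWords_of_eq_one (h1 : l c₁ = 1) (h2 : 1 ≤ l c₂) (h3 : l c₂ ≤ l c₃) :
    HasFewPeriodicWords l := by
  refine .of_half (periodicBound_le_of_eq_one h1 h12.symm h2) ?_
  have letters_le := add_add_le_sum (fun a => (l a + 1) / 2) h12 h13 h23
  have multinomial_ge := choose_mul_choose_le_multinomial (fun a => (l a + 1) / 2) h12
  have sum_lt : ∑ a, l a < 2 * ∑ a, (l a + 1) / 2 := by
    rw [mul_sum]
    exact sum_lt_sum (fun a _ => by lia) ⟨c₁, mem_univ _, by lia⟩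
  set K := ∑ a, (l a + 1) / 2
  obtain ⟨y, hy⟩ : ∃ y, (l c₂ + 1) / 2 = y + 1 := ⟨(l c₂ + 1) / 2 - 1, by lia⟩
  have choose_ge : 2 * (2 * y + 1) ≤ (K - 1).choose (y + 1) :=
    (two_mul_le_choose_two_mul y).trans (Nat.choose_le_choose _ (by lia))
  simp only [h1, hy, Nat.reduceAdd, Nat.reduceDiv, Nat.choose_one_right] at multinomial_ge
  calc (∑ a, l a) * (l c₂ - 1) ≤ (∑ a, l a) * (2 * y + 1) := Nat.mul_le_mul_left _ (by lia)
    _ < 2 * K * (2 * y + 1) := Nat.mul_lt_mul_of_pos_right sum_lt (by lia)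
    _ = K * (2 * (2 * y + 1)) := by ring
    _ ≤ K * (K - 1).choose (y + 1) := Nat.mul_le_mul_left _ choose_ge
    _ ≤ _ := multinomial_ge

theorem hasFewPeriodicWords_of_eq_two_of_sum_half (h1 : l c₁ = 2) (h2 : 2 ≤ l c₂) (h3 : 2 ≤ l c₃)
    (hK : ∑ a, (l a + 1) / 2 = 3) : HasFewPeriodicWords l := by
  have half_le := add_add_le_sum (fun a => (l a + 1) / 2) h12 h13 h23
  have letters_le := add_add_le_sum l h12 h13 h23
  have sum_le := sum_le_two_mul_sum_half l
  have half_multinomial_le : Nat.multinomial univ (fun a => l a / 2) ≤ 6 :=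
    (multinomial_le_factorial _).trans <| Nat.factorial_le (n := 3) <|
      hK ▸ sum_le_sum fun a _ => by lia
  have bound := periodicBound_le (l := l) (c := c₁) (by lia)
  have multinomial_ge := choose_mul_choose_le_multinomial l h12
  rw [show ∑ a, l a = 6 by lia, h1, show l c₂ = 2 by lia] at multinomial_ge
  rw [h1] at bound
  have choose_eq : Nat.choose 6 2 * Nat.choose (6 - 2) 2 = 90 := rfl
  rw [HasFewPeriodicWords, show ∑ a, l a = 6 by lia]
  lia

theorem hasFewPeriodicWords_of_eq_two (h1 : l c₁ = 2) (h2 : 2 ≤ l c₂) (h3 : 2 ≤ l c₃) :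
    HasFewPeriodicWords l := by
  have letters_le := add_add_le_sum (fun a => (l a + 1) / 2) h12 h13 h23
  have multinomial_ge := choose_mul_choose_le_multinomial (fun a => (l a + 1) / 2) h12
  have sum_le := sum_le_two_mul_sum_half l
  by_cases hK : ∑ a, (l a + 1) / 2 = 3
  · exact hasFewPeriodicWords_of_eq_two_of_sum_half h12 h13 h23 h1 h2 h3 hK
  refine .of_half (periodicBound_le h1.ge) ?_
  set K := ∑ a, (l a + 1) / 2
  have choose_ge : K - 1 ≤ (K - 1).choose ((l c₂ + 1) / 2) := by
    have := add_le_choose (y := (l c₂ + 1) / 2) (z := K - 1 - (l c₂ + 1) / 2) (by lia) (by lia)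
    rwa [show (l c₂ + 1) / 2 + (K - 1 - (l c₂ + 1) / 2) = K - 1 by lia] at this
  simp only [h1, Nat.reduceAdd, Nat.reduceDiv, Nat.choose_one_right] at multinomial_ge
  calc (∑ a, l a) * (2 * l c₁ - 3) ≤ K * 2 := by lia
    _ < K * (K - 1) := Nat.mul_lt_mul_of_pos_left (by lia) (by lia)
    _ ≤ K * (K - 1).choose ((l c₂ + 1) / 2) := Nat.mul_le_mul_left _ choose_ge
    _ ≤ _ := multinomial_ge

theorem hasFewPeriodicWords_of_three_le (h1 : 3 ≤ l c₁) (h2 : l c₁ ≤ l c₂) (h3 : l c₂ ≤ l c₃) :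
    HasFewPeriodicWords l := by
  refine .of_half (periodicBound_le (c := c₁) (by lia)) ?_
  have letters_le := add_add_le_sum (fun a => (l a + 1) / 2) h12 h13 h23
  have multinomial_ge := choose_mul_choose_le_multinomial (fun a => (l a + 1) / 2) h12
  have sum_le := sum_le_two_mul_sum_half l
  set K := ∑ a, (l a + 1) / 2
  obtain ⟨x, hx⟩ : ∃ x, (l c₁ + 1) / 2 = x + 1 := ⟨(l c₁ + 1) / 2 - 1, by lia⟩
  obtain ⟨z, hz⟩ : ∃ z, K = x + 1 + z := ⟨K - (x + 1), by lia⟩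
  have choose_ge : (2 + z).choose 2 ≤ K.choose (x + 1) :=
    hz ▸ choose_le_choose_add (by lia) le_rfl
  have choose_ge' : 2 * (2 * x + 1) ≤ z.choose ((l c₂ + 1) / 2) := by
    obtain ⟨t, ht⟩ : ∃ t, z = (l c₂ + 1) / 2 + t := ⟨z - (l c₂ + 1) / 2, by lia⟩
    refine (two_mul_le_choose_two_mul x).trans ?_
    rw [two_mul, ht]
    exact choose_le_choose_add (by lia) (by lia)
  rw [hx, show K - (x + 1) = z by lia] at multinomial_ge
  have choose_two := two_mul_choose_two z
  have four_le : 4 ≤ z := by lia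
  calc (∑ a, l a) * (2 * l c₁ - 3) ≤ 3 * z * (2 * (2 * x + 1)) := Nat.mul_le_mul (by lia) (by lia)
    _ < (2 + z).choose 2 * (2 * (2 * x + 1)) :=
      Nat.mul_lt_mul_of_pos_right (by nlinarith) (by lia)
    _ ≤ K.choose (x + 1) * z.choose ((l c₂ + 1) / 2) := Nat.mul_le_mul choose_ge choose_ge'
    _ ≤ _ := multinomial_ge

theorem hasFewPeriodicWords_of_sorted (h1 : 1 ≤ l c₁) (h2 : l c₁ ≤ l c₂) (h3 : l c₂ ≤ l c₃) :
    HasFewPeriodicWords l := by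
  obtain h1 | h1 | h1 : l c₁ = 1 ∨ l c₁ = 2 ∨ 3 ≤ l c₁ := by lia
  · exact hasFewPeriodicWords_of_eq_one h12 h13 h23 h1 (by lia) h3
  · exact hasFewPeriodicWords_of_eq_two h12 h13 h23 h1 (by lia) (by lia)
  · exact hasFewPeriodicWords_of_three_le h12 h13 h23 h1 h2 h3

theorem hasFewPeriodicWords_of_three (h1 : 1 ≤ l c₁) (h2 : 1 ≤ l c₂) (h3 : 1 ≤ l c₃) :
    HasFewPeriodicWords l := by
  wlog h : l c₁ ≤ l c₂ generalizing c₁ c₂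
  · exact this h12.symm h23 h13 h2 h1 (by lia)
  obtain h' | h' := le_total (l c₂) (l c₃)
  · exact hasFewPeriodicWords_of_sorted h12 h13 h23 h1 h h'
  obtain h'' | h'' := le_total (l c₁) (l c₃)
  · exact hasFewPeriodicWords_of_sorted h13 h12 h23.symm h1 h'' h'
  · exact hasFewPeriodicWords_of_sorted h13.symm h23.symm h12 h3 h'' h

end ThreeLetters

end Estimates

/-! ### Degrees with two letters -/

section TwoLetters

open Finset

theorem mul_lt_choose_of_le {x y₀ y C : ℕ}
    (base : 2 * (x + 1 + y₀) * C < (x + 1 + y₀).choose (x + 1))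
    (growth : 2 * C ≤ (x + 1 + y₀).choose x) (hy : y₀ ≤ y) :
    2 * (x + 1 + y) * C < (x + 1 + y).choose (x + 1) := by
  induction y, hy using Nat.le_induction with
  | base => exact base
  | succ y hy ih =>
    have pascal := Nat.choose_succ_succ' (x + 1 + y) x
    have growth' : 2 * C ≤ (x + 1 + y).choose x := growth.trans (Nat.choose_le_choose _ (by lia))
    rw [← add_assoc]
    lia

theorem mul_sq_lt_choose_six {y : ℕ} (hy : 6 ≤ y) : 16 * y ^ 2 < (6 + y).choose 6 := by
  induction y, hy using Nat.le_induction with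
  | base => decide
  | succ y hy ih =>
    have pascal : (6 + (y + 1)).choose 6 = (6 + y).choose 5 + (6 + y).choose 6 :=
      Nat.choose_succ_succ' (6 + y) 5
    have growth : 2 * (5 + (y + 1)) * 17 < (5 + (y + 1)).choose 5 :=
      mul_lt_choose_of_le (x := 4) (y₀ := 6) (by decide) (by decide) (by lia)
    rw [show 5 + (y + 1) = 6 + y by lia] at growth
    lia

/-- The exponent pairs for which the words of half the length already show that there are few
periodic words. -/
def IsLargePair (a b : ℕ) : Prop :=
  (a ≤ 4 ∧ 39 ≤ b) ∨ (5 ≤ a ∧ a ≤ 6 ∧ 17 ≤ b) ∨ (7 ≤ a ∧ a ≤ 8 ∧ 13 ≤ b) ∨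
    (9 ≤ a ∧ a ≤ 10 ∧ 11 ≤ b) ∨ 11 ≤ a

instance (a b : ℕ) : Decidable (IsLargePair a b) :=
  inferInstanceAs (Decidable (_ ∨ _))

theorem IsLargePair.mul_lt_choose_half {a b : ℕ} (h : IsLargePair a b) (ha : 3 ≤ a) (hab : a ≤ b) :
    (a + b) * (2 * a - 3) < ((a + 1) / 2 + (b + 1) / 2).choose ((a + 1) / 2) := by
  generalize hx : (a + 1) / 2 = x
  generalize hy : (b + 1) / 2 = y
  have sum_le : a + b ≤ 2 * (x + y) := by lia
  obtain ⟨_, _⟩ | ⟨_, _, _⟩ | ⟨_, _, _⟩ | ⟨_, _, _⟩ | _ := h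
  · obtain rfl : x = 1 + 1 := by lia
    exact (Nat.mul_le_mul sum_le (by lia)).trans_lt
      (mul_lt_choose_of_le (y₀ := 20) (C := 5) (by decide) (by decide) (by lia))
  · obtain rfl : x = 2 + 1 := by lia
    exact (Nat.mul_le_mul sum_le (by lia)).trans_lt
      (mul_lt_choose_of_le (y₀ := 9) (C := 9) (by decide) (by decide) (by lia))
  · obtain rfl : x = 3 + 1 := by lia
    exact (Nat.mul_le_mul sum_le (by lia)).trans_lt
      (mul_lt_choose_of_le (y₀ := 7) (C := 13) (by decide) (by decide) (by lia))
  · obtain rfl : x = 4 + 1 := by lia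
    exact (Nat.mul_le_mul sum_le (by lia)).trans_lt
      (mul_lt_choose_of_le (y₀ := 6) (C := 17) (by decide) (by decide) (by lia))
  · calc (a + b) * (2 * a - 3) ≤ 4 * y * (4 * y) := Nat.mul_le_mul (by lia) (by lia)
      _ = 16 * y ^ 2 := by ring
      _ < (6 + y).choose 6 := mul_sq_lt_choose_six (by lia)
      _ ≤ (x + y).choose x := choose_le_choose_add (by lia) le_rfl

/-- The pairs `3 ≤ a ≤ b` for which there are too many periodic words of degree `a eᵢ + b eⱼ` for
the generic argument. -/
def exceptionalPairs : Finset (ℕ × ℕ) := {(3, 3), (3, 4), (3, 6), (4, 4)}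

/-- The bound `periodicBound` for degrees with two letters. It is written with descending factorials
because these evaluate quickly, unlike `Nat.choose`. -/
def twoLetterBound (a b : ℕ) : ℕ :=
  ∑ r ∈ Icc 2 a, if (r ∣ a ∧ r ∣ b) ∨ (r ∣ a - 1 ∧ r ∣ b) ∨ (r ∣ a ∧ r ∣ b - 1) then
    r.totient * ((a / r + b / r).descFactorial (a / r) / (a / r).factorial) else 0

theorem mul_twoLetterBound_lt_of_not_isLargePair : ∀ a ∈ Icc 3 10, ∀ b ∈ Icc 3 38,
    a ≤ b → ¬ IsLargePair a b → (a, b) ∉ exceptionalPairs →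
    (a + b) * twoLetterBound a b < (a + b).descFactorial a / a.factorial := by
  decide +kernel

variable {α : Type*} [DecidableEq α] {i j : α} (hij : i ≠ j)
include hij

theorem IsNearMultiple.twoDeg_dvd {a b r : ℕ} (h : IsNearMultiple r (twoDeg i j a b)) :
    (r ∣ a ∧ r ∣ b) ∨ (r ∣ a - 1 ∧ r ∣ b) ∨ (r ∣ a ∧ r ∣ b - 1) := by
  obtain h | ⟨k, hk, h⟩ := h
  · exact .inl ((forall_dvd_twoDeg hij).1 h)
  obtain rfl | hki := eq_or_ne k i
  · have dvd_left := h k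
    have dvd_right := h j
    simp only [Pi.sub_apply, Pi.single_eq_same, Pi.single_eq_of_ne hij.symm, twoDeg_left hij,
      twoDeg_right hij, Nat.sub_zero] at dvd_left dvd_right
    exact .inr (.inl ⟨dvd_left, dvd_right⟩)
  obtain rfl | hkj := eq_or_ne k j
  · have dvd_left := h i
    have dvd_right := h k
    simp only [Pi.sub_apply, Pi.single_eq_same, Pi.single_eq_of_ne hij, twoDeg_left hij,
      twoDeg_right hij, Nat.sub_zero] at dvd_left dvd_right
    exact .inr (.inr ⟨dvd_left, dvd_right⟩)
  · exact absurd (twoDeg_of_ne hki hkj a b) hk.ne'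

variable [Fintype α]

theorem periodicBound_twoDeg_le {a b : ℕ} (ha : 2 ≤ a) :
    periodicBound (twoDeg i j a b) ≤ twoLetterBound a b := by
  rw [periodicBound, twoLetterBound, sum_twoDeg,
    ← sum_subset (Icc_subset_Icc_right (Nat.le_add_right a b))]
  · refine sum_le_sum fun r _ => ?_
    split_ifs with near dvd
    · rw [twoDeg_div hij, multinomial_twoDeg hij, Nat.choose_eq_descFactorial_div_factorial]
    · exact absurd (near.twoDeg_dvd hij) dvd
    · exact Nat.zero_le _
    · exact le_rfl
  · intro r hr hra
    simp only [mem_Icc] at hr hra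
    refine if_neg fun near => ?_
    have not_dvd : ¬ r ∣ a := fun h => by
      have := Nat.le_of_dvd (by lia) h
      lia
    have not_dvd_sub_one : ¬ r ∣ a - 1 := fun h => by
      have := Nat.le_of_dvd (by lia) h
      lia
    have := near.twoDeg_dvd hij
    tauto

theorem hasFewPeriodicWords_of_isLargePair {a b : ℕ} (ha : 3 ≤ a) (hab : a ≤ b)
    (h : IsLargePair a b) : HasFewPeriodicWords (twoDeg i j a b) := by
  have half_eq : (fun c => (twoDeg i j a b c + 1) / 2) =
      twoDeg i j ((a + 1) / 2) ((b + 1) / 2) := by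
    ext c
    obtain rfl | hi := eq_or_ne c i
    · simp only [twoDeg_left hij]
    obtain rfl | hj := eq_or_ne c j
    · simp only [twoDeg_right hij]
    · simp only [twoDeg_of_ne hi hj, zero_add, Nat.reduceDiv]
  refine .of_half (periodicBound_le (c := i) (by rw [twoDeg_left hij]; lia)) ?_
  rw [half_eq, multinomial_twoDeg hij, sum_twoDeg, twoDeg_left hij]
  exact h.mul_lt_choose_half ha hab

theorem hasFewPeriodicWords_twoDeg {a b : ℕ} (ha : 3 ≤ a) (hab : a ≤ b)
    (h : (a, b) ∉ exceptionalPairs) : HasFewPeriodicWords (twoDeg i j a b) := by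
  by_cases hlarge : IsLargePair a b
  · exact hasFewPeriodicWords_of_isLargePair hij ha hab hlarge
  have small : a ≤ 10 ∧ b ≤ 38 := by
    unfold IsLargePair at hlarge
    lia
  have lt := mul_twoLetterBound_lt_of_not_isLargePair a (mem_Icc.2 ⟨ha, small.1⟩) b
    (mem_Icc.2 ⟨by lia, small.2⟩) hab hlarge h
  rw [HasFewPeriodicWords, sum_twoDeg, multinomial_twoDeg hij,
    Nat.choose_eq_descFactorial_div_factorial]
  exact (Nat.mul_le_mul_left _ (periodicBound_twoDeg_le hij (by lia))).trans_lt lt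

end TwoLetters

/-! ### The polynomials `P_m` as degree ratios -/

section NicholsPolynomials

open Finset MvPolynomial

section TwoTerms

variable {α R : Type*} [Fintype α] [DecidableEq α] [CommRing R] {i j : α} (p : α → α → R) {b : ℕ}

theorem hasDegreeRatio_twoDeg_one (hij : i ≠ j) (hb : 0 < b) :
    HasDegreeRatio p (1 + b - 2) (twoDeg i j 1 b) (1 - p j j ^ (b - 1) * (p i j * p j i)) := by
  obtain ⟨m, rfl⟩ : ∃ m, b = m + 1 := ⟨b - 1, by lia⟩
  rw [show 1 + (m + 1) - 2 = m by lia, Nat.add_sub_cancel]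
  exact hasDegreeRatio_one hij p m

theorem hasDegreeRatio_twoDeg_two (hij : i ≠ j) (hb : 2 ≤ b) :
    HasDegreeRatio p (2 + b - 2) (twoDeg i j 2 b)
      (1 + p j j ^ (b * (b - 1) / 2) * (-(p i j * p j i)) ^ b * p i i) := by
  rw [Nat.add_sub_cancel_left]
  obtain ⟨k, rfl | rfl⟩ : ∃ k, b = 2 * k + 2 ∨ b = 2 * k + 3 := ⟨(b - 2) / 2, by lia⟩
  · exact hasDegreeRatio_two_even hij p k
  · exact hasDegreeRatio_two_odd hij p k

theorem HasFewPeriodicWords.of_not_twoDeg {l : α → ℕ} (h1 : ¬ ∃ i, l = Pi.single i (l i))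
    (h2 : ∀ i j, i ≠ j → 0 < l i → l i ≤ l j → l = twoDeg i j (l i) (l j) →
      3 ≤ l i ∧ (l i, l j) ∉ exceptionalPairs) :
    HasFewPeriodicWords l := by
  by_cases! hzero : ∀ a, l a = 0
  · simp [HasFewPeriodicWords, hzero, Nat.multinomial_pos]
  obtain ⟨i, hi⟩ := hzero
  obtain ⟨j, hji, hj⟩ : ∃ j, j ≠ i ∧ l j ≠ 0 := by
    by_contra! h
    refine h1 ⟨i, funext fun c => ?_⟩
    obtain rfl | hc := eq_or_ne c i
    · rw [Pi.single_eq_same]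
    · rw [Pi.single_eq_of_ne hc, h c hc]
  by_cases! hthree : ∃ k, k ≠ i ∧ k ≠ j ∧ l k ≠ 0
  · obtain ⟨k, hki, hkj, hk⟩ := hthree
    exact hasFewPeriodicWords_of_three hji.symm hki.symm hkj.symm
      (Nat.pos_of_ne_zero hi) (Nat.pos_of_ne_zero hj) (Nat.pos_of_ne_zero hk)
  have eq_twoDeg : l = twoDeg i j (l i) (l j) := by
    ext c
    obtain rfl | hci := eq_or_ne c i
    · rw [twoDeg_left hji.symm]
    obtain rfl | hcj := eq_or_ne c j
    · rw [twoDeg_right hji.symm]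
    · rw [twoDeg_of_ne hci hcj, hthree c hci hcj]
  obtain hle | hle := le_total (l i) (l j)
  · obtain ⟨three_le, notMem⟩ := h2 i j hji.symm (Nat.pos_of_ne_zero hi) hle eq_twoDeg
    exact eq_twoDeg ▸ hasFewPeriodicWords_twoDeg hji.symm three_le hle notMem
  · rw [twoDeg_comm] at eq_twoDeg
    obtain ⟨three_le, notMem⟩ := h2 j i hji (Nat.pos_of_ne_zero hj) hle eq_twoDeg
    exact eq_twoDeg ▸ hasFewPeriodicWords_twoDeg hji three_le hle notMem

end TwoTerms

variable {n d : ℕ} {l : Fin n → ℕ}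

theorem prod_pVar_eq_pMonomial (l : Fin n → ℕ) :
    (∏ i, (pVar i i) ^ (l i * (l i - 1))) *
      ∏ i, ∏ j ∈ Ioi i, (pVar i j * pVar j i) ^ (l i * l j) = pMonomial pVar (twistExp l) := by
  have split_pair (i : Fin n) : ∏ j ∈ Ioi i, (pVar i j * pVar j i) ^ (l i * l j) =
      ∏ j ∈ Ioi i, (pVar i j) ^ (l j * l i) * (pVar j i) ^ (l i * l j) :=
    prod_congr rfl fun j _ => by rw [mul_pow, mul_comm (l j)]
  rw [prod_congr rfl fun i _ => split_pair i,
    prod_prod_Ioi_mul_eq_prod_prod_off_diag (fun i j : Fin n => (pVar j i) ^ (l i * l j)),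
    ← prod_mul_distrib, pMonomial, Fintype.prod_prod_type]
  refine prod_congr rfl fun i _ => ?_
  rw [← mul_prod_erase _ _ (mem_univ i), ← compl_singleton]
  congr 1
  · simp [twistExp]
  · refine prod_congr rfl fun j hj => ?_
    have hij : i ≠ j := by simpa [eq_comm] using hj
    simp [twistExp, hij, mul_comm]

theorem HasFewPeriodicWords.hasDegreeRatio_pVar (hl : ∑ a, l a = d + 2)
    (h : HasFewPeriodicWords l) :
    HasDegreeRatio pVar d l (1 - (∏ i, (pVar i i) ^ (l i * (l i - 1))) *
      ∏ i, ∏ j ∈ Ioi i, (pVar i j * pVar j i) ^ (l i * l j)) := by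
  rw [prod_pVar_eq_pMonomial]
  simpa only [twistFactor, Nat.div_one] using h.hasDegreeRatio hl (pVar (n := n))

theorem IsTwoTerm.hasDegreeRatio {R : Type*} [CommRing R] {p : Fin n → Fin n → R} {a b : ℕ}
    {s : Fin n × Fin n} {P : R} (h : IsTwoTerm l a b s) (hl : ∑ a, l a = d + 2)
    (hP : s.1 ≠ s.2 → HasDegreeRatio p (a + b - 2) (twoDeg s.1 s.2 a b) P) :
    HasDegreeRatio p d l P := by
  obtain ⟨hne, rfl⟩ := h
  obtain rfl : d = a + b - 2 := by
    have sum_eq := sum_twoDeg (i := s.1) (j := s.2) a b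
    rw [twoDeg] at sum_eq
    lia
  exact hP hne

theorem hasDegreeRatio_nicholsP (hl : ∑ a, l a = d + 2) (h1 : ¬ ∃ i, l = Pi.single i (l i)) :
    HasDegreeRatio pVar d l (nicholsP l) := by
  unfold nicholsP
  rw [dif_neg h1]
  split_ifs with h2 h3 h4 h5 h6 h7
  · exact h2.choose_spec.2.hasDegreeRatio hl
      fun hij => hasDegreeRatio_twoDeg_one pVar hij h2.choose_spec.1
  · obtain ⟨pos, hs⟩ := h3.choose_spec
    refine hs.hasDegreeRatio hl fun hij => hasDegreeRatio_twoDeg_two pVar hij ?_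
    by_contra! lt_two
    have left_eq : l h3.choose.1 = 2 := (congrFun hs.2 _).trans (twoDeg_left hij 2 _)
    have right_eq : l h3.choose.2 = 1 := by lia
    refine h2 ⟨h3.choose.swap, by simp [left_eq], hij.symm, ?_⟩
    rw [Prod.fst_swap, Prod.snd_swap, left_eq, add_comm, ← right_eq]
    exact hs.2
  · exact h4.choose_spec.hasDegreeRatio hl fun hij => hasDegreeRatio_three_three hij pVar
  · exact h5.choose_spec.hasDegreeRatio hl fun hij => hasDegreeRatio_three_four hij pVar
  · exact h6.choose_spec.hasDegreeRatio hl fun hij => hasDegreeRatio_three_six hij pVar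
  · exact h7.choose_spec.hasDegreeRatio hl fun hij => hasDegreeRatio_four_four hij pVar
  · refine (HasFewPeriodicWords.of_not_twoDeg h1 fun i j hij hi hle heq =>
      ⟨?_, fun hmem => ?_⟩).hasDegreeRatio_pVar hl
    · by_contra! lt_three
      obtain hi | hi : l i = 1 ∨ l i = 2 := by lia
      · exact h2 ⟨(i, j), by lia, hij, by rwa [hi] at heq⟩
      · exact h3 ⟨(i, j), by lia, hij, by rwa [hi] at heq⟩
    · simp only [exceptionalPairs, mem_insert, mem_singleton, Prod.mk.injEq] at hmem
      obtain ⟨hi, hj⟩ | ⟨hi, hj⟩ | ⟨hi, hj⟩ | ⟨hi, hj⟩ := hmem <;> rw [hi, hj] at heq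
      · exact h4 ⟨(i, j), hij, heq⟩
      · exact h5 ⟨(i, j), hij, heq⟩
      · exact h6 ⟨(i, j), hij, heq⟩
      · exact h7 ⟨(i, j), hij, heq⟩

end NicholsPolynomials

/-! ### Determinants of the shuffle matrices -/

section Determinants

open Finset MvPolynomial

section CommRing

variable {α R : Type*} [Fintype α] [DecidableEq α] [CommRing R] (p : α → α → R)

theorem wordDeg_mem_piAntidiag {d : ℕ} (w : Fin d → α) : wordDeg w ∈ piAntidiag univ d := by
  simp [sum_wordDeg]

theorem det_one_sub_rotationMatrix_pow_eq_prod (d : ℕ) :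
    (1 - rotationMatrix p d).det ^ (d + 1) =
      ∏ l ∈ piAntidiag univ (d + 1), rootProd (twistFactor p l) (d + 1) l := by
  rw [det_one_sub_rotationMatrix_pow,
    ← prod_fiberwise_of_maps_to fun w _ => wordDeg_mem_piAntidiag w]
  refine prod_congr rfl fun l _ => prod_congr rfl fun w hw => ?_
  rw [(mem_filter.1 hw).2, twistFactor]

theorem prod_wordDeg_add_single_eq (g : ℕ → R) {d : ℕ} (l : α → ℕ) (j : α) :
    ∏ w : Fin d → α with wordDeg w + Pi.single j 1 = l, g (rootOrder w) ^ rootOrder w =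
      if 0 < l j then rootProd g d (l - Pi.single j 1) else 1 := by
  split_ifs with hj
  · rw [rootProd]
    refine prod_congr (filter_congr fun w _ => ⟨?_, ?_⟩) fun _ _ => rfl
    · rintro rfl
      exact (add_tsub_cancel_right _ _).symm
    · rintro h
      rw [h, sub_single_add_single hj]
  · refine prod_eq_one fun w hw => ?_
    rw [← (mem_filter.1 hw).2] at hj
    simp at hj

theorem det_one_sub_twistedRotationMatrix_pow_eq_prod (d : ℕ) (j : α) :
    (1 - twistedRotationMatrix p d j).det ^ (d + 1) = ∏ l ∈ piAntidiag univ (d + 2),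
      if 0 < l j then rootProd (twistFactor p l) (d + 1) (l - Pi.single j 1) else 1 := by
  have maps_to (w : Fin (d + 1) → α) : wordDeg w + Pi.single j 1 ∈ piAntidiag univ (d + 2) := by
    simp [sum_add_distrib, sum_wordDeg]
  rw [det_one_sub_twistedRotationMatrix_pow, ← prod_fiberwise_of_maps_to fun w _ => maps_to w]
  refine prod_congr rfl fun l _ => ?_
  rw [← prod_wordDeg_add_single_eq]
  refine prod_congr rfl fun w hw => ?_
  rw [(mem_filter.1 hw).2, twistFactor]

theorem prod_det_one_sub_twistedRotationMatrix_pow_eq_prod (d : ℕ) :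
    (∏ j, (1 - twistedRotationMatrix p d j).det) ^ (d + 1) =
      ∏ l ∈ piAntidiag univ (d + 2), deletionProd (twistFactor p l) (d + 1) l := by
  rw [← prod_pow, prod_congr rfl fun j _ => det_one_sub_twistedRotationMatrix_pow_eq_prod p d j,
    prod_comm]
  exact prod_congr rfl fun l _ => by rw [deletionProd, prod_filter]

theorem det_shuffleMatrix_pow_mul_prod_eq [IsDomain R] {d : ℕ} {A B : (α → ℕ) → R}
    (hne : ∀ l ∈ piAntidiag univ (d + 2), rootProd (twistFactor p l) (d + 2) l ≠ 0)
    (hAB : ∀ l ∈ piAntidiag univ (d + 2),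
      deletionProd (twistFactor p l) (d + 1) l ^ (d + 2) * B l =
        A l * rootProd (twistFactor p l) (d + 2) l ^ (d + 1)) :
    (shuffleMatrix p (d + 2)).det ^ ((d + 1) * (d + 2)) * ∏ l ∈ piAntidiag univ (d + 2), B l =
      (shuffleMatrix p (d + 1)).det ^ (Fintype.card α * ((d + 1) * (d + 2))) *
        ∏ l ∈ piAntidiag univ (d + 2), A l := by
  have rotation_eq : (1 - rotationMatrix p (d + 1)).det ^ ((d + 1) * (d + 2)) =
      ∏ l ∈ piAntidiag univ (d + 2), rootProd (twistFactor p l) (d + 2) l ^ (d + 1) := by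
    rw [mul_comm, pow_mul, det_one_sub_rotationMatrix_pow_eq_prod, prod_pow]
  have twisted_eq : (∏ j, (1 - twistedRotationMatrix p d j).det) ^ ((d + 1) * (d + 2)) =
      ∏ l ∈ piAntidiag univ (d + 2), deletionProd (twistFactor p l) (d + 1) l ^ (d + 2) := by
    rw [pow_mul, prod_det_one_sub_twistedRotationMatrix_pow_eq_prod, prod_pow]
  have recursion := congrArg (· ^ ((d + 1) * (d + 2))) (det_shuffleMatrix_succ p d)
  simp only [mul_pow, rotation_eq, twisted_eq, ← pow_mul] at recursion
  have ratio_eq := prod_congr rfl hAB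
  rw [prod_mul_distrib, prod_mul_distrib] at ratio_eq
  refine mul_left_cancel₀ (prod_ne_zero_iff.2 fun l hl => pow_ne_zero (d + 1) (hne l hl)) ?_
  rw [← mul_assoc, recursion, mul_assoc, ratio_eq]
  ring

theorem twistFactor_single (i : α) (m r : ℕ) :
    twistFactor p (Pi.single i m) r = 1 - p i i ^ (m * (m - 1) / r) := by
  rw [twistFactor, pMonomial, prod_eq_single (i, i)]
  · simp [twistExp]
  · rintro ⟨a, b⟩ - hab
    obtain rfl | ha := eq_or_ne a i
    · have hb : b ≠ a := fun hb => hab (by rw [hb])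
      simp [twistExp, hb]
    · simp [twistExp, ha]
  · simp

theorem deletionProd_single (g : ℕ → R) (d : ℕ) (i : α) (m : ℕ) :
    deletionProd g d (Pi.single i (m + 1)) = rootProd g d (Pi.single i m) := by
  have support_eq : ({j | 0 < (Pi.single i (m + 1) : α → ℕ) j} : Finset α) = {i} := by
    ext j
    obtain rfl | hj := eq_or_ne j i
    · simp
    · simp [hj]
  rw [deletionProd, support_eq, prod_singleton, Pi.single_add, add_tsub_cancel_right]

theorem deletionProd_single_pow_mul_qNumber_pow (d : ℕ) (i : α) :
    deletionProd (twistFactor p (Pi.single i (d + 2))) (d + 1) (Pi.single i (d + 2)) ^ (d + 2) *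
        qNumber (d + 1) (p i i) ^ ((d + 1) * (d + 2)) =
      qNumber (d + 2) (p i i) ^ ((d + 1) * (d + 2)) *
        rootProd (twistFactor p (Pi.single i (d + 2))) (d + 2) (Pi.single i (d + 2)) ^ (d + 1) := by
  have twistFactor_eq : twistFactor p (Pi.single i (d + 2)) (d + 2) =
      (1 - p i i) * qNumber (d + 1) (p i i) := by
    rw [twistFactor_single, Nat.mul_div_cancel_left _ (by lia), qNumber, mul_neg_geom_sum,
      show d + 2 - 1 = d + 1 by lia]
  have twistFactor_eq' : twistFactor p (Pi.single i (d + 2)) (d + 1) =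
      (1 - p i i) * qNumber (d + 2) (p i i) := by
    rw [twistFactor_single, show d + 2 - 1 = d + 1 by lia, Nat.mul_div_cancel _ (by lia), qNumber,
      mul_neg_geom_sum]
  rw [deletionProd_single, rootProd_single, rootProd_single, twistFactor_eq, twistFactor_eq']
  simp only [mul_pow, ← pow_mul]
  ring

theorem exists_twistExp_pos {l : α → ℕ} (hl : 2 ≤ ∑ a, l a) : ∃ x, 0 < twistExp l x := by
  by_cases! h : ∃ a, 2 ≤ l a
  · obtain ⟨a, ha⟩ := h
    exact ⟨(a, a), by simpa [twistExp] using ⟨by lia, by lia⟩⟩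
  have two_le_card : 1 < #{a | 0 < l a} := by
    rw [card_filter]
    refine hl.trans (sum_le_sum fun a _ => ?_)
    have := h a
    split_ifs <;> lia
  obtain ⟨a, b, ha, hb, hab⟩ := one_lt_card_iff.1 two_le_card
  rw [mem_filter_univ] at ha hb
  exact ⟨(a, b), by simpa [twistExp, hab] using ⟨ha, hb⟩⟩

end CommRing

variable {n d : ℕ} {l : Fin n → ℕ}

theorem twistFactor_pVar_ne_zero {r : ℕ} (hl : 2 ≤ ∑ a, l a) (hr : 0 < r) (h : IsNearMultiple r l) :
    twistFactor pVar l r ≠ 0 := by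
  obtain ⟨x, hx⟩ := exists_twistExp_pos hl
  have exponent_ne_zero : twistExp l x / r ≠ 0 :=
    (Nat.div_pos (Nat.le_of_dvd hx (h.dvd_twistExp x)) hr).ne'
  intro heq
  have coeff_eq := congrArg (constantCoeff (σ := Fin n × Fin n) (R := ℤ)) heq
  rw [twistFactor, map_sub, map_one, map_zero, pMonomial, map_prod,
    prod_eq_zero (mem_univ x) (by simp [exponent_ne_zero])] at coeff_eq
  simp at coeff_eq

theorem rootProd_pVar_ne_zero (hl : ∑ a, l a = d + 2) :
    rootProd (twistFactor pVar l) (d + 2) l ≠ 0 := by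
  rw [rootProd, prod_ne_zero_iff]
  intro w hw
  rw [mem_filter_univ] at hw
  exact pow_ne_zero _ (twistFactor_pVar_ne_zero (by lia) (rootOrder_pos w)
    (hw ▸ isNearMultiple_rootOrder w))

theorem nicholsP_single (i : Fin n) {m : ℕ} (hm : m ≠ 0) :
    nicholsP (Pi.single i m) = qNumber m (pVar i i) := by
  have h : ∃ k : Fin n, (Pi.single i m : Fin n → ℕ) = Pi.single k ((Pi.single i m : Fin n → ℕ) k) :=
    ⟨i, by simp⟩
  have choose_eq : h.choose = i := by
    by_contra hne
    have := congrFun h.choose_spec i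
    rw [Pi.single_eq_of_ne' hne, Pi.single_eq_same] at this
    exact hm this
  unfold nicholsP
  rw [dif_pos h, choose_eq, Pi.single_eq_same]

variable {K : Type*} [Field K] (φ : MvPolynomial (Fin n × Fin n) ℤ →+* K)

theorem exists_degreeRatio (hl : ∑ a, l a = d + 2) :
    ∃ A B, deletionProd (twistFactor pVar l) (d + 1) l ^ (d + 2) * B =
        A * rootProd (twistFactor pVar l) (d + 2) l ^ (d + 1) ∧
      (φ A = 0 ↔ φ (nicholsP l) = 0) ∧ (φ B = 0 → ∃ i, φ (qNumber (d + 1) (pVar i i)) = 0) := by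
  by_cases h : ∃ i, l = Pi.single i (l i)
  · obtain ⟨i, hi⟩ := h
    obtain rfl : l = Pi.single i (d + 2) := by
      rw [hi, sum_pi_single' i, if_pos (mem_univ i)] at hl
      rwa [hl] at hi
    refine ⟨_, _, deletionProd_single_pow_mul_qNumber_pow pVar d i, ?_, fun hB => ⟨i, ?_⟩⟩
    · rw [nicholsP_single i (by lia), map_pow]
      exact pow_eq_zero_iff (by positivity)
    · rw [map_pow] at hB
      exact eq_zero_of_pow_eq_zero hB
  · obtain ⟨D, hD, rad⟩ := hasDegreeRatio_nicholsP hl h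
    exact ⟨D, 1, by rw [mul_one, hD], rad.map_eq_zero_iff φ, by simp⟩

theorem exists_det_shuffleMatrix_ratio (d : ℕ) :
    ∃ A B : (Fin n → ℕ) → K,
      (shuffleMatrix (fun i j => φ (pVar i j)) (d + 2)).det ^ ((d + 1) * (d + 2)) *
        ∏ l ∈ piAntidiag univ (d + 2), B l =
      (shuffleMatrix (fun i j => φ (pVar i j)) (d + 1)).det ^ (n * ((d + 1) * (d + 2))) *
        ∏ l ∈ piAntidiag univ (d + 2), A l ∧
      ∀ l, ∑ a, l a = d + 2 → (A l = 0 ↔ φ (nicholsP l) = 0) ∧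
        (B l = 0 → ∃ i, φ (qNumber (d + 1) (pVar i i)) = 0) := by
  choose! A B hratio hzero using fun (l : Fin n → ℕ) (hl : ∑ a, l a = d + 2) =>
    exists_degreeRatio φ hl
  refine ⟨fun l => φ (A l), fun l => φ (B l), ?_, hzero⟩
  have sum_eq {l : Fin n → ℕ} (hl : l ∈ piAntidiag univ (d + 2)) : ∑ a, l a = d + 2 :=
    (mem_piAntidiag.1 hl).1
  have ratio := congrArg φ <| det_shuffleMatrix_pow_mul_prod_eq pVar
    (fun l hl => rootProd_pVar_ne_zero (sum_eq hl)) fun l hl => hratio l (sum_eq hl)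
  simpa only [map_mul, map_pow, map_prod, RingHom.map_det, RingHom.mapMatrix_apply,
    map_shuffleMatrix, Fintype.card_fin] using ratio

theorem det_shuffleMatrix_ne_zero_of_nicholsP_ne_zero
    (hP : ∀ l : Fin n → ℕ, 2 ≤ ∑ a, l a → φ (nicholsP l) ≠ 0) (d : ℕ) :
    (shuffleMatrix (fun i j => φ (pVar i j)) (d + 1)).det ≠ 0 := by
  induction d with
  | zero => simp [shuffleMatrix_one]
  | succ d ih =>
    obtain ⟨A, B, ratio, hzero⟩ := exists_det_shuffleMatrix_ratio φ d
    have A_ne_zero : ∏ l ∈ piAntidiag univ (d + 2), A l ≠ 0 := prod_ne_zero_iff.2 fun l hl => by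
      have sum_eq := (mem_piAntidiag.1 hl).1
      exact (hzero l sum_eq).1.not.2 (hP l (by lia))
    have := left_ne_zero_of_mul (ratio ▸ mul_ne_zero (pow_ne_zero _ ih) A_ne_zero)
    exact ne_zero_pow (by positivity) this

theorem nicholsP_ne_zero_of_qNumber_ne_zero
    (hdet : (shuffleMatrix (fun i j => φ (pVar i j)) (d + 2)).det ≠ 0)
    (hq : ∀ i, φ (qNumber (d + 1) (pVar i i)) ≠ 0) (hl : ∑ a, l a = d + 2) :
    φ (nicholsP l) ≠ 0 := by
  obtain ⟨A, B, ratio, hzero⟩ := exists_det_shuffleMatrix_ratio φ d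
  have B_ne_zero : ∏ l ∈ piAntidiag univ (d + 2), B l ≠ 0 :=
    prod_ne_zero_iff.2 fun m hm hB =>
      let ⟨i, hi⟩ := (hzero m (mem_piAntidiag.1 hm).1).2 hB
      hq i hi
  have A_ne_zero := right_ne_zero_of_mul (ratio ▸ mul_ne_zero (pow_ne_zero _ hdet) B_ne_zero)
  exact (hzero l hl).1.not.1 (prod_ne_zero_iff.1 A_ne_zero l (by simpa using hl))

theorem forall_det_shuffleMatrix_ne_zero_iff :
    (∀ d, (shuffleMatrix (fun i j => φ (pVar i j)) (d + 1)).det ≠ 0) ↔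
      ∀ l : Fin n → ℕ, 2 ≤ ∑ a, l a → φ (nicholsP l) ≠ 0 := by
  refine ⟨fun hdet l hl => ?_, det_shuffleMatrix_ne_zero_of_nicholsP_ne_zero φ⟩
  have qNumber_ne_zero (d : ℕ) : ∀ i, φ (qNumber (d + 1) (pVar i i)) ≠ 0 := by
    induction d with
    | zero => simp [qNumber]
    | succ d ih =>
      intro i
      rw [← nicholsP_single i (by lia)]
      exact nicholsP_ne_zero_of_qNumber_ne_zero φ (hdet (d + 1)) ih (by simp)
  obtain ⟨d, hd⟩ := Nat.exists_eq_add_of_le' hl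
  exact nicholsP_ne_zero_of_qNumber_ne_zero φ (hdet (d + 1)) (qNumber_ne_zero d) hd

end Determinants

/-! ### Skew derivations of the tensor algebra -/

section TensorAlgebra

variable {ι R M : Type*} [CommRing R] [AddCommGroup M] [Module R M] (x : Module.Basis ι R M)

theorem tensorAlgebra_basis_mul_induction {P : TensorAlgebra R M → Prop} (one : P 1)
    (mul : ∀ i s, P s → P (TensorAlgebra.ι R (x i) * s))
    (add : ∀ s t, P s → P t → P (s + t)) (smul : ∀ (a : R) s, P s → P (a • s))
    (t : TensorAlgebra R M) : P t := by
  have mul_left (t s) (hs : P s) : P (t * s) := by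
    induction t using TensorAlgebra.induction generalizing s with
    | algebraMap r =>
      rw [← Algebra.smul_def]
      exact smul r s hs
    | ι v =>
      induction x.mem_span v using Submodule.span_induction with
      | mem v hv =>
        obtain ⟨i, rfl⟩ := hv
        exact mul i s hs
      | zero => simpa using smul 0 s hs
      | add v w _ _ hv hw => rw [map_add, add_mul]; exact add _ _ hv hw
      | smul a v _ hv => rw [map_smul, smul_mul_assoc]; exact smul a _ hv
    | mul a b ha hb => rw [mul_assoc]; exact ha _ (hb _ hs)
    | add a b ha hb => rw [add_mul]; exact add _ _ (ha s hs) (hb s hs)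
  simpa using mul_left t 1 one

theorem tensorAlgebra_linearMap_ext {N : Type*} [AddCommGroup N] [Module R N]
    {F G : TensorAlgebra R M →ₗ[R] N} (one : F 1 = G 1)
    (mul : ∀ i s, F s = G s → F (TensorAlgebra.ι R (x i) * s) = G (TensorAlgebra.ι R (x i) * s)) :
    F = G := by
  ext t
  refine tensorAlgebra_basis_mul_induction x one mul (fun s t hs ht => ?_) (fun a s hs => ?_) t
  · rw [map_add, map_add, hs, ht]
  · rw [map_smul, map_smul, hs]

@[simp]
theorem algebraMapInv_ι (v : M) :
    TensorAlgebra.algebraMapInv (TensorAlgebra.ι R v) = (0 : R) := by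
  simp [TensorAlgebra.algebraMapInv]

/-- The endomorphism `x j ↦ a j • x j` of the tensor algebra. -/
noncomputable def diagonalHom (a : ι → R) : TensorAlgebra R M →ₐ[R] TensorAlgebra R M :=
  TensorAlgebra.lift R (x.constr R fun j => a j • TensorAlgebra.ι R (x j))

@[simp]
theorem diagonalHom_ι (a : ι → R) (j : ι) :
    diagonalHom x a (TensorAlgebra.ι R (x j)) = a j • TensorAlgebra.ι R (x j) := by
  simp [diagonalHom]

theorem diagonalHom_comm (a b : ι → R) (t : TensorAlgebra R M) :
    diagonalHom x a (diagonalHom x b t) = diagonalHom x b (diagonalHom x a t) := by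
  have comp_comm : (diagonalHom x a).comp (diagonalHom x b) =
      (diagonalHom x b).comp (diagonalHom x a) :=
    TensorAlgebra.hom_ext (x.ext fun k => by simp [smul_smul, mul_comm])
  exact DFunLike.congr_fun comp_comm t

theorem algebraMapInv_diagonalHom (a : ι → R) (t : TensorAlgebra R M) :
    TensorAlgebra.algebraMapInv (diagonalHom x a t) = TensorAlgebra.algebraMapInv t := by
  have comp_eq : (TensorAlgebra.algebraMapInv).comp (diagonalHom x a) =
      TensorAlgebra.algebraMapInv := TensorAlgebra.hom_ext (x.ext fun k => by simp)
  exact DFunLike.congr_fun comp_eq t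

/-- The coefficient of `x j` in the degree one component, as a linear form on the tensor
algebra. -/
noncomputable def linearCoeff (j : ι) : TensorAlgebra R M →ₗ[R] R :=
  x.coord j ∘ₗ TensorAlgebra.ιInv

@[simp]
theorem linearCoeff_one (j : ι) : linearCoeff x j 1 = 0 := by
  let : Module Rᵐᵒᵖ M := Module.compHom _ ((RingHom.id R).fromOpposite mul_comm)
  have : IsCentralScalar R M := ⟨fun r m => rfl⟩
  simp [linearCoeff, TensorAlgebra.ιInv]

@[simp]
theorem linearCoeff_ι_mul [DecidableEq ι] (i j : ι) (t : TensorAlgebra R M) :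
    linearCoeff x j (TensorAlgebra.ι R (x i) * t) =
      if i = j then TensorAlgebra.algebraMapInv t else 0 := by
  let : Module Rᵐᵒᵖ M := Module.compHom _ ((RingHom.id R).fromOpposite mul_comm)
  have : IsCentralScalar R M := ⟨fun r m => rfl⟩
  have fst_comp : (TrivSqZeroExt.fstHom R R M).comp TensorAlgebra.toTrivSqZeroExt =
      TensorAlgebra.algebraMapInv := by
    ext v
    simp
  have fst_eq : TrivSqZeroExt.fst (TensorAlgebra.toTrivSqZeroExt t) =
      TensorAlgebra.algebraMapInv t := DFunLike.congr_fun fst_comp t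
  simp [linearCoeff, TensorAlgebra.ιInv, fst_eq, Finsupp.single_apply]

end TensorAlgebra

section SkewDerivations

variable {ι K V : Type*} [Field K] [AddCommGroup V] [Module K V]
  {c : V ⊗[K] V →ₗ[K] V ⊗[K] V} {x : Module.Basis ι K V} {q : ι → ι → K}

theorem braidingExt_one (v : V) : braidingExt c v 1 = 1 ⊗ₜ v := by
  simp [braidingExt]

theorem braidingExt_ι_mul (v w : V) (t : TensorAlgebra K V) :
    braidingExt c v (TensorAlgebra.ι K w * t) = tensorLeftMul K V
      (TensorProduct.map (TensorAlgebra.ι K) ((braidingExt c).flip t) (c (v ⊗ₜ w))) := by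
  simp [braidingExt, braidingStep]

theorem tensorLeftMul_tmul (s t : TensorAlgebra K V) (v : V) :
    tensorLeftMul K V (s ⊗ₜ (t ⊗ₜ v)) = (s * t) ⊗ₜ v := by
  simp [tensorLeftMul]

theorem braidedComul_one : braidedComul c 1 = 1 ⊗ₜ 1 := by
  simp [braidedComul]

theorem braidedComul_ι_mul (v : V) (t : TensorAlgebra K V) :
    braidedComul c (TensorAlgebra.ι K v * t) = primitiveMul c v (braidedComul c t) := by
  simp [braidedComul, primitiveMulₗ]

variable (c x) in
/-- The skew derivation `∂ j` of the tensor algebra: the component of the coproduct whose right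
tensor factor is `x j`. -/
noncomputable def skewDer (j : ι) : TensorAlgebra K V →ₗ[K] TensorAlgebra K V :=
  TensorProduct.rid K (TensorAlgebra K V) ∘ₗ (linearCoeff x j).lTensor (TensorAlgebra K V) ∘ₗ
    braidedComul c

@[simp]
theorem skewDer_one (j : ι) : skewDer c x j 1 = 0 := by
  simp [skewDer, braidedComul_one]

variable (c x q) in
/-- The braiding `c` is given by `x i ⊗ x j ↦ q i j • x j ⊗ x i`, where the scalars `q i j` need not
be invertible. -/
def HasBraidingMatrix : Prop :=
  ∀ i j, c (x i ⊗ₜ[K] x j) = q i j • (x j ⊗ₜ[K] x i)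

namespace HasBraidingMatrix

theorem braidingExt_apply (hc : HasBraidingMatrix c x q) (i : ι) (t : TensorAlgebra K V) :
    braidingExt c (x i) t = diagonalHom x (q i) t ⊗ₜ x i := by
  have braidingExt_eq : braidingExt c (x i) = (TensorProduct.mk K _ V).flip (x i) ∘ₗ
      (diagonalHom x (q i)).toLinearMap := by
    refine tensorAlgebra_linearMap_ext x (by simp [braidingExt_one]) fun j s hs => ?_
    rw [braidingExt_ι_mul, hc i j, map_smul, TensorProduct.map_tmul, LinearMap.flip_apply, hs]
    simp [tensorLeftMul_tmul, TensorProduct.smul_tmul']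
  rw [braidingExt_eq]
  rfl

theorem primitiveMul_tmul (hc : HasBraidingMatrix c x q) (i : ι) (a b : TensorAlgebra K V) :
    primitiveMul c (x i) (a ⊗ₜ b) = (TensorAlgebra.ι K (x i) * a) ⊗ₜ b +
      diagonalHom x (q i) a ⊗ₜ (TensorAlgebra.ι K (x i) * b) := by
  simp [primitiveMul, hc.braidingExt_apply]

theorem braidedComul_diagonalHom (hc : HasBraidingMatrix c x q) (a : ι → K)
    (t : TensorAlgebra K V) : braidedComul c (diagonalHom x a t) =
      TensorProduct.map (diagonalHom x a).toLinearMap (diagonalHom x a).toLinearMap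
        (braidedComul c t) := by
  have comp_eq : braidedComul c ∘ₗ (diagonalHom x a).toLinearMap =
      TensorProduct.map (diagonalHom x a).toLinearMap (diagonalHom x a).toLinearMap ∘ₗ
        braidedComul c := by
    refine tensorAlgebra_linearMap_ext x (by simp [braidedComul_one]) fun i s hs => ?_
    simp only [LinearMap.comp_apply, AlgHom.toLinearMap_apply] at hs ⊢
    rw [map_mul, diagonalHom_ι, smul_mul_assoc, map_smul, braidedComul_ι_mul, braidedComul_ι_mul,
      hs]
    induction braidedComul c s using TensorProduct.induction_on with
    | zero => simp
    | tmul s t =>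
      simp [hc.primitiveMul_tmul, diagonalHom_comm x a, TensorProduct.smul_tmul',
        TensorProduct.tmul_smul]
    | add s t hs ht => simp only [map_add, smul_add, hs, ht]
  exact DFunLike.congr_fun comp_eq t

theorem rid_lTensor_algebraMapInv_braidedComul (hc : HasBraidingMatrix c x q)
    (t : TensorAlgebra K V) : TensorProduct.rid K (TensorAlgebra K V)
      ((TensorAlgebra.algebraMapInv (R := K) (M := V)).toLinearMap.lTensor (TensorAlgebra K V)
        (braidedComul c t)) = t := by
  have comp_eq : (TensorProduct.rid K (TensorAlgebra K V)).toLinearMap ∘ₗ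
      (TensorAlgebra.algebraMapInv (R := K) (M := V)).toLinearMap.lTensor (TensorAlgebra K V) ∘ₗ
        braidedComul c = LinearMap.id := by
    refine tensorAlgebra_linearMap_ext x (by simp [braidedComul_one]) fun i s hs => ?_
    rw [LinearMap.id_apply] at hs ⊢
    conv_rhs => rw [← hs]
    simp only [LinearMap.comp_apply, braidedComul_ι_mul]
    induction braidedComul c s using TensorProduct.induction_on with
    | zero => simp
    | tmul a b => simp [hc.primitiveMul_tmul]
    | add a b ha hb => simp only [map_add, mul_add, ha, hb]
  exact DFunLike.congr_fun comp_eq t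

theorem skewDer_ι_mul [DecidableEq ι] (hc : HasBraidingMatrix c x q) (i j : ι)
    (t : TensorAlgebra K V) :
    skewDer c x j (TensorAlgebra.ι K (x i) * t) =
      TensorAlgebra.ι K (x i) * skewDer c x j t +
        if i = j then diagonalHom x (q i) t else 0 := by
  simp only [skewDer, LinearMap.comp_apply, braidedComul_ι_mul]
  conv_rhs => enter [2]; rw [← hc.rid_lTensor_algebraMapInv_braidedComul t]
  induction braidedComul c t using TensorProduct.induction_on with
  | zero => simp
  | tmul a b => simp [hc.primitiveMul_tmul]
  | add a b ha hb =>
    simp only [map_add, mul_add, ha, hb]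
    split_ifs <;> abel

theorem skewDer_mul (hc : HasBraidingMatrix c x q) (j : ι) (s t : TensorAlgebra K V) :
    skewDer c x j (s * t) = s * skewDer c x j t + skewDer c x j s * diagonalHom x (q j) t := by
  classical
  induction s using tensorAlgebra_basis_mul_induction x with
  | one => simp
  | mul i s hs =>
    rw [mul_assoc, hc.skewDer_ι_mul, hc.skewDer_ι_mul, hs]
    split_ifs with h
    · subst h
      simp [mul_add, add_mul, mul_assoc, add_assoc]
    · simp [mul_add, mul_assoc]
  | add s s' hs hs' =>
    simp only [add_mul, map_add, hs, hs']
    abel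
  | smul a s hs => simp only [smul_mul_assoc, map_smul, hs, smul_add]

theorem skewDer_diagonalHom (hc : HasBraidingMatrix c x q) (a : ι → K) (j : ι)
    (t : TensorAlgebra K V) :
    skewDer c x j (diagonalHom x a t) = a j • diagonalHom x a (skewDer c x j t) := by
  classical
  have comp_eq : skewDer c x j ∘ₗ (diagonalHom x a).toLinearMap =
      a j • (diagonalHom x a).toLinearMap ∘ₗ skewDer c x j := by
    refine tensorAlgebra_linearMap_ext x (by simp) fun k s hs => ?_
    simp only [LinearMap.comp_apply, AlgHom.toLinearMap_apply, LinearMap.smul_apply] at hs ⊢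
    rw [map_mul, diagonalHom_ι, smul_mul_assoc, map_smul, hc.skewDer_ι_mul, hc.skewDer_ι_mul, hs]
    split_ifs with h
    · subst h
      simp only [map_add, map_mul, diagonalHom_ι, smul_add, diagonalHom_comm x a,
        mul_smul_comm, smul_mul_assoc]
    · simp only [add_zero, map_mul, diagonalHom_ι, mul_smul_comm, smul_mul_assoc]
      rw [smul_comm]
  exact DFunLike.congr_fun comp_eq t

theorem lTensor_skewDer_braidedComul (hc : HasBraidingMatrix c x q) (j : ι)
    (t : TensorAlgebra K V) : (skewDer c x j).lTensor (TensorAlgebra K V) (braidedComul c t) =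
      braidedComul c (skewDer c x j t) := by
  classical
  have comp_eq : (skewDer c x j).lTensor (TensorAlgebra K V) ∘ₗ braidedComul c =
      braidedComul c ∘ₗ skewDer c x j := by
    refine tensorAlgebra_linearMap_ext x (by simp [braidedComul_one]) fun i s hs => ?_
    simp only [LinearMap.comp_apply] at hs ⊢
    rw [hc.skewDer_ι_mul, braidedComul_ι_mul, map_add, braidedComul_ι_mul, ← hs,
      apply_ite (braidedComul c), map_zero, hc.braidedComul_diagonalHom]
    induction braidedComul c s using TensorProduct.induction_on with
    | zero => simp
    | tmul a b =>
      simp only [hc.primitiveMul_tmul, map_add, LinearMap.lTensor_tmul, hc.skewDer_ι_mul]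
      split_ifs with h <;> simp [TensorProduct.tmul_add, add_assoc]
    | add a b ha hb =>
      simp only [map_add, ha, hb]
      split_ifs <;> abel
  exact DFunLike.congr_fun comp_eq t

theorem algebraMapInv_skewDer (hc : HasBraidingMatrix c x q) (j : ι) (t : TensorAlgebra K V) :
    TensorAlgebra.algebraMapInv (skewDer c x j t) = linearCoeff x j t := by
  classical
  have comp_eq : (TensorAlgebra.algebraMapInv (R := K) (M := V)).toLinearMap ∘ₗ skewDer c x j =
      linearCoeff x j := by
    refine tensorAlgebra_linearMap_ext x (by simp) fun i s _ => ?_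
    simp only [LinearMap.comp_apply, AlgHom.toLinearMap_apply, hc.skewDer_ι_mul, map_add, map_mul,
      algebraMapInv_ι, zero_mul, zero_add, linearCoeff_ι_mul]
    split_ifs <;> simp [algebraMapInv_diagonalHom]
  exact DFunLike.congr_fun comp_eq t

end HasBraidingMatrix

end SkewDerivations

/-! ### Homogeneous components and words -/

section Components

variable {ι R M : Type*} [CommRing R] [AddCommGroup M] [Module R M]

/-- The projection of the tensor algebra to its homogeneous component of degree `d`: the linear map
underlying `tensorComponent d`. -/
noncomputable def componentMap (R M : Type*) [CommRing R] [AddCommGroup M] [Module R M] (d : ℕ) :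
    TensorAlgebra R M →ₗ[R] TensorAlgebra R M :=
  GradedAlgebra.proj (fun k : ℕ => LinearMap.range (TensorAlgebra.ι R : M →ₗ[R] _) ^ k) d

theorem componentMap_zero_one : componentMap R M 0 1 = 1 := by
  rw [componentMap, GradedAlgebra.proj_apply]
  exact DirectSum.decompose_of_mem_same _ SetLike.GradedOne.one_mem

theorem componentMap_succ_one (d : ℕ) : componentMap R M (d + 1) 1 = 0 := by
  rw [componentMap, GradedAlgebra.proj_apply]
  exact DirectSum.decompose_of_mem_ne _ SetLike.GradedOne.one_mem (Nat.succ_ne_zero d).symm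

theorem ι_mem_range_ι_pow_one (v : M) :
    TensorAlgebra.ι R v ∈ LinearMap.range (TensorAlgebra.ι R : M →ₗ[R] _) ^ 1 := by
  simp

theorem componentMap_zero_ι_mul (v : M) (t : TensorAlgebra R M) :
    componentMap R M 0 (TensorAlgebra.ι R v * t) = 0 := by
  rw [componentMap, GradedAlgebra.proj_apply]
  exact DirectSum.coe_decompose_mul_of_left_mem_of_not_le
    (fun k : ℕ => LinearMap.range (TensorAlgebra.ι R : M →ₗ[R] _) ^ k)
    (ι_mem_range_ι_pow_one v) (by simp)

theorem componentMap_succ_ι_mul (d : ℕ) (v : M) (t : TensorAlgebra R M) :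
    componentMap R M (d + 1) (TensorAlgebra.ι R v * t) =
      TensorAlgebra.ι R v * componentMap R M d t := by
  rw [add_comm, componentMap, componentMap, GradedAlgebra.proj_apply, GradedAlgebra.proj_apply]
  exact DirectSum.coe_decompose_mul_add_of_left_mem
    (fun k : ℕ => LinearMap.range (TensorAlgebra.ι R : M →ₗ[R] _) ^ k) (ι_mem_range_ι_pow_one v)

theorem eq_zero_of_componentMap_eq_zero {t : TensorAlgebra R M}
    (h : ∀ d, componentMap R M d t = 0) : t = 0 := by
  apply (DirectSum.decompose
    fun k : ℕ => LinearMap.range (TensorAlgebra.ι R : M →ₗ[R] _) ^ k).injective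
  rw [DirectSum.decompose_zero]
  ext d
  exact h d

variable (x : Module.Basis ι R M)

theorem componentMap_diagonalHom (a : ι → R) (d : ℕ) (t : TensorAlgebra R M) :
    componentMap R M d (diagonalHom x a t) = diagonalHom x a (componentMap R M d t) := by
  induction t using tensorAlgebra_basis_mul_induction x generalizing d with
  | one => cases d <;> simp [componentMap_zero_one, componentMap_succ_one]
  | mul j s hs => cases d <;> simp [componentMap_zero_ι_mul, componentMap_succ_ι_mul, hs]
  | add s t hs ht => simp [hs, ht]
  | smul a s hs => simp [hs]

include x in
theorem componentMap_zero_apply (t : TensorAlgebra R M) :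
    componentMap R M 0 t = algebraMap R _ (TensorAlgebra.algebraMapInv t) := by
  have eq_comp : componentMap R M 0 =
      Algebra.linearMap R _ ∘ₗ TensorAlgebra.algebraMapInv.toLinearMap :=
    tensorAlgebra_linearMap_ext x (by simp [componentMap_zero_one])
      fun i s _ => by simp [componentMap_zero_ι_mul]
  exact DFunLike.congr_fun eq_comp t

include x in
theorem algebraMapInv_componentMap_succ (d : ℕ) (t : TensorAlgebra R M) :
    TensorAlgebra.algebraMapInv (componentMap R M (d + 1) t) = 0 := by
  induction t using tensorAlgebra_basis_mul_induction x with
  | one => rw [componentMap_succ_one, map_zero]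
  | mul i s _ => simp [componentMap_succ_ι_mul]
  | add s t hs ht => rw [map_add, map_add, hs, ht, add_zero]
  | smul a s hs => rw [map_smul, map_smul, hs, smul_zero]

theorem componentMap_one_apply [Fintype ι] (t : TensorAlgebra R M) :
    componentMap R M 1 t = ∑ j, linearCoeff x j t • TensorAlgebra.ι R (x j) := by
  classical
  induction t using tensorAlgebra_basis_mul_induction x with
  | one => simpa using componentMap_succ_one 0
  | mul i s _ =>
    rw [componentMap_succ_ι_mul 0, componentMap_zero_apply x, ← Algebra.commutes,
      ← Algebra.smul_def]
    simp [ite_smul]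
  | add s t hs ht => simp only [map_add, hs, ht, add_smul, Finset.sum_add_distrib]
  | smul a s hs => simp only [map_smul, hs, Finset.smul_sum, smul_smul, smul_eq_mul]

theorem linearCoeff_componentMap_one [Finite ι] (j : ι) (t : TensorAlgebra R M) :
    linearCoeff x j (componentMap R M 1 t) = linearCoeff x j t := by
  classical
  have := Fintype.ofFinite ι
  have linearCoeff_ι (i : ι) :
      linearCoeff x j (TensorAlgebra.ι R (x i)) = if i = j then 1 else 0 := by
    simpa using linearCoeff_ι_mul x i j 1
  rw [componentMap_one_apply x, map_sum]
  simp [linearCoeff_ι]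

variable {d : ℕ}

/-- The monomial `x (w 0) * ⋯ * x (w (d - 1))` of the tensor algebra. -/
noncomputable def tensorWord (w : Fin d → ι) : TensorAlgebra R M :=
  TensorAlgebra.tprod R M d (x ∘ w)

theorem tensorWord_zero (w : Fin 0 → ι) : tensorWord x w = 1 := by
  simp [tensorWord]

theorem tensorWord_cons (i : ι) (w : Fin d → ι) :
    tensorWord x (Fin.cons i w : Fin (d + 1) → ι) = TensorAlgebra.ι R (x i) * tensorWord x w := by
  simp [tensorWord, List.ofFn_succ]

theorem tensorWord_snoc (i : ι) (w : Fin d → ι) :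
    tensorWord x (Fin.snoc w i : Fin (d + 1) → ι) = tensorWord x w * TensorAlgebra.ι R (x i) := by
  rw [tensorWord, TensorAlgebra.tprod_apply, List.ofFn_succ']
  simp [tensorWord, List.concat_eq_append]

theorem linearIndependent_tensorWord (d : ℕ) :
    LinearIndependent R (tensorWord x : (Fin d → ι) → TensorAlgebra R M) := by
  have tensorWord_eq : (tensorWord x : (Fin d → ι) → TensorAlgebra R M) =
      x.tensorAlgebra ∘ fun w => FreeMonoid.ofList (List.ofFn w) := by
    ext w
    simp [tensorWord, Module.Basis.tensorAlgebra, FreeAlgebra.basisFreeMonoid,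
      FreeAlgebra.equivMonoidAlgebraFreeMonoid, FreeMonoid.lift_apply, map_list_prod,
      List.map_ofFn, Function.comp_def]
  rw [tensorWord_eq]
  exact x.tensorAlgebra.linearIndependent.comp _ fun v w hvw => by
    simpa using List.ofFn_injective (FreeMonoid.ofList.injective hvw)

theorem diagonalHom_tensorWord (q : ι → ι → R) (i : ι) (w : Fin d → ι) :
    diagonalHom x (q i) (tensorWord x w) = wordChar q i w • tensorWord x w := by
  induction d with
  | zero => simp [tensorWord_zero, wordChar]
  | succ d ih =>
    cases w using Fin.consCases with
    | cons a w =>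
      rw [tensorWord_cons, map_mul, ih, wordChar_cons, diagonalHom_ι, smul_mul_smul_comm]

variable [Fintype ι]

/-- The homogeneous element of degree `d` whose coefficient at the monomial of a word `w` is
`a w`. -/
noncomputable def ofCoeff (d : ℕ) : ((Fin d → ι) → R) →ₗ[R] TensorAlgebra R M :=
  Fintype.linearCombination R (tensorWord x)

theorem ofCoeff_apply (a : (Fin d → ι) → R) : ofCoeff x d a = ∑ w, a w • tensorWord x w :=
  Fintype.linearCombination_apply ..

theorem ofCoeff_injective (d : ℕ) : Function.Injective (ofCoeff x d) :=
  linearIndependent_iff_injective_fintypeLinearCombination.1 (linearIndependent_tensorWord x d)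

theorem ofCoeff_succ (a : (Fin (d + 1) → ι) → R) :
    ofCoeff x (d + 1) a =
      ∑ i, TensorAlgebra.ι R (x i) * ofCoeff x d fun w => a (Fin.cons i w) := by
  simp only [ofCoeff_apply, sum_word_cons, tensorWord_cons, Finset.mul_sum, mul_smul_comm]

theorem ofCoeff_succ_right (a : (Fin (d + 1) → ι) → R) :
    ofCoeff x (d + 1) a =
      ∑ i, (ofCoeff x d fun w => a (Fin.snoc w i)) * TensorAlgebra.ι R (x i) := by
  simp only [ofCoeff_apply, sum_word_snoc, tensorWord_snoc, Finset.sum_mul, smul_mul_assoc]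

theorem componentMap_ofCoeff (a : (Fin d → ι) → R) :
    componentMap R M d (ofCoeff x d a) = ofCoeff x d a := by
  induction d with
  | zero => simp [ofCoeff_apply, tensorWord_zero, componentMap_zero_one]
  | succ d ih => simp only [ofCoeff_succ, map_sum, componentMap_succ_ι_mul, ih]

theorem exists_ofCoeff_eq_componentMap (d : ℕ) (t : TensorAlgebra R M) :
    ∃ a, ofCoeff x d a = componentMap R M d t := by
  classical
  induction t using tensorAlgebra_basis_mul_induction x generalizing d with
  | one =>
    cases d with
    | zero => exact ⟨1, by simp [ofCoeff_apply, componentMap_zero_one, tensorWord_zero]⟩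
    | succ d => exact ⟨0, by rw [map_zero, componentMap_succ_one]⟩
  | mul i s hs =>
    cases d with
    | zero => exact ⟨0, by rw [map_zero, componentMap_zero_ι_mul]⟩
    | succ d =>
      obtain ⟨a, ha⟩ := hs d
      refine ⟨fun w => if w 0 = i then a (Fin.tail w) else 0, ?_⟩
      rw [ofCoeff_succ, componentMap_succ_ι_mul, ← ha, Finset.sum_eq_single i]
      · simp
      · intro j _ hj
        simp [hj, ofCoeff_apply]
      · simp
  | add s t hs ht =>
    obtain ⟨a, ha⟩ := hs d
    obtain ⟨b, hb⟩ := ht d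
    exact ⟨a + b, by rw [map_add, map_add, ha, hb]⟩
  | smul r s hs =>
    obtain ⟨b, hb⟩ := hs d
    exact ⟨r • b, by rw [map_smul, map_smul, hb]⟩

theorem eq_zero_of_sum_mul_ι_eq_zero {t : ι → TensorAlgebra R M}
    (ht : ∀ j, componentMap R M d (t j) = t j) (hsum : ∑ j, t j * TensorAlgebra.ι R (x j) = 0)
    (j : ι) : t j = 0 := by
  have exists_coeff (j : ι) : ∃ b, ofCoeff x d b = t j := by
    rw [← ht]
    exact exists_ofCoeff_eq_componentMap x d _
  choose b hb using exists_coeff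
  have ofCoeff_eq_zero : ofCoeff x (d + 1) (fun w => b (w (Fin.last d)) (Fin.init w)) = 0 := by
    rw [ofCoeff_succ_right, ← hsum]
    exact Finset.sum_congr rfl fun j _ => by simp [← hb]
  have coeff_eq_zero := (map_eq_zero_iff _ (ofCoeff_injective x (d + 1))).1 ofCoeff_eq_zero
  have b_eq_zero : b j = 0 := by
    ext w
    simpa using congrFun coeff_eq_zero (Fin.snoc w j)
  rw [← hb, b_eq_zero, map_zero]

end Components

namespace HasBraidingMatrix

variable {ι K V : Type*} [Field K] [AddCommGroup V] [Module K V]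
  {c : V ⊗[K] V →ₗ[K] V ⊗[K] V} {x : Module.Basis ι K V} {q : ι → ι → K}

theorem componentMap_skewDer (hc : HasBraidingMatrix c x q) (j : ι) (d : ℕ)
    (t : TensorAlgebra K V) :
    componentMap K V d (skewDer c x j t) = skewDer c x j (componentMap K V (d + 1) t) := by
  classical
  induction t using tensorAlgebra_basis_mul_induction x generalizing d with
  | one => simp [componentMap_succ_one]
  | mul i s hs =>
    rw [hc.skewDer_ι_mul, map_add, componentMap_succ_ι_mul, hc.skewDer_ι_mul,
      apply_ite (componentMap K V d), map_zero, componentMap_diagonalHom]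
    congr 1
    cases d with
    | zero =>
      rw [componentMap_zero_ι_mul]
      simp [componentMap_zero_apply x, Algebra.algebraMap_eq_smul_one, skewDer_one]
    | succ d => rw [componentMap_succ_ι_mul, hs]
  | add s t hs ht => simp [hs, ht]
  | smul a s hs => simp [hs]

variable [Fintype ι] [DecidableEq ι] {d : ℕ}

theorem sum_skewDer_tensorWord_mul (hc : HasBraidingMatrix c x q) (w : Fin d → ι) :
    ∑ j, skewDer c x j (tensorWord x w) * TensorAlgebra.ι K (x j) =
      ∑ v, shuffleMatrix q d w v • tensorWord x v := by
  induction d with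
  | zero => simp [tensorWord_zero, skewDer_one, shuffleMatrix]
  | succ d ih =>
    cases w using Fin.consCases with
    | cons a w =>
      simp only [tensorWord_cons, hc.skewDer_ι_mul, add_mul, Finset.sum_add_distrib, mul_assoc,
        ← Finset.mul_sum, ih, shuffleMatrix, Matrix.add_apply, add_smul]
      congr 1
      · rw [sum_word_cons, Finset.sum_eq_single a]
        · simp [consMatrix, tensorWord_cons, Finset.mul_sum]
        · intro b _ hb
          simp [consMatrix, hb.symm]
        · simp
      · simp [rotationMatrix, weightedPermMatrix, ite_mul, ite_smul,
          rotateWord_cons, tensorWord_snoc, diagonalHom_tensorWord]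

theorem sum_skewDer_ofCoeff_mul (hc : HasBraidingMatrix c x q) (a : (Fin d → ι) → K) :
    ∑ j, skewDer c x j (ofCoeff x d a) * TensorAlgebra.ι K (x j) =
      ofCoeff x d (Matrix.vecMul a (shuffleMatrix q d)) := by
  simp only [ofCoeff_apply, map_sum, map_smul, Finset.sum_mul, smul_mul_assoc]
  rw [Finset.sum_comm]
  simp only [← Finset.smul_sum, hc.sum_skewDer_tensorWord_mul]
  simp only [Matrix.vecMul, dotProduct, Finset.sum_smul, Finset.smul_sum, smul_smul]
  rw [Finset.sum_comm]

theorem forall_skewDer_ofCoeff_eq_zero_iff (hc : HasBraidingMatrix c x q)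
    (a : (Fin (d + 1) → ι) → K) :
    (∀ j, skewDer c x j (ofCoeff x (d + 1) a) = 0) ↔
      Matrix.vecMul a (shuffleMatrix q (d + 1)) = 0 := by
  rw [← map_eq_zero_iff _ (ofCoeff_injective x (d + 1)), ← hc.sum_skewDer_ofCoeff_mul]
  refine ⟨fun h => by simp [h], fun h => eq_zero_of_sum_mul_ι_eq_zero x (d := d) (fun j => ?_) h⟩
  rw [hc.componentMap_skewDer, componentMap_ofCoeff]

end HasBraidingMatrix

/-! ### The defining ideal of the Nichols algebra -/

section TensorProduct

theorem eq_zero_of_forall_lTensor_eq_zero {R A B N κ : Type*} [CommRing R] [AddCommGroup A]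
    [Module R A] [Module.Free R A] [AddCommGroup B] [Module R B] [AddCommGroup N] [Module R N]
    {f : κ → B →ₗ[R] N} (hf : ∀ b, (∀ u, f u b = 0) → b = 0) {z : A ⊗[R] B}
    (hz : ∀ u, (f u).lTensor A z = 0) : z = 0 := by
  classical
  let 𝓐 := Module.Free.chooseBasis R A
  let coeff := TensorProduct.equivFinsuppOfBasisLeft (N := B) 𝓐
  have apply_coeff (u : κ) (k) (z : A ⊗[R] B) : f u (coeff z k) =
      TensorProduct.lid R N ((𝓐.coord k).rTensor N ((f u).lTensor A z)) := by
    rw [TensorProduct.equivFinsuppOfBasisLeft_apply]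
    induction z using TensorProduct.induction_on with
    | zero => simp
    | tmul a b => simp
    | add a b ha hb => simp only [map_add, ha, hb]
  rw [← coeff.map_eq_zero_iff]
  ext k
  exact hf _ fun u => by rw [apply_coeff, hz, map_zero, map_zero]

end TensorProduct

section SkewRadical

variable {ι K V : Type*} [Field K] [AddCommGroup V] [Module K V]
  {c : V ⊗[K] V →ₗ[K] V ⊗[K] V} {x : Module.Basis ι K V} {q : ι → ι → K}
  {t : TensorAlgebra K V}

variable (c x) in
/-- The composition of the skew derivations with respect to the letters of a word, the first letter
being applied first. -/
noncomputable def skewDerWord : List ι → Module.End K (TensorAlgebra K V)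
  | [] => LinearMap.id
  | j :: u => skewDerWord u ∘ₗ skewDer c x j

theorem skewDerWord_cons (j : ι) (u : List ι) (t : TensorAlgebra K V) :
    skewDerWord c x (j :: u) t = skewDerWord c x u (skewDer c x j t) := rfl

variable (c x) in
/-- No iterated skew derivative of `t` has a constant term. These elements form the defining ideal
of the Nichols algebra. -/
def IsSkewRadical (t : TensorAlgebra K V) : Prop :=
  ∀ u, TensorAlgebra.algebraMapInv (skewDerWord c x u t) = 0

namespace IsSkewRadical

theorem algebraMapInv_eq_zero (h : IsSkewRadical c x t) : TensorAlgebra.algebraMapInv t = 0 :=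
  h []

theorem map_skewDer (h : IsSkewRadical c x t) (j : ι) : IsSkewRadical c x (skewDer c x j t) :=
  fun u => h (j :: u)

theorem map_skewDerWord (h : IsSkewRadical c x t) (u : List ι) :
    IsSkewRadical c x (skewDerWord c x u t) := by
  induction u generalizing t with
  | nil => exact h
  | cons j _ ih => exact ih (h.map_skewDer j)

theorem map_diagonalHom (h : IsSkewRadical c x t) (hc : HasBraidingMatrix c x q) (a : ι → K) :
    IsSkewRadical c x (diagonalHom x a t) := by
  intro u
  induction u generalizing t with
  | nil => exact (algebraMapInv_diagonalHom x a t).trans h.algebraMapInv_eq_zero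
  | cons j u ih =>
    rw [skewDerWord_cons, hc.skewDer_diagonalHom, map_smul, map_smul, ih (h.map_skewDer j),
      smul_zero]

theorem mul_left (h : IsSkewRadical c x t) (hc : HasBraidingMatrix c x q)
    (s : TensorAlgebra K V) : IsSkewRadical c x (s * t) := by
  intro u
  induction u generalizing s t with
  | nil => simp [skewDerWord, h.algebraMapInv_eq_zero]
  | cons j u ih =>
    rw [skewDerWord_cons, hc.skewDer_mul, map_add, map_add, ih (h.map_skewDer j),
      ih (h.map_diagonalHom hc _), add_zero]

theorem mul_right (h : IsSkewRadical c x t) (hc : HasBraidingMatrix c x q)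
    (s : TensorAlgebra K V) : IsSkewRadical c x (t * s) := by
  intro u
  induction u generalizing s t with
  | nil => simp [skewDerWord, h.algebraMapInv_eq_zero]
  | cons j u ih =>
    rw [skewDerWord_cons, hc.skewDer_mul, map_add, map_add, ih h, ih (h.map_skewDer j), add_zero]

theorem componentMap_zero_eq_zero (h : IsSkewRadical c x t) : componentMap K V 0 t = 0 := by
  rw [componentMap_zero_apply x, h.algebraMapInv_eq_zero, map_zero]

theorem componentMap_one_eq_zero [Finite ι] (h : IsSkewRadical c x t)
    (hc : HasBraidingMatrix c x q) : componentMap K V 1 t = 0 := by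
  have := Fintype.ofFinite ι
  simp [componentMap_one_apply x, ← hc.algebraMapInv_skewDer,
    (h.map_skewDer _).algebraMapInv_eq_zero]

theorem map_componentMap (h : IsSkewRadical c x t) (hc : HasBraidingMatrix c x q) (d : ℕ) :
    IsSkewRadical c x (componentMap K V d t) := by
  intro u
  induction u generalizing d t with
  | nil =>
    cases d with
    | zero => simp [h.componentMap_zero_eq_zero]
    | succ d => exact algebraMapInv_componentMap_succ x d t
  | cons j u ih =>
    cases d with
    | zero => simp [h.componentMap_zero_eq_zero]
    | succ d =>
      rw [skewDerWord_cons, ← hc.componentMap_skewDer]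
      exact ih (h.map_skewDer j) d

end IsSkewRadical

end SkewRadical

section NicholsIdeal

variable {ι K V : Type*} [Field K] [AddCommGroup V] [Module K V]
  {c : V ⊗[K] V →ₗ[K] V ⊗[K] V} {x : Module.Basis ι K V} {q : ι → ι → K}
  {t : TensorAlgebra K V} {I : TwoSidedIdeal (TensorAlgebra K V)}

theorem mem_toSubspace : t ∈ I.toSubspace ↔ t ∈ I := by
  simp [TwoSidedIdeal.toSubspace, TwoSidedIdeal.mem_asIdeal]

/-- The ideal of the elements satisfying `IsSkewRadical`. -/
noncomputable def skewRadical (hc : HasBraidingMatrix c x q) : TwoSidedIdeal (TensorAlgebra K V) :=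
  TwoSidedIdeal.mk' {t | IsSkewRadical c x t} (fun u => by simp)
    (fun hs ht u => by rw [map_add, map_add, hs u, ht u, add_zero])
    (fun hs u => by rw [map_neg, map_neg, hs u, neg_zero])
    (fun ht => ht.mul_left hc _) (fun ht => ht.mul_right hc _)

theorem mem_skewRadical (hc : HasBraidingMatrix c x q) : t ∈ skewRadical hc ↔ IsSkewRadical c x t :=
  TwoSidedIdeal.mem_mk' ..

theorem mem_toSubspace_skewRadical (hc : HasBraidingMatrix c x q) :
    t ∈ (skewRadical hc).toSubspace ↔ IsSkewRadical c x t :=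
  mem_toSubspace.trans (mem_skewRadical hc)

theorem HasBraidingMatrix.rid_lTensor_skewDerWord_braidedComul (hc : HasBraidingMatrix c x q)
    (u : List ι) (t : TensorAlgebra K V) : TensorProduct.rid K (TensorAlgebra K V)
      ((TensorAlgebra.algebraMapInv.toLinearMap ∘ₗ skewDerWord c x u).lTensor (TensorAlgebra K V)
        (braidedComul c t)) = skewDerWord c x u t := by
  induction u generalizing t with
  | nil => exact hc.rid_lTensor_algebraMapInv_braidedComul t
  | cons j u ih =>
    rw [skewDerWord_cons, ← ih, ← hc.lTensor_skewDer_braidedComul, ← LinearMap.lTensor_comp_apply]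
    rfl

theorem map_mkQ_braidedComul_eq_zero (hc : HasBraidingMatrix c x q) (ht : IsSkewRadical c x t) :
    TensorProduct.map (skewRadical hc).toSubspace.mkQ (skewRadical hc).toSubspace.mkQ
      (braidedComul c t) = 0 := by
  set S := (skewRadical hc).toSubspace
  let functional (u : List ι) : TensorAlgebra K V →ₗ[K] K :=
    TensorAlgebra.algebraMapInv.toLinearMap ∘ₗ skewDerWord c x u
  have le_ker (u : List ι) : S ≤ LinearMap.ker (functional u) :=
    fun s hs => (mem_toSubspace_skewRadical hc).1 hs u
  refine eq_zero_of_forall_lTensor_eq_zero (f := fun u => S.liftQ _ (le_ker u)) ?_ fun u => ?_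
  · intro b hb
    obtain ⟨s, rfl⟩ := S.mkQ_surjective b
    rw [Submodule.mkQ_apply, Submodule.Quotient.mk_eq_zero]
    exact (mem_toSubspace_skewRadical hc).2 hb
  · have rid_lTensor_liftQ (z : TensorAlgebra K V ⊗[K] TensorAlgebra K V) :
        TensorProduct.rid K _ ((S.liftQ _ (le_ker u)).lTensor _
          (TensorProduct.map S.mkQ S.mkQ z)) =
        S.mkQ (TensorProduct.rid K _ ((functional u).lTensor (TensorAlgebra K V) z)) := by
      induction z using TensorProduct.induction_on with
      | zero => simp
      | tmul a b => simp
      | add a b ha hb => simp only [map_add, ha, hb]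
    rw [← (TensorProduct.rid K _).map_eq_zero_iff, rid_lTensor_liftQ,
      hc.rid_lTensor_skewDerWord_braidedComul, Submodule.mkQ_apply,
      Submodule.Quotient.mk_eq_zero]
    exact (mem_toSubspace_skewRadical hc).2 (ht.map_skewDerWord u)

theorem isNicholsCoideal_skewRadical [Finite ι] (hc : HasBraidingMatrix c x q) :
    IsNicholsCoideal c (skewRadical hc) where
  homogeneous t ht d := (mem_skewRadical hc).2 (((mem_skewRadical hc).1 ht).map_componentMap hc d)
  two_le_degree t ht d hd := by
    have radical := (mem_skewRadical hc).1 ht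
    change componentMap K V d t = 0
    interval_cases d
    · exact radical.componentMap_zero_eq_zero
    · exact radical.componentMap_one_eq_zero hc
  coideal t ht := by
    set S := (skewRadical hc).toSubspace
    have exact_mkQ : Function.Exact S.subtype S.mkQ := LinearMap.exact_subtype_mkQ S
    rw [sup_comm, ← TensorProduct.map_ker exact_mkQ S.mkQ_surjective exact_mkQ S.mkQ_surjective,
      LinearMap.mem_ker]
    exact map_mkQ_braidedComul_eq_zero hc ((mem_skewRadical hc).1 ht)

theorem rid_lTensor_mem_of_forall_eq_zero {f : TensorAlgebra K V →ₗ[K] K}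
    (hf : ∀ s ∈ I, f s = 0) {z : TensorAlgebra K V ⊗[K] TensorAlgebra K V}
    (hz : z ∈ LinearMap.range (I.toSubspace.subtype.rTensor (TensorAlgebra K V)) ⊔
      LinearMap.range (I.toSubspace.subtype.lTensor (TensorAlgebra K V))) :
    TensorProduct.rid K _ (f.lTensor (TensorAlgebra K V) z) ∈ I := by
  rw [← mem_toSubspace]
  obtain ⟨_, ⟨a, rfl⟩, _, ⟨b, rfl⟩, rfl⟩ := Submodule.mem_sup.1 hz
  clear hz
  rw [map_add, map_add]
  refine add_mem ?_ ?_
  · induction a using TensorProduct.induction_on with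
    | zero => simp
    | tmul s t => simpa using I.toSubspace.smul_mem _ s.2
    | add a b ha hb => simpa only [map_add] using add_mem ha hb
  · induction b using TensorProduct.induction_on with
    | zero => simp
    | tmul s t => simp [hf _ (mem_toSubspace.1 t.2)]
    | add a b ha hb => simpa only [map_add] using add_mem ha hb

theorem IsNicholsCoideal.skewDer_mem [Finite ι] (hI : IsNicholsCoideal c I) (ht : t ∈ I) (j : ι) :
    skewDer c x j t ∈ I := by
  refine rid_lTensor_mem_of_forall_eq_zero (fun s hs => ?_) (hI.coideal t ht)
  have component_eq_zero : componentMap K V 1 s = 0 := hI.two_le_degree s hs 1 one_lt_two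
  rw [← linearCoeff_componentMap_one, component_eq_zero, map_zero]

theorem IsNicholsCoideal.eq_bot [Fintype ι] [DecidableEq ι] (hI : IsNicholsCoideal c I)
    (hc : HasBraidingMatrix c x q) (hdet : ∀ d, (shuffleMatrix q (d + 1)).det ≠ 0) : I = ⊥ := by
  have component_eq_zero (d : ℕ) (t) (ht : t ∈ I) : componentMap K V d t = 0 := by
    induction d generalizing t with
    | zero => exact hI.two_le_degree t ht 0 two_pos
    | succ d ih =>
      obtain ⟨a, ha⟩ := exists_ofCoeff_eq_componentMap x (d + 1) t
      have skewDer_eq_zero (j : ι) : skewDer c x j (ofCoeff x (d + 1) a) = 0 := by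
        rw [ha, ← hc.componentMap_skewDer]
        exact ih _ (hI.skewDer_mem ht j)
      have vecMul_eq_zero := (hc.forall_skewDer_ofCoeff_eq_zero_iff a).1 skewDer_eq_zero
      rw [← ha, Matrix.eq_zero_of_vecMul_eq_zero (hdet d) vecMul_eq_zero, map_zero]
  refine le_bot_iff.1 fun t ht => ?_
  exact (TwoSidedIdeal.mem_bot _).2
    (eq_zero_of_componentMap_eq_zero fun d => component_eq_zero d t ht)

theorem proj_eq_zero_iff : NicholsAlgebra.proj c t = 0 ↔ t ∈ nicholsIdeal c := by
  rw [TwoSidedIdeal.mem_iff, ← RingCon.eq]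
  rfl

theorem bijective_proj_iff : Function.Bijective (NicholsAlgebra.proj c) ↔ nicholsIdeal c = ⊥ := by
  have proj_surjective : Function.Surjective (NicholsAlgebra.proj c) := RingCon.mkₐ_surjective _
  rw [Function.Bijective, and_iff_left proj_surjective, injective_iff_map_eq_zero, ← le_bot_iff]
  simp only [proj_eq_zero_iff]
  rfl

theorem HasBraidingMatrix.bijective_proj_iff_forall_det [Fintype ι] [DecidableEq ι]
    (hc : HasBraidingMatrix c x q) : Function.Bijective (NicholsAlgebra.proj c) ↔
      ∀ d, (shuffleMatrix q (d + 1)).det ≠ 0 := by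
  rw [bijective_proj_iff]
  constructor
  · intro ideal_eq_bot d det_eq_zero
    obtain ⟨a, ha, vecMul_eq_zero⟩ := Matrix.exists_vecMul_eq_zero_iff.2 det_eq_zero
    have skewDer_eq_zero := (hc.forall_skewDer_ofCoeff_eq_zero_iff a).2 vecMul_eq_zero
    have mem_radical : ofCoeff x (d + 1) a ∈ skewRadical hc := by
      rw [mem_skewRadical]
      rintro (_ | ⟨j, u⟩)
      · simp [skewDerWord, ofCoeff_succ]
      · simp [skewDerWord_cons, skewDer_eq_zero]
    have radical_le : skewRadical hc ≤ nicholsIdeal c := le_sSup (isNicholsCoideal_skewRadical hc)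
    rw [ideal_eq_bot] at radical_le
    have ofCoeff_eq_zero := (TwoSidedIdeal.mem_bot _).1 (radical_le mem_radical)
    exact ha ((map_eq_zero_iff _ (ofCoeff_injective x (d + 1))).1 ofCoeff_eq_zero)
  · intro hdet
    rw [nicholsIdeal, sSup_eq_bot]
    exact fun I hI => IsNicholsCoideal.eq_bot hI hc hdet

end NicholsIdeal

theorem theorem4p4_general {K V : Type*} [Field K] [AddCommGroup V] [Module K V] {n : ℕ}
    (c : V ⊗[K] V →ₗ[K] V ⊗[K] V) (x : Module.Basis (Fin n) K V)
    (q : Matrix (Fin n) (Fin n) K) (hc : HasBraidingMatrix c x q) :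
    Function.Bijective (NicholsAlgebra.proj c) ↔
      ∀ m : Fin n → ℕ, 2 ≤ ∑ i, m i → evalAtMatrix q (nicholsP m) ≠ 0 := by
  let evalHom : MvPolynomial (Fin n × Fin n) ℤ →+* K :=
    (MvPolynomial.aeval (R := ℤ) fun s => q s.1 s.2).toRingHom
  rw [hc.bijective_proj_iff_forall_det]
  simpa [evalHom, evalAtMatrix] using forall_det_shuffleMatrix_ne_zero_iff evalHom

theorem theorem4p4 {K V : Type*} [Field K] [AddCommGroup V] [Module K V] {n : ℕ}
    (c : V ⊗[K] V →ₗ[K] V ⊗[K] V) (x : Module.Basis (Fin n) K V)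
    (q : Matrix (Fin n) (Fin n) K) (hc : IsDiagonalBraiding c x q) :
    Function.Bijective (NicholsAlgebra.proj c) ↔
      ∀ m : Fin n → ℕ, 2 ≤ ∑ i, m i → evalAtMatrix q (nicholsP m) ≠ 0 :=
  theorem4p4_general c x q hc.braiding
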